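/- A finite web in the plane consists of finitely many nodes and finitely many straight wires, each joining two distinct nodes. It supports forces ${\bf F}=({\bf f}_1,\dots,{\bf f}_N)\in(\mathbb R^2)^N$ at the terminal points ${\bf X}=({\bf x}_1,\dots,{\bf x}_N)\in(\mathbb R^2)^N$ if the ${\bf x}_i$ are among its nodes and each wire $[{\bf p},{\bf q}]$ can be given a tension $\sigma_{{\bf p}{\bf q}}=\sigma_{{\bf q}{\bf p}}\ge 0$ so that every node ${\bf p}$ is in equilibrium: $$\sum_{i:\,{\bf x}_i={\bf p}}{\bf f}_i+\sum_{{\bf q}:\,[{\bf p},{\bf q}]\text{ is a wire}}\sigma_{{\bf p}{\bf q}}\,\frac{{\bf q}-{\bf p}}{\|{\bf q}-{\bf p}\|}={\bf 0}.$$ A loop of a web is a polygon whose edges are wires of the web. A loop is called minimal if no other wire of the web meets the inside of the polygon, and elementary if it cannot be subdivided into two loops of the web, that is, if there are no two loops of the web lying in the closed region bounded by it such that its edges are exactly the wires belonging to one but not both of them. Let $P$ be the number of points of $\{{\bf x}_1,\dots,{\bf x}_N\}$ that lie in the interior of the convex hull of $\{{\bf x}_1,\dots,{\bf x}_N\}$.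 If some finite web in the plane supports ${\bf F}$ at ${\bf X}$, then there is a finite web in the plane, in which two different wires share at most a common end point and no node lies on a wire other than as one of its end points, that supports ${\bf F}$ at ${\bf X}$ with a strictly positive tension in every wire and that has at most $P$ minimal loops and at most $P$ elementary loops. -/

import Mathlib

/-- The Euclidean plane. -/
abbrev Plane : Type := EuclideanSpace ℝ (Fin 2)

/-- A finite web in the plane: finitely many nodes, and a collection of straight wires, each joining
two distinct nodes (`graph.Adj p q` says that the segment `[p, q]` is a wire of the web). -/
structure Web where
  nodes : Finset Plane
  graph : SimpleGraph Plane
  mem_nodes : ∀ p q : Plane, graph.Adj p q → p ∈ nodes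

namespace Web

open Classical in
/-- `σ` is an admissible stress state on `W` for the forces `F` applied at the terminal nodes `X`:
the wire `[p, q]` carries the nonnegative tension `σ p q`, and every node is in equilibrium. -/
structure IsAdmissibleStress (W : Web) {N : ℕ} (X F : Fin N → Plane) (σ : Plane → Plane → ℝ) :
    Prop where
  terminal : ∀ i, X i ∈ W.nodes
  symm : ∀ p q, W.graph.Adj p q → σ p q = σ q p
  nonneg : ∀ p q, W.graph.Adj p q → 0 ≤ σ p q
  equilibrium : ∀ p ∈ W.nodes,
    (∑ i with X i = p, F i) + ∑ q ∈ W.nodes with W.graph.Adj p q, (σ p q / ‖q - p‖) • (q - p) = 0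

/-- The web `W` supports the loading `F` at the terminal nodes `X`. -/
def Supports (W : Web) {N : ℕ} (X F : Fin N → Plane) : Prop :=
  ∃ σ : Plane → Plane → ℝ, W.IsAdmissibleStress X F σ

/-- There is a node wherever wires meet: two different wires can share only a common end point, and
no node lies on a wire other than as one of its end points. -/
structure NoCrossing (W : Web) : Prop where
  wires : ∀ p q r s, W.graph.Adj p q → W.graph.Adj r s → s(p, q) ≠ s(r, s) →
    segment ℝ p q ∩ segment ℝ r s ⊆ ({p, q} : Set Plane) ∩ {r, s}
  nodes : ∀ p q, W.graph.Adj p q → ∀ x ∈ W.nodes, x ∈ segment ℝ p q → x = p ∨ x = q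

/-- A loop of the web, given by its set of edges: a polygon (closed circuit without repeated
vertices) whose edges are wires of the web. In a web without crossings it is a simple polygon. -/
def IsLoop (W : Web) (L : Set (Sym2 Plane)) : Prop :=
  ∃ (p : Plane) (c : W.graph.Walk p p), c.IsCycle ∧ L = {e | e ∈ c.edges}

/-- The closed polygonal line formed by the edges in `L`. -/
def trace (L : Set (Sym2 Plane)) : Set Plane :=
  {x | ∃ p q : Plane, s(p, q) ∈ L ∧ x ∈ segment ℝ p q}

/-- The points strictly inside the polygon with edge set `L`: those that lie in a bounded component
of the complement of the polygonal line. -/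
def inside (L : Set (Sym2 Plane)) : Set Plane :=
  {x | x ∉ trace L ∧ Bornology.IsBounded (connectedComponentIn (trace L)ᶜ x)}

/-- A minimal loop: a loop with no other wires inside the polygon. -/
def IsMinimalLoop (W : Web) (L : Set (Sym2 Plane)) : Prop :=
  W.IsLoop L ∧
    ∀ p q, W.graph.Adj p q → s(p, q) ∉ L → Disjoint (segment ℝ p q) (inside L)

/-- An elementary loop: a loop that cannot be subdivided into two subloops. Two loops that lie in
the closed region bounded by `L` subdivide it exactly when `L` consists of the edges that belong to
one of them but not to both. -/
def IsElementaryLoop (W : Web) (L : Set (Sym2 Plane)) : Prop :=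
  W.IsLoop L ∧
    ¬ ∃ L₁ L₂ : Set (Sym2 Plane), W.IsLoop L₁ ∧ W.IsLoop L₂ ∧
      trace L₁ ⊆ trace L ∪ inside L ∧ trace L₂ ⊆ trace L ∪ inside L ∧ L = symmDiff L₁ L₂

end Web

/-- The number of terminal points lying strictly inside the convex hull of all terminal points. -/
noncomputable def numInteriorTerminals {N : ℕ} (X : Fin N → Plane) : ℕ :=
  (Set.range X ∩ interior (convexHull ℝ (Set.range X))).ncard

/-! The web is replaced by a planar net whose bounded faces each claim a different interior
terminal, and then loops are charged to bounded faces.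

Cutting the wires at their crossings and end points, adding tensions where pieces coincide and
dropping slack pieces gives a net without crossings in equilibrium (`exists_isNet_of_supports`).
Among all such nets one with the least cycle rank modulo two is taken, and terminals inside wires
are made nodes at no cost. Such a net has no convex cell. Indeed, in a convex cell let `a c` be the
least tension along side `c`. Subtracting `a c` along every side kills at least one edge per side
and disturbs the corners by the forces of the polygon with side tensions `a`. The same forces are
balanced by a smaller polygon with parallel sides and the same tensions, tied to the old corners by
prongs along the corner forces. The polygon is shrunk until a side vanishes. Counting edges and
vertices, the cycle rank changes by at most the number of final sides minus the number of final
corners. Either this is negative, or the final polygon is again a convex cell, with fewer corners,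
and the step is repeated (`IsNet.shrink_cell`, `IsNet.exists_cycleRank_lt`).

A bounded face of a net without convex cells is therefore not convex (`IsFace.exists_isCell`), so by
the Tietze–Nakajima theorem (`convex_of_locally_convex`) it fails to be convex locally at some point
`x`. There all wires pull into a closed half plane and not all along its boundary, so their
resultant is not zero. Hence `x` is a terminal, the ray from `x` against the resultant starts in the
face, and `x` is interior to the hull (`IsFace.convex_or_terminal`). The terminal determines the ray
and so the face, which bounds the number of bounded faces by `P` (`encard_le_of_injOn_faces`).

Minimal and elementary loops share one property: a cycle of wires within the closed region of the
loop meets it in an even set (`IsPrimeLoop`). A face inside the loop at one of its edges has an even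
boundary, which must then contain the whole loop (`IsPrimeLoop.exists_face`), and two such loops
with the same face coincide (`IsPrimeLoop.eq_of_face`). The parity of the number of wires met by a
half line takes the role of the Jordan curve theorem throughout. -/

namespace PlaneWeb

open Set Filter Topology

/-! ### The cross product and unit vectors in the plane -/

/-- The cross product (signed area) of two vectors of the plane. -/
def cr (a b : Plane) : ℝ := a 0 * b 1 - a 1 * b 0

lemma cr_add_left (a b c : Plane) : cr (a + b) c = cr a c + cr b c := by
  simp [cr]; ring

lemma cr_add_right (a b c : Plane) : cr a (b + c) = cr a b + cr a c := by
  simp [cr]; ring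

lemma cr_sub_left (a b c : Plane) : cr (a - b) c = cr a c - cr b c := by
  simp [cr]; ring

lemma cr_sub_right (a b c : Plane) : cr a (b - c) = cr a b - cr a c := by
  simp [cr]; ring

lemma cr_smul_left (r : ℝ) (a b : Plane) : cr (r • a) b = r * cr a b := by
  simp [cr]; ring

lemma cr_smul_right (r : ℝ) (a b : Plane) : cr a (r • b) = r * cr a b := by
  simp [cr]; ring

lemma cr_neg_left (a b : Plane) : cr (-a) b = -cr a b := by
  simp [cr]; ring

lemma cr_neg_right (a b : Plane) : cr a (-b) = -cr a b := by
  simp [cr]; ring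

@[simp] lemma cr_self (a : Plane) : cr a a = 0 := by
  simp [cr]; ring

@[simp] lemma cr_zero_left (a : Plane) : cr 0 a = 0 := by
  simp [cr]

@[simp] lemma cr_zero_right (a : Plane) : cr a 0 = 0 := by
  simp [cr]

lemma cr_anticomm (a b : Plane) : cr a b = -cr b a := by
  simp [cr]; ring

/-- The Plücker relation: `u` expressed through `a` and `b`. -/
lemma cr_mul_cr (a b u x : Plane) : cr a b * cr u x = cr u b * cr a x + cr a u * cr b x := by
  simp only [cr]; ring

lemma cr_smul_eq (a b u : Plane) : cr a b • u = cr u b • a + cr a u • b := by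
  ext i
  fin_cases i <;> simp [cr] <;> ring

lemma plane_ext {a b : Plane} (h0 : a 0 = b 0) (h1 : a 1 = b 1) : a = b := by
  ext i
  fin_cases i
  · exact h0
  · exact h1

lemma exists_smul_of_cr_eq_zero {a b : Plane} (ha : a ≠ 0) (h : cr a b = 0) : ∃ r : ℝ, b = r • a := by
  simp only [cr] at h
  by_cases h0 : a 0 = 0
  · have h1 : a 1 ≠ 0 := fun h1 => ha (plane_ext h0 h1)
    refine ⟨b 1 / a 1, plane_ext ?_ ?_⟩
    · have : b 0 = 0 := by
        rw [h0] at h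
        have : a 1 * b 0 = 0 := by linarith
        simpa [h1] using this
      simp [this, h0]
    · simp; field_simp
  · refine ⟨b 0 / a 0, plane_ext ?_ ?_⟩
    · simp; field_simp
    · simp; field_simp; linarith

@[fun_prop]
lemma continuous_cr {α : Type*} [TopologicalSpace α] {f g : α → Plane} (hf : Continuous f)
    (hg : Continuous g) : Continuous fun x => cr (f x) (g x) := by
  unfold cr; fun_prop

/-- The vector rotated by a right angle counterclockwise. -/
def rot (a : Plane) : Plane := !₂[-a 1, a 0]

@[simp] lemma rot_zero_apply (a : Plane) : rot a 0 = -a 1 := rfl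
@[simp] lemma rot_one_apply (a : Plane) : rot a 1 = a 0 := rfl

lemma cr_rot_pos {a : Plane} (ha : a ≠ 0) : 0 < cr a (rot a) := by
  have : a 0 ≠ 0 ∨ a 1 ≠ 0 := by
    by_contra h
    push Not at h
    exact ha (plane_ext h.1 h.2)
  simp only [cr, rot_zero_apply, rot_one_apply]
  rcases this with h | h
  · nlinarith [mul_self_pos.2 h, mul_self_nonneg (a 1)]
  · nlinarith [mul_self_pos.2 h, mul_self_nonneg (a 0)]

/-- The unit vector in the direction of `v`. -/
noncomputable def udir (v : Plane) : Plane := ‖v‖⁻¹ • v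

@[simp] lemma udir_zero : udir 0 = 0 := by simp [udir]

lemma udir_smul {r : ℝ} (hr : 0 < r) (v : Plane) : udir (r • v) = udir v := by
  unfold udir
  rw [norm_smul, smul_smul, Real.norm_of_nonneg hr.le]
  congr 1
  field_simp

lemma udir_neg (v : Plane) : udir (-v) = -udir v := by simp [udir]

lemma norm_smul_udir (v : Plane) : ‖v‖ • udir v = v := by
  by_cases h : v = 0
  · simp [h]
  · rw [udir, smul_smul, mul_inv_cancel₀ (norm_ne_zero_iff.2 h), one_smul]

lemma udir_ne_zero {v : Plane} (h : v ≠ 0) : udir v ≠ 0 := by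
  intro h0
  have := norm_smul_udir v
  rw [h0, smul_zero] at this
  exact h this.symm

lemma cr_udir_left (v w : Plane) : cr (udir v) w = ‖v‖⁻¹ * cr v w := cr_smul_left _ _ _

/-! ### Segments, forces and tensions -/

/-- The segment joining the two members of an unordered pair. -/
def seg : Sym2 Plane → Set Plane := Sym2.lift ⟨fun p q => segment ℝ p q, segment_symm ℝ⟩

@[simp] lemma seg_mk (p q : Plane) : seg s(p, q) = segment ℝ p q := rfl

lemma mem_seg_of_mem {e : Sym2 Plane} {v : Plane} (h : v ∈ e) : v ∈ seg e := by
  induction e with | h p q =>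
  rcases Sym2.mem_iff.1 h with rfl | rfl
  · exact left_mem_segment ℝ _ _
  · exact right_mem_segment ℝ _ _

lemma isCompact_seg (e : Sym2 Plane) : IsCompact (seg e) := by
  induction e with | h p q =>
  rw [seg_mk, segment_eq_image_lineMap]
  exact isCompact_Icc.image (by fun_prop)

open Classical in
/-- The force exerted at `v` by a wire under unit tension. -/
noncomputable def pull (v : Plane) : Sym2 Plane → Plane :=
  Sym2.lift ⟨fun p q => (if v = p then udir (q - p) else 0) + (if v = q then udir (p - q) else 0),
    fun _ _ => add_comm _ _⟩

open Classical in
lemma pull_mk (v p q : Plane) : pull v s(p, q) =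
    (if v = p then udir (q - p) else 0) + (if v = q then udir (p - q) else 0) := rfl

lemma pull_left {p q : Plane} (h : p ≠ q) : pull p s(p, q) = udir (q - p) := by
  simp [pull_mk, h]

lemma pull_of_notMem {v : Plane} {e : Sym2 Plane} (h : v ∉ e) : pull v e = 0 := by
  induction e with | h p q =>
  have := Sym2.mem_iff.not.1 h
  push Not at this
  simp [pull_mk, this.1, this.2]

/-- The force exerted at `v` by all wires under the tensions `t`. -/
noncomputable def force (v : Plane) : (Sym2 Plane →₀ ℝ) →ₗ[ℝ] Plane :=
  Finsupp.linearCombination ℝ (pull v)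

lemma force_single (v : Plane) (e : Sym2 Plane) (r : ℝ) :
    force v (Finsupp.single e r) = r • pull v e := by
  simp [force]

lemma force_apply (v : Plane) (t : Sym2 Plane →₀ ℝ) : force v t = ∑ e ∈ t.support, t e • pull v e := by
  simp [force, Finsupp.linearCombination_apply, Finsupp.sum]

/-! ### The cycle space modulo two -/

section CycleSpace

variable {α : Type*}

open Classical in
/-- The incidence of an edge with a vertex, modulo two. -/
noncomputable def inc (v : α) (e : Sym2 α) : ZMod 2 := if v ∈ e then 1 else 0

/-- The space of functions on the edges `E` that have an even sum at every vertex. -/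
def cycleSpace (E : Finset (Sym2 α)) : Submodule (ZMod 2) (Sym2 α → ZMod 2) where
  carrier := {z | (∀ e ∉ E, z e = 0) ∧ ∀ v, ∑ e ∈ E, z e * inc v e = 0}
  add_mem' := by
    rintro x y ⟨h1, h2⟩ ⟨h3, h4⟩
    refine ⟨fun e he => by simp [h1 e he, h3 e he], fun v => ?_⟩
    simp only [Pi.add_apply, add_mul, Finset.sum_add_distrib, h2 v, h4 v, add_zero]
  zero_mem' := by simp
  smul_mem' := by
    rintro c x ⟨h1, h2⟩
    refine ⟨fun e he => by simp [h1 e he], fun v => ?_⟩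
    simp only [Pi.smul_apply, smul_eq_mul, mul_assoc, ← Finset.mul_sum, h2 v, mul_zero]

lemma sum_inc_of_subset {E E' : Finset (Sym2 α)} (h : E ⊆ E') {z : Sym2 α → ZMod 2}
    (hz : ∀ e ∉ E, z e = 0) (v : α) :
    ∑ e ∈ E', z e * inc v e = ∑ e ∈ E, z e * inc v e :=
  (Finset.sum_subset h fun e _ he => by rw [hz e he, zero_mul]).symm

lemma cycleSpace_mono {E E' : Finset (Sym2 α)} (h : E ⊆ E') : cycleSpace E ≤ cycleSpace E' := by
  rintro z ⟨h1, h2⟩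
  refine ⟨fun e he => h1 e fun h' => he (h h'), fun v => ?_⟩
  rw [sum_inc_of_subset h h1, h2]

instance (E : Finset (Sym2 α)) : FiniteDimensional (ZMod 2) (cycleSpace E) := by
  let f : cycleSpace E →ₗ[ZMod 2] (E → ZMod 2) :=
    { toFun := fun z e => z.1 e.1
      map_add' := fun _ _ => rfl
      map_smul' := fun _ _ => rfl }
  refine FiniteDimensional.of_injective f fun x y h => Subtype.ext (funext fun e => ?_)
  by_cases he : e ∈ E
  · exact congrFun h ⟨e, he⟩
  · rw [x.2.1 e he, y.2.1 e he]

/-- The dimension of the cycle space. -/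
noncomputable def cycleRank (E : Finset (Sym2 α)) : ℕ := Module.finrank (ZMod 2) (cycleSpace E)

/-- Adding edges that reach new vertices. -/
lemma cycleRank_add_le {E E' N : Finset (Sym2 α)} (hE : E ⊆ E') (hN : ∀ e, e ∈ N ↔ e ∈ E' ∧ e ∉ E)
    (Q : Finset α) (hQE : ∀ p ∈ Q, ∀ e ∈ E, p ∉ e) (hQ : ∀ p ∈ Q, ∃ e ∈ N, ∀ q ∈ Q, q ∈ e ↔ q = p) :
    cycleRank E' + Q.card ≤ cycleRank E + N.card := by
  classical
  obtain rfl : N = E' \ E := by ext e; rw [hN, Finset.mem_sdiff]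
  let N := E' \ E
  let R : cycleSpace E' →ₗ[ZMod 2] (N → ZMod 2) :=
    { toFun := fun z e => z.1 e.1
      map_add' := fun _ _ => rfl
      map_smul' := fun _ _ => rfl }
  let D : (N → ZMod 2) →ₗ[ZMod 2] (Q → ZMod 2) :=
    { toFun := fun b q => ∑ e : N, b e * inc q.1 e.1
      map_add' := fun x y => by
        ext q; simp [add_mul, Finset.sum_add_distrib]
      map_smul' := fun c x => by
        ext q; simp [mul_assoc, Finset.mul_sum] }
  -- An edge of `N` that meets `Q` in `p` alone makes the parity conditions at the points of `Q`
  -- independent, so they cut the dimension by `Q.card`.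
  have hD : Function.Surjective D := by
    intro y
    choose e he1 he2 using hQ
    refine ⟨∑ p : Q, y p • Pi.single (⟨e p.1 p.2, he1 p.1 p.2⟩ : N) 1, ?_⟩
    rw [map_sum]
    ext q
    have key : ∀ p : Q, D (y p • Pi.single (⟨e p.1 p.2, he1 p.1 p.2⟩ : N) 1) q
        = if p = q then y p else 0 := by
      intro p
      rw [map_smul]
      simp only [D, LinearMap.coe_mk, AddHom.coe_mk, Pi.smul_apply, smul_eq_mul]
      rw [Finset.sum_eq_single (⟨e p.1 p.2, he1 p.1 p.2⟩ : N)]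
      · simp only [Pi.single_eq_same, one_mul, inc]
        have := he2 p.1 p.2 q.1 q.2
        by_cases h : p = q
        · subst h; simp [this]
        · have h' : q.1 ≠ p.1 := fun h' => h (Subtype.ext h'.symm)
          simp [this, h, h']
      · intro b _ hb
        simp [Pi.single_eq_of_ne hb]
      · simp
    rw [Finset.sum_apply]
    simp [key]
  -- No edge of `E` reaches `Q`, so the parity of a cycle at a point of `Q` involves edges of `N`
  -- only.
  have h1 : LinearMap.range R ≤ LinearMap.ker D := by
    rintro _ ⟨z, rfl⟩
    rw [LinearMap.mem_ker]
    ext q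
    have hz := z.2.2 q.1
    rw [← Finset.sum_sdiff hE, Finset.sum_eq_zero (s := E), add_zero] at hz
    · simp only [D, R, LinearMap.coe_mk, AddHom.coe_mk, Pi.zero_apply]
      rw [← hz]
      exact Finset.sum_coe_sort (E' \ E) (fun e => z.1 e * inc q.1 e)
    · intro e he
      simp [inc, hQE q.1 q.2 e he]
  have h2 := LinearMap.finrank_range_add_finrank_ker R
  have h3 := LinearMap.finrank_range_add_finrank_ker D
  rw [LinearMap.range_eq_top.2 hD, finrank_top] at h3
  simp only [Module.finrank_pi, Fintype.card_coe] at h3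
  have h4 := Submodule.finrank_mono h1
  have h5 : Module.finrank (ZMod 2) (LinearMap.ker R) ≤ cycleRank E := by
    let f : LinearMap.ker R →ₗ[ZMod 2] cycleSpace E :=
      { toFun := fun z => ⟨z.1.1, by
          have hz : ∀ e ∉ E, z.1.1 e = 0 := by
            intro e he
            by_cases he' : e ∈ E'
            · exact congrFun z.2 ⟨e, Finset.mem_sdiff.2 ⟨he', he⟩⟩
            · exact z.1.2.1 e he'
          exact ⟨hz, fun v => by rw [← sum_inc_of_subset hE hz]; exact z.1.2.2 v⟩⟩
        map_add' := fun _ _ => rfl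
        map_smul' := fun _ _ => rfl }
    refine LinearMap.finrank_le_finrank_of_injective (f := f) fun x y h => ?_
    apply Subtype.ext
    apply Subtype.ext
    exact congrArg (fun w => w.1) h
  have h6 : cycleRank E' = Module.finrank (ZMod 2) (cycleSpace E') := rfl
  have h7 : N.card = (E' \ E).card := rfl
  omega

/-- Removing independent edges of cycles. -/
lemma cycleRank_remove_le {ι : Type*} [Fintype ι] [DecidableEq ι] {E E' : Finset (Sym2 α)} (hE : E ⊆ E')
    (e : ι → Sym2 α) (he : ∀ i, e i ∉ E)
    (z : ι → Sym2 α → ZMod 2) (hz : ∀ i, z i ∈ cycleSpace E')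
    (hze : ∀ i j, z i (e j) = if i = j then 1 else 0) :
    cycleRank E + Fintype.card ι ≤ cycleRank E' := by
  let R : cycleSpace E' →ₗ[ZMod 2] (ι → ZMod 2) :=
    { toFun := fun z i => z.1 (e i)
      map_add' := fun _ _ => rfl
      map_smul' := fun _ _ => rfl }
  -- The cycles `z i` are dual to the edges `e i`, so evaluation at these edges is onto, while the
  -- cycles of `E` lie in its kernel.
  have hR : Function.Surjective R := by
    intro y
    refine ⟨∑ i, y i • ⟨z i, hz i⟩, ?_⟩
    rw [map_sum]
    ext j
    rw [Finset.sum_apply]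
    simp [R, hze]
  have h2 := LinearMap.finrank_range_add_finrank_ker R
  rw [LinearMap.range_eq_top.2 hR, finrank_top] at h2
  simp only [Module.finrank_pi] at h2
  have h5 : cycleRank E ≤ Module.finrank (ZMod 2) (LinearMap.ker R) := by
    let f : cycleSpace E →ₗ[ZMod 2] LinearMap.ker R :=
      { toFun := fun z => ⟨⟨z.1, cycleSpace_mono hE z.2⟩, by
          rw [LinearMap.mem_ker]; ext i; exact z.2.1 _ (he i)⟩
        map_add' := fun _ _ => rfl
        map_smul' := fun _ _ => rfl }
    refine LinearMap.finrank_le_finrank_of_injective (f := f) fun x y h => ?_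
    apply Subtype.ext
    exact congrArg (fun w => w.1.1) h
  have h6 : cycleRank E' = Module.finrank (ZMod 2) (cycleSpace E') := rfl
  omega

end CycleSpace

/-! ### Subdividing segments -/

lemma mem_segment_iff_smul {a b x : Plane} :
    x ∈ segment ℝ a b ↔ ∃ θ : ℝ, 0 ≤ θ ∧ θ ≤ 1 ∧ x = a + θ • (b - a) := by
  rw [segment_eq_image']
  constructor
  · rintro ⟨θ, ⟨h0, h1⟩, rfl⟩; exact ⟨θ, h0, h1, rfl⟩
  · rintro ⟨θ, h0, h1, rfl⟩; exact ⟨θ, ⟨h0, h1⟩, rfl⟩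

lemma exists_param_of_mem_segment {a b x : Plane} (h : x ∈ segment ℝ a b) (ha : x ≠ a) (hb : x ≠ b) :
    ∃ θ : ℝ, 0 < θ ∧ θ < 1 ∧ x = a + θ • (b - a) := by
  obtain ⟨θ, h0, h1, rfl⟩ := mem_segment_iff_smul.1 h
  refine ⟨θ, lt_of_le_of_ne h0 ?_, lt_of_le_of_ne h1 ?_, rfl⟩
  · rintro rfl; simp at ha
  · rintro rfl; simp at hb

lemma mem_segment_line {x d : Plane} {a b c : ℝ} (h1 : a ≤ c) (h2 : c ≤ b) :
    x + c • d ∈ segment ℝ (x + a • d) (x + b • d) := by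
  rw [mem_segment_iff_smul]
  rcases eq_or_lt_of_le (h1.trans h2) with h | h
  · have : c = a := le_antisymm (h ▸ h2) h1
    exact ⟨0, le_rfl, zero_le_one, by simp [this]⟩
  · refine ⟨(c - a) / (b - a), div_nonneg (by linarith) (by linarith),
      (div_le_one (by linarith)).2 (by linarith), ?_⟩
    have hba : b - a ≠ 0 := by linarith
    have : x + b • d - (x + a • d) = (b - a) • d := by rw [sub_smul]; abel
    rw [this, smul_smul, div_mul_cancel₀ _ hba, sub_smul]
    abel

lemma line_injective {x d : Plane} (hd : d ≠ 0) {a b : ℝ} (h : x + a • d = x + b • d) : a = b := by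
  have : (a - b) • d = 0 := by rw [sub_smul, sub_eq_zero]; exact add_left_cancel h
  rcases smul_eq_zero.1 this with h | h
  · linarith
  · exact absurd h hd

/-- Two collinear segments that overlap, neither containing an end point of the other in its
interior, agree. -/
lemma eq_of_overlap {p q r s x : Plane} (hpq : p ≠ q) (hrs : r ≠ s) (hc : cr (q - p) (s - r) = 0)
    (hx : x ∈ segment ℝ p q) (hx' : x ∈ segment ℝ r s) (h1 : x ≠ p) (h2 : x ≠ q) (h3 : x ≠ r)
    (h4 : x ≠ s) (hr : ∀ y, y = r ∨ y = s → y ∈ segment ℝ p q → y = p ∨ y = q)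
    (hp : ∀ y, y = p ∨ y = q → y ∈ segment ℝ r s → y = r ∨ y = s) : s(p, q) = s(r, s) := by
  have hd : q - p ≠ 0 := sub_ne_zero.2 hpq.symm
  obtain ⟨l, hl⟩ := exists_smul_of_cr_eq_zero hd hc
  have hl0 : l ≠ 0 := by
    rintro rfl
    rw [zero_smul] at hl
    exact hrs (sub_eq_zero.1 hl).symm
  -- Exchanging `r` and `s` makes both segments point the same way. On the common line with origin
  -- `x` the end points then have coordinates `-α < 1 - α` and `-γl < (1 - γ)l`. On either side of
  -- `x` the nearer end point lies in the other segment, so it is an end point there as well.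
  wlog hlp : 0 < l generalizing r s l
  · rw [Sym2.eq_swap (a := r)]
    refine this hrs.symm ?_ (by rwa [segment_symm]) h4 h3 (fun y hy => hr y hy.symm)
      (fun y hy hy' => (hp y hy (by rwa [segment_symm])).symm) (-l) ?_ (neg_ne_zero.2 hl0) ?_
    · rw [← neg_sub s r, cr_neg_right, hc, neg_zero]
    · rw [← neg_sub s r, hl, neg_smul]
    · have := lt_of_le_of_ne (not_lt.1 hlp) hl0
      linarith
  obtain ⟨α, ha0, ha1, hxa⟩ := exists_param_of_mem_segment hx h1 h2
  obtain ⟨γ, hg0, hg1, hxg⟩ := exists_param_of_mem_segment hx' h3 h4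
  rw [hl] at hxg
  set d := q - p with hd'
  have ep : p = x + (-α) • d := by rw [hxa, neg_smul]; abel
  have eq : q = x + (1 - α) • d := by rw [hxa, sub_smul, one_smul, hd']; abel
  have er : r = x + (-(γ * l)) • d := by rw [hxg, neg_smul, smul_smul]; abel
  have es : s = x + ((1 - γ) * l) • d := by
    have : s = r + l • d := by rw [← hl]; abel
    rw [this, er, add_assoc, ← add_smul]; congr 2; ring
  have hgl : 0 < γ * l := by positivity
  have hgl' : 0 < (1 - γ) * l := mul_pos (by linarith) hlp
  have e1 : p = r := by
    rcases le_total (γ * l) α with h | h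
    · have : r ∈ segment ℝ p q := by
        rw [er, ep, eq]; exact mem_segment_line (by linarith) (by linarith)
      rcases hr r (Or.inl rfl) this with h' | h'
      · exact h'.symm
      · rw [er, eq] at h'
        have := line_injective hd h'
        linarith
    · have : p ∈ segment ℝ r s := by
        rw [er, ep, es]; exact mem_segment_line (by linarith) (by linarith)
      rcases hp p (Or.inl rfl) this with h' | h'
      · exact h'
      · rw [ep, es] at h'
        have := line_injective hd h'
        linarith
  have e2 : q = s := by
    rcases le_total ((1 - γ) * l) (1 - α) with h | h
    · have : s ∈ segment ℝ p q := by
        rw [es, ep, eq]; exact mem_segment_line (by linarith) (by linarith)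
      rcases hr s (Or.inr rfl) this with h' | h'
      · rw [es, ep] at h'
        have := line_injective hd h'
        linarith
      · exact h'.symm
    · have : q ∈ segment ℝ r s := by
        rw [er, eq, es]; exact mem_segment_line (by linarith) (by linarith)
      rcases hp q (Or.inr rfl) this with h' | h'
      · rw [eq, er] at h'
        have := line_injective hd h'
        linarith
      · exact h'
  rw [e1, e2]

open Classical in
-- At the inner point the two unit pulls cancel, and at the ends the directions are unchanged. Hence
-- subdividing a wire at equal tension preserves all forces.
lemma pull_add_pull {a b v : Plane} {θ : ℝ} (h0 : 0 < θ) (h1 : θ < 1) (hv : v = a + θ • (b - a))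
    (x : Plane) : pull x s(a, v) + pull x s(v, b) = pull x s(a, b) := by
  have e1 : udir (v - a) = udir (b - a) := by
    rw [hv, add_sub_cancel_left, udir_smul h0]
  have e2 : udir (b - v) = udir (b - a) := by
    have : b - v = (1 - θ) • (b - a) := by rw [hv, sub_smul, one_smul]; abel
    rw [this, udir_smul (by linarith)]
  have e3 : udir (a - v) = -udir (b - a) := by rw [← neg_sub, udir_neg, e1]
  have e4 : udir (v - b) = -udir (b - a) := by rw [← neg_sub, udir_neg, e2]
  have e5 : udir (a - b) = -udir (b - a) := by rw [← neg_sub, udir_neg]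
  simp only [pull_mk, e1, e2, e3, e4, e5]
  split_ifs <;> simp

lemma inc_add_inc {α : Type*} {a b v : α} (hav : a ≠ v) (hvb : v ≠ b) (hab : a ≠ b) (x : α) :
    inc x s(a, v) + inc x s(v, b) = inc x s(a, b) := by
  classical
  simp only [inc, Sym2.mem_iff]
  by_cases h1 : x = a
  · subst h1; simp [hav, hab]
  · by_cases h2 : x = v
    · subst h2; simp [h1, hvb]; decide
    · simp [h1, h2]

/-- A segment is subdivided by the points of a finite set `V` that it contains. -/
lemma exists_chain (V : Finset Plane) (a b : Plane) (hab : a ≠ b) (ha : a ∈ V) (hb : b ∈ V) :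
    ∃ G : Finset (Sym2 Plane),
      (∀ f ∈ G, ¬ f.IsDiag ∧ seg f ⊆ segment ℝ a b ∧ (∀ x ∈ f, x ∈ V) ∧ ∀ x ∈ V, x ∈ seg f → x ∈ f) ∧
      (∀ x, ∑ f ∈ G, pull x f = pull x s(a, b)) ∧ ∀ x, ∑ f ∈ G, inc x f = inc x s(a, b) := by
  classical
  -- Splitting at a point of `V` inside the segment leaves fewer points of `V` inside each half.
  induction hn : (V.filter fun v => v ∈ openSegment ℝ a b).card using Nat.strong_induction_on
    generalizing a b with | _ n ih =>
  by_cases hv : ∃ v ∈ V, v ∈ segment ℝ a b ∧ v ≠ a ∧ v ≠ b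
  · obtain ⟨v, hvV, hvs, hva, hvb⟩ := hv
    obtain ⟨θ, h0, h1, hθ⟩ := exists_param_of_mem_segment hvs hva hvb
    have hvo : v ∈ openSegment ℝ a b := mem_openSegment_of_ne_left_right hva.symm hvb.symm hvs
    have hd : b - a ≠ 0 := sub_ne_zero.2 hab.symm
    have ea : a = a + (0 : ℝ) • (b - a) := by simp
    have eb : b = a + (1 : ℝ) • (b - a) := by simp
    have s1 : segment ℝ a v ⊆ segment ℝ a b :=
      (convex_segment a b).segment_subset (left_mem_segment ℝ _ _) hvs
    have s2 : segment ℝ v b ⊆ segment ℝ a b :=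
      (convex_segment a b).segment_subset hvs (right_mem_segment ℝ _ _)
    have o1 : openSegment ℝ a v ⊆ openSegment ℝ a b := by
      intro x hx
      rw [openSegment_eq_image'] at hx ⊢
      obtain ⟨μ, ⟨m0, m1⟩, rfl⟩ := hx
      refine ⟨μ * θ, ⟨by positivity, by nlinarith⟩, ?_⟩
      simp only [hθ, add_sub_cancel_left, smul_smul]
    have o2 : openSegment ℝ v b ⊆ openSegment ℝ a b := by
      intro x hx
      rw [openSegment_eq_image'] at hx ⊢
      obtain ⟨μ, ⟨m0, m1⟩, rfl⟩ := hx
      refine ⟨θ + μ * (1 - θ), ⟨by nlinarith, by nlinarith⟩, ?_⟩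
      have : b - v = (1 - θ) • (b - a) := by rw [hθ, sub_smul, one_smul]; abel
      simp only [this, smul_smul, add_smul]
      rw [hθ]; abel
    have n1 : v ∉ openSegment ℝ a v := fun h => hva (right_mem_openSegment_iff.1 h).symm
    have n2 : v ∉ openSegment ℝ v b := fun h => hvb (left_mem_openSegment_iff.1 h)
    obtain ⟨G₁, g1, g2, g3⟩ := ih _ (by
      rw [← hn]
      refine Finset.card_lt_card ⟨fun x hx => ?_, fun h => n1 ?_⟩
      · simp only [Finset.mem_filter] at hx ⊢; exact ⟨hx.1, o1 hx.2⟩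
      · exact (Finset.mem_filter.1 (h (Finset.mem_filter.2 ⟨hvV, hvo⟩))).2) a v hva.symm ha hvV rfl
    obtain ⟨G₂, k1, k2, k3⟩ := ih _ (by
      rw [← hn]
      refine Finset.card_lt_card ⟨fun x hx => ?_, fun h => n2 ?_⟩
      · simp only [Finset.mem_filter] at hx ⊢; exact ⟨hx.1, o2 hx.2⟩
      · exact (Finset.mem_filter.1 (h (Finset.mem_filter.2 ⟨hvV, hvo⟩))).2) v b hvb hvV hb rfl
    -- The halves meet in `v` only, so an edge of both chains would have `v` as both its ends.
    have hdisj : Disjoint G₁ G₂ := by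
      rw [Finset.disjoint_left]
      intro f hf1 hf2
      have key : ∀ x ∈ f, x = v := by
        intro x hx
        obtain ⟨μ, m0, m1, e1⟩ := mem_segment_iff_smul.1 ((g1 f hf1).2.1 (mem_seg_of_mem hx))
        obtain ⟨η, t0, t1, e2⟩ := mem_segment_iff_smul.1 ((k1 f hf2).2.1 (mem_seg_of_mem hx))
        have e3 : b - v = (1 - θ) • (b - a) := by rw [hθ, sub_smul, one_smul]; abel
        rw [e3, hθ, smul_smul, add_assoc, ← add_smul] at e2
        rw [hθ, add_sub_cancel_left, smul_smul, e2] at e1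
        have e4 := line_injective hd e1
        have e5 : θ + η * (1 - θ) = θ := by nlinarith
        rw [e2, e5, hθ]
      have := (g1 f hf1).1
      induction f with | h p q =>
      apply this
      rw [Sym2.mk_isDiag_iff, key p (by simp), key q (by simp)]
    refine ⟨G₁ ∪ G₂, ?_, ?_, ?_⟩
    · intro f hf
      rcases Finset.mem_union.1 hf with hf | hf
      · exact ⟨(g1 f hf).1, (g1 f hf).2.1.trans s1, (g1 f hf).2.2⟩
      · exact ⟨(k1 f hf).1, (k1 f hf).2.1.trans s2, (k1 f hf).2.2⟩
    · intro x
      rw [Finset.sum_union hdisj, g2, k2, pull_add_pull h0 h1 hθ]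
    · intro x
      rw [Finset.sum_union hdisj, g3, k3, inc_add_inc hva.symm hvb hab]
  · push Not at hv
    refine ⟨{s(a, b)}, ?_, by simp, by simp⟩
    intro f hf
    rw [Finset.mem_singleton] at hf
    subst hf
    refine ⟨by simpa using hab, le_rfl, ?_, ?_⟩
    · intro x hx
      rcases Sym2.mem_iff.1 hx with rfl | rfl <;> assumption
    · intro x hxV hx
      by_contra h
      rw [Sym2.mem_iff, not_or] at h
      exact h.2 (hv x hxV hx h.1)

/-! ### Plane nets in equilibrium -/

/-- Distinct edges share at most a common end point. -/
structure NonCrossing (E : Finset (Sym2 Plane)) : Prop where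
  not_isDiag : ∀ e ∈ E, ¬ e.IsDiag
  mem : ∀ e ∈ E, ∀ f ∈ E, e ≠ f → ∀ x ∈ seg e, x ∈ seg f → x ∈ e

/-- The tensions `t` balance the forces `F` at the points `X`, in a net without crossings. -/
structure IsNet {N : ℕ} (X F : Fin N → Plane) (t : Sym2 Plane →₀ ℝ) : Prop where
  pos : ∀ e ∈ t.support, 0 < t e
  nonCrossing : NonCrossing t.support
  balance : ∀ v, (∑ i with X i = v, F i) + force v t = 0

lemma finite_crossings (E : Finset (Sym2 Plane)) :
    {x | ∃ e ∈ E, ∃ f ∈ E, x ∈ seg e ∧ x ∈ seg f ∧ (seg e ∩ seg f).Subsingleton}.Finite := by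
  have : {x | ∃ e ∈ E, ∃ f ∈ E, x ∈ seg e ∧ x ∈ seg f ∧ (seg e ∩ seg f).Subsingleton} ⊆
      ⋃ e ∈ E, ⋃ f ∈ E, {x | x ∈ seg e ∩ seg f ∧ (seg e ∩ seg f).Subsingleton} := by
    rintro x ⟨e, he, f, hf, h1, h2, h3⟩
    simp only [mem_iUnion]
    exact ⟨e, he, f, hf, ⟨h1, h2⟩, h3⟩
  refine Set.Finite.subset ?_ this
  refine E.finite_toSet.biUnion fun e _ => E.finite_toSet.biUnion fun f _ => ?_
  by_cases h : (seg e ∩ seg f).Subsingleton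
  · exact h.finite.subset fun x hx => hx.1
  · convert Set.finite_empty
    ext x; simp [h]

lemma subsingleton_inter_of_cr_ne {p q r s : Plane} (h : cr (q - p) (s - r) ≠ 0) :
    (segment ℝ p q ∩ segment ℝ r s).Subsingleton := by
  rintro x ⟨hx1, hx2⟩ y ⟨hy1, hy2⟩
  obtain ⟨a, -, -, rfl⟩ := mem_segment_iff_smul.1 hx1
  obtain ⟨b, -, -, rfl⟩ := mem_segment_iff_smul.1 hy1
  obtain ⟨c, -, -, hc⟩ := mem_segment_iff_smul.1 hx2
  obtain ⟨d, -, -, hd⟩ := mem_segment_iff_smul.1 hy2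
  have h1 : (a - b) • (q - p) = (c - d) • (s - r) := by
    have : (p + a • (q - p)) - (p + b • (q - p)) = (r + c • (s - r)) - (r + d • (s - r)) := by
      rw [hc, hd]
    rw [sub_smul, sub_smul]
    rw [add_sub_add_left_eq_sub, add_sub_add_left_eq_sub] at this
    exact this
  have h2 : (a - b) * cr (q - p) (s - r) = 0 := by
    rw [← cr_smul_left, h1, cr_smul_left, cr_self, mul_zero]
  have : a = b := by
    rcases mul_eq_zero.1 h2 with h3 | h3
    · linarith
    · exact absurd h3 h
  rw [this]

lemma sub_eq_smul_of_mem_segment {p q x y : Plane} (hx : x ∈ segment ℝ p q)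
    (hy : y ∈ segment ℝ p q) : ∃ c : ℝ, y - x = c • (q - p) := by
  obtain ⟨a, -, -, rfl⟩ := mem_segment_iff_smul.1 hx
  obtain ⟨b, -, -, rfl⟩ := mem_segment_iff_smul.1 hy
  exact ⟨b - a, by rw [sub_smul]; abel⟩

lemma pull_diag (v p : Plane) : pull v s(p, p) = 0 := by
  simp [pull_mk]

/-- Every nonnegative system of tensions can be rearranged into a net without crossings. -/
lemma exists_isNet_of_tensions {N : ℕ} (X F : Fin N → Plane) (t : Sym2 Plane →₀ ℝ)
    (hpos : ∀ e, 0 ≤ t e) (hbal : ∀ v, (∑ i with X i = v, F i) + force v t = 0) :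
    ∃ t', IsNet X F t' := by
  classical
  set E := t.support.filter fun e => ¬ e.IsDiag with hE
  -- All end points, and all common points of pairs of segments that meet in a single point.
  -- Overlapping segments need nothing more: both are cut at the end points of the other, so their
  -- chains agree on the overlap.
  set V : Finset Plane := (finite_crossings E).toFinset ∪ E.biUnion fun e => e.toFinset with hV
  have hmemV : ∀ e ∈ E, ∀ x ∈ e, x ∈ V := by
    intro e he x hx
    exact Finset.mem_union_right _ (Finset.mem_biUnion.2 ⟨e, he, Sym2.mem_toFinset.2 hx⟩)
  have hchain : ∀ e ∈ E, ∃ G : Finset (Sym2 Plane),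
      (∀ f ∈ G, ¬ f.IsDiag ∧ seg f ⊆ seg e ∧ (∀ x ∈ f, x ∈ V) ∧ ∀ x ∈ V, x ∈ seg f → x ∈ f) ∧
      (∀ x, ∑ f ∈ G, pull x f = pull x e) := by
    intro e he
    induction e with | h a b =>
    have hab : a ≠ b := by simpa using (Finset.mem_filter.1 he).2
    obtain ⟨G, h1, h2, -⟩ := exists_chain V a b hab (hmemV _ he a (by simp)) (hmemV _ he b (by simp))
    exact ⟨G, h1, h2⟩
  choose! G hG1 hG2 using hchain
  -- A piece that arises from several wires carries the sum of their tensions.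
  set t' : Sym2 Plane →₀ ℝ := ∑ e ∈ E, t e • ∑ f ∈ G e, Finsupp.single f 1 with ht'
  have happ : ∀ f, t' f = ∑ e ∈ E, t e * (if f ∈ G e then 1 else 0) := by
    intro f
    rw [ht', Finsupp.finsetSum_apply]
    refine Finset.sum_congr rfl fun e _ => ?_
    rw [Finsupp.smul_apply, Finsupp.finsetSum_apply, smul_eq_mul]
    congr 1
    simp [Finsupp.single_apply]
  have hsupp : ∀ f ∈ t'.support, ∃ e ∈ E, f ∈ G e := by
    intro f hf
    by_contra h
    push Not at h
    apply Finsupp.mem_support_iff.1 hf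
    rw [happ]
    exact Finset.sum_eq_zero fun e he => by simp [h e he]
  refine ⟨t', ?_, ⟨?_, ?_⟩, ?_⟩
  · intro f hf
    refine lt_of_le_of_ne ?_ (Finsupp.mem_support_iff.1 hf).symm
    rw [happ]
    exact Finset.sum_nonneg fun e _ => mul_nonneg (hpos e) (by split_ifs <;> norm_num)
  · intro f hf
    obtain ⟨e, he, hfe⟩ := hsupp f hf
    exact (hG1 e he f hfe).1
  · intro f hf f' hf' hne x hx hx'
    obtain ⟨e, he, hfe⟩ := hsupp f hf
    obtain ⟨e', he', hfe'⟩ := hsupp f' hf'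
    obtain ⟨k1, k2, k3, k4⟩ := hG1 e he f hfe
    obtain ⟨l1, l2, l3, l4⟩ := hG1 e' he' f' hfe'
    by_cases hxV : x ∈ V
    · exact k4 x hxV hx
    exfalso
    -- A common point outside `V` cannot be the only common point of the two old wires. They are
    -- then collinear, and `eq_of_overlap` identifies the pieces.
    have hns : ¬ (seg e ∩ seg e').Subsingleton := fun h => hxV <| Finset.mem_union_left _ <|
      (Set.Finite.mem_toFinset _).2 ⟨e, he, e', he', k2 hx, l2 hx', h⟩
    induction e with | h p q =>
    induction e' with | h r s =>
    induction f with | h p' q' =>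
    induction f' with | h r' s' =>
    have hc : cr (q - p) (s - r) = 0 := by
      by_contra h
      exact hns (subsingleton_inter_of_cr_ne h)
    obtain ⟨c, hc1⟩ := sub_eq_smul_of_mem_segment (k2 (left_mem_segment ℝ p' q'))
      (k2 (right_mem_segment ℝ p' q'))
    obtain ⟨d, hd1⟩ := sub_eq_smul_of_mem_segment (l2 (left_mem_segment ℝ r' s'))
      (l2 (right_mem_segment ℝ r' s'))
    refine hne (eq_of_overlap (x := x) (by simpa using k1) (by simpa using l1) ?_ hx hx' ?_ ?_ ?_ ?_
      (fun y hy hy' => ?_) (fun y hy hy' => ?_))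
    · rw [hc1, hd1, cr_smul_left, cr_smul_right, hc, mul_zero, mul_zero]
    · rintro rfl; exact hxV (k3 _ (by simp))
    · rintro rfl; exact hxV (k3 _ (by simp))
    · rintro rfl; exact hxV (l3 _ (by simp))
    · rintro rfl; exact hxV (l3 _ (by simp))
    · exact Sym2.mem_iff.1 (k4 y (l3 y (Sym2.mem_iff.2 hy)) hy')
    · exact Sym2.mem_iff.1 (l4 y (k3 y (Sym2.mem_iff.2 hy)) hy')
  · intro v
    rw [← hbal v]
    congr 1
    rw [ht', map_sum, force_apply]
    have h1 : ∑ e ∈ t.support, t e • pull v e = ∑ e ∈ E, t e • pull v e := by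
      symm
      refine Finset.sum_subset (Finset.filter_subset _ _) fun e he he' => ?_
      have : e.IsDiag := by
        by_contra h
        exact he' (Finset.mem_filter.2 ⟨he, h⟩)
      induction e with | h p q =>
      rw [Sym2.mk_isDiag_iff] at this
      rw [this, pull_diag, smul_zero]
    rw [h1]
    refine Finset.sum_congr rfl fun e he => ?_
    rw [map_smul, map_sum, ← hG2 e he v]
    simp [force_single]

/-- The subdivision of a web supporting the forces. -/
lemma exists_isNet_of_supports {N : ℕ} (X F : Fin N → Plane) (W : Web) (hW : W.Supports X F) :
    ∃ t, IsNet X F t := by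
  classical
  obtain ⟨σ, hσ⟩ := hW
  -- The stress is symmetric on wires only and arbitrary elsewhere. The average is a function of the
  -- unordered pair that agrees with it on the wires.
  set g : Sym2 Plane → ℝ := Sym2.lift ⟨fun p q => if W.graph.Adj p q then (σ p q + σ q p) / 2 else 0,
    fun p q => by simp only [W.graph.adj_comm p q, add_comm (σ p q)]⟩ with hg
  set S : Finset (Sym2 Plane) := (W.nodes ×ˢ W.nodes).image fun x => s(x.1, x.2) with hS
  have hgmk : ∀ p q, g s(p, q) = if W.graph.Adj p q then σ p q else 0 := by
    intro p q
    simp only [hg, Sym2.lift_mk]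
    split_ifs with h
    · rw [hσ.symm p q h]; ring
    · rfl
  have hgS : ∀ e, g e ≠ 0 → e ∈ S := by
    intro e he
    induction e with | h p q =>
    rw [hgmk] at he
    have h : W.graph.Adj p q := by
      by_contra h
      exact he (if_neg h)
    exact Finset.mem_image.2 ⟨(p, q), Finset.mem_product.2
      ⟨W.mem_nodes _ _ h, W.mem_nodes _ _ h.symm⟩, rfl⟩
  set t : Sym2 Plane →₀ ℝ := Finsupp.onFinset S g hgS with ht
  refine exists_isNet_of_tensions X F t ?_ ?_
  · intro e
    induction e with | h p q =>
    simp only [ht, Finsupp.onFinset_apply, hgmk]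
    split_ifs with h
    · exact hσ.nonneg p q h
    · exact le_rfl
  · intro v
    have hadj : ∀ p q, W.graph.Adj p q → p ≠ q := fun p q h => h.ne
    have h1 : force v t = ∑ e ∈ S, g e • pull v e := by
      rw [force_apply]
      refine Finset.sum_subset Finsupp.support_onFinset_subset fun e _ he => ?_
      rw [Finsupp.notMem_support_iff] at he
      rw [he, zero_smul]
    have h2 : ∑ e ∈ S, g e • pull v e = ∑ e ∈ S with v ∈ e, g e • pull v e := by
      symm
      refine Finset.sum_subset (Finset.filter_subset _ _) fun e he he' => ?_
      rw [pull_of_notMem fun h => he' (Finset.mem_filter.2 ⟨he, h⟩), smul_zero]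
    by_cases hv : v ∈ W.nodes
    · rw [← hσ.equilibrium v hv, h1, h2]
      congr 1
      have h3 : (S.filter fun e => v ∈ e) = W.nodes.image fun q => s(v, q) := by
        ext e
        simp only [hS, Finset.mem_filter, Finset.mem_image, Finset.mem_product, Prod.exists]
        constructor
        · rintro ⟨⟨p, q, ⟨hp, hq⟩, rfl⟩, hve⟩
          rcases Sym2.mem_iff.1 hve with rfl | rfl
          · exact ⟨q, hq, rfl⟩
          · exact ⟨p, hp, Sym2.eq_swap⟩
        · rintro ⟨q, hq, rfl⟩
          exact ⟨⟨v, q, ⟨hv, hq⟩, rfl⟩, by simp⟩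
      rw [h3, Finset.sum_image (fun a _ b _ h => Sym2.congr_right.1 h), Finset.sum_filter]
      refine Finset.sum_congr rfl fun q _ => ?_
      rw [hgmk]
      split_ifs with h
      · rw [pull_left h.ne, udir, smul_smul, div_eq_mul_inv]
      · rw [zero_smul]
    · have h4 : ∑ i with X i = v, F i = 0 := by
        refine Finset.sum_eq_zero fun i hi => absurd ((Finset.mem_filter.1 hi).2 ▸ hσ.terminal i) hv
      rw [h4, zero_add, h1, h2]
      refine Finset.sum_eq_zero fun e he => ?_
      obtain ⟨he1, he2⟩ := Finset.mem_filter.1 he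
      exfalso
      obtain ⟨⟨p, q⟩, hpq, rfl⟩ := Finset.mem_image.1 he1
      rw [Finset.mem_product] at hpq
      rcases Sym2.mem_iff.1 he2 with rfl | rfl
      · exact hv hpq.1
      · exact hv hpq.2

/-- A point inside a wire is made a node. -/
lemma exists_isNet_insert {N : ℕ} {X F : Fin N → Plane} {t : Sym2 Plane →₀ ℝ} (ht : IsNet X F t)
    {e₀ : Sym2 Plane} (he₀ : e₀ ∈ t.support) {p : Plane} (hp : p ∈ seg e₀) (hpe : p ∉ e₀) :
    ∃ t', IsNet X F t' ∧ cycleRank t'.support ≤ cycleRank t.support ∧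
      (∀ e ∈ t'.support, ∀ x ∈ seg e, x ∉ e → ∃ f ∈ t.support, x ∈ seg f ∧ x ∉ f) ∧
      ∀ e ∈ t'.support, p ∈ seg e → p ∈ e := by
  classical
  induction e₀ with | h a b =>
  have hab : a ≠ b := by simpa using ht.nonCrossing.not_isDiag _ he₀
  have hpa : p ≠ a := fun h => hpe (by simp [h])
  have hpb : p ≠ b := fun h => hpe (by simp [h])
  obtain ⟨θ, h0, h1, hθ⟩ := exists_param_of_mem_segment hp hpa hpb
  have hnew : ∀ e ∈ t.support, p ∉ e := by
    intro e he hpe'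
    by_cases h : e = s(a, b)
    · exact hpe (h ▸ hpe')
    · exact hpe (ht.nonCrossing.mem _ he₀ _ he (Ne.symm h) p hp (mem_seg_of_mem hpe'))
  have hs1 : segment ℝ a p ⊆ segment ℝ a b :=
    (convex_segment a b).segment_subset (left_mem_segment ℝ _ _) hp
  have hs2 : segment ℝ p b ⊆ segment ℝ a b :=
    (convex_segment a b).segment_subset hp (right_mem_segment ℝ _ _)
  have hd : b - a ≠ 0 := sub_ne_zero.2 hab.symm
  have hinter : ∀ x ∈ segment ℝ a p, x ∈ segment ℝ p b → x = p := by
    intro x hx hx'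
    obtain ⟨μ, m0, m1, e1⟩ := mem_segment_iff_smul.1 hx
    obtain ⟨η, t0, t1, e2⟩ := mem_segment_iff_smul.1 hx'
    have e3 : b - p = (1 - θ) • (b - a) := by rw [hθ, sub_smul, one_smul]; abel
    rw [e3, hθ, smul_smul, add_assoc, ← add_smul] at e2
    rw [hθ, add_sub_cancel_left, smul_smul, e2] at e1
    have e4 := line_injective hd e1
    have e5 : θ + η * (1 - θ) = θ := by nlinarith
    rw [e2, e5, hθ]
  set r := t s(a, b) with hr
  have hrpos : 0 < r := ht.pos _ he₀
  have n1 : s(a, p) ∉ t.support := fun h => hnew _ h (by simp)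
  have n2 : s(p, b) ∉ t.support := fun h => hnew _ h (by simp)
  have n3 : s(a, p) ≠ s(p, b) := by
    intro h
    have : a ∈ s(p, b) := h ▸ Sym2.mem_mk_left a p
    rcases Sym2.mem_iff.1 this with h | h
    · exact hpa h.symm
    · exact hab h
  have n4 : s(a, b) ≠ s(a, p) := fun h => n1 (h ▸ he₀)
  have n5 : s(a, b) ≠ s(p, b) := fun h => n2 (h ▸ he₀)
  set t' : Sym2 Plane →₀ ℝ := t - Finsupp.single s(a, b) r + Finsupp.single s(a, p) r +
    Finsupp.single s(p, b) r with ht'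
  have happ : ∀ e, t' e = if e = s(a, p) ∨ e = s(p, b) then r else if e = s(a, b) then 0 else t e := by
    intro e
    simp only [ht', Finsupp.add_apply, Finsupp.sub_apply, Finsupp.single_apply]
    by_cases e1 : e = s(a, p)
    · subst e1
      simp [n3.symm, n4, Finsupp.notMem_support_iff.1 n1]
    by_cases e2 : e = s(p, b)
    · subst e2
      simp [n3, n5, Finsupp.notMem_support_iff.1 n2]
    by_cases e3 : e = s(a, b)
    · subst e3
      simp [e1, e2, Ne.symm e1, Ne.symm e2, hr]
    · simp [e1, e2, e3, Ne.symm e1, Ne.symm e2, Ne.symm e3]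
  have hsupp : t'.support = insert s(a, p) (insert s(p, b) (t.support.erase s(a, b))) := by
    ext e
    rw [Finsupp.mem_support_iff, happ]
    simp only [Finset.mem_insert, Finset.mem_erase, Finsupp.mem_support_iff]
    by_cases e1 : e = s(a, p)
    · simp [e1, hrpos.ne']
    by_cases e2 : e = s(p, b)
    · simp [e2, hrpos.ne']
    by_cases e3 : e = s(a, b)
    · simp [e3, n4, n5]
    · simp [e1, e2, e3]
  have hcase : ∀ e ∈ t'.support, e = s(a, p) ∨ e = s(p, b) ∨ e ≠ s(a, b) ∧ e ∈ t.support := by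
    intro e he
    rw [hsupp] at he
    simpa [Finset.mem_insert, Finset.mem_erase] using he
  have hold : ∀ e, e ≠ s(a, b) → e ∈ t.support → ∀ x ∈ segment ℝ a b, x ∈ seg e →
      x ∈ e ∧ (x = a ∨ x = b) := fun e h1 h2 x hx hx' =>
    ⟨ht.nonCrossing.mem e h2 _ he₀ h1 x hx' hx,
      Sym2.mem_iff.1 (ht.nonCrossing.mem _ he₀ e h2 h1.symm x hx hx')⟩
  have hx1 : ∀ x ∈ segment ℝ a p, x = a ∨ x = b → x = a := by
    rintro x hx (h | h)
    · exact h
    · subst h; exact absurd (hinter x hx (right_mem_segment ℝ _ _)).symm hpb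
  have hx2 : ∀ x ∈ segment ℝ p b, x = a ∨ x = b → x = b := by
    rintro x hx (h | h)
    · subst h; exact absurd (hinter x (left_mem_segment ℝ _ _) hx).symm hpa
    · exact h
  refine ⟨t', ⟨?_, ⟨?_, ?_⟩, ?_⟩, ?_, ?_, ?_⟩
  · intro e he
    rw [happ]
    rcases hcase e he with h | h | ⟨h, h'⟩
    · simpa [h] using hrpos
    · simpa [h] using hrpos
    · split_ifs
      · exact hrpos
      · exact ht.pos e h'
  · intro e he
    rcases hcase e he with h | h | ⟨h, h'⟩
    · subst h; simpa using hpa.symm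
    · subst h; simpa using hpb
    · exact ht.nonCrossing.not_isDiag e h'
  · intro e he f hf hne x hx hx'
    rcases hcase e he with h | h | ⟨h, h'⟩ <;> rcases hcase f hf with k | k | ⟨k, k'⟩
    · exact absurd (h.trans k.symm) hne
    · subst h k; rw [hinter x hx hx']; simp
    · subst h; rw [hx1 x hx (hold f k k' x (hs1 hx) hx').2]; simp
    · subst h k; rw [hinter x hx' hx]; simp
    · exact absurd (h.trans k.symm) hne
    · subst h; rw [hx2 x hx (hold f k k' x (hs2 hx) hx').2]; simp
    · subst k; exact (hold e h h' x (hs1 hx') hx).1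
    · subst k; exact (hold e h h' x (hs2 hx') hx).1
    · exact ht.nonCrossing.mem e h' f k' hne x hx hx'
  · intro v
    rw [← ht.balance v]
    congr 1
    simp only [ht', map_add, map_sub, force_single]
    have := pull_add_pull h0 h1 hθ v
    rw [← this, smul_add]
    abel
  -- Adding two halves and the new vertex `p` raises the cycle rank by at most one. Removing the
  -- whole wire, an edge of the (flat) triangle it forms with its halves, lowers it by at least one.
  · set E' := insert s(a, p) (insert s(p, b) t.support) with hE'
    have k1 : t.support ⊆ E' := fun e he => by simp [hE', Finsupp.mem_support_iff.1 he]
    have k2 : E' \ t.support = {s(a, p), s(p, b)} := by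
      ext e
      simp only [hE', Finset.mem_sdiff, Finset.mem_insert, Finset.mem_singleton]
      constructor
      · tauto
      · rintro (rfl | rfl) <;> simp [n1, n2]
    have k3 := cycleRank_add_le (N := {s(a, p), s(p, b)}) k1 (fun e => by rw [← k2, Finset.mem_sdiff])
        {p} (by simpa using hnew) (by
      intro q hq
      rw [Finset.mem_singleton] at hq
      subst hq
      refine ⟨s(a, q), by simp, by simp⟩)
    rw [Finset.card_pair n3, Finset.card_singleton] at k3
    have k4 : t'.support ⊆ E' := by
      rw [hsupp]
      exact Finset.insert_subset_insert _ (Finset.insert_subset_insert _ (Finset.erase_subset _ _))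
    have k5 := cycleRank_remove_le (ι := Unit) k4 (fun _ => s(a, b)) (by simp [hsupp, n4, n5])
      (fun _ e => if e ∈ ({s(a, b), s(a, p), s(p, b)} : Finset (Sym2 Plane)) then 1 else 0) (by
        intro _
        refine ⟨fun e he => ?_, fun v => ?_⟩
        · refine if_neg fun h => he ?_
          simp only [Finset.mem_insert, Finset.mem_singleton] at h
          rcases h with rfl | rfl | rfl
          · exact k1 he₀
          · simp [hE']
          · simp [hE']
        · have hsub : ({s(a, b), s(a, p), s(p, b)} : Finset (Sym2 Plane)) ⊆ E' := by
            intro e he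
            simp only [Finset.mem_insert, Finset.mem_singleton] at he
            rcases he with rfl | rfl | rfl
            · exact k1 he₀
            · simp [hE']
            · simp [hE']
          rw [sum_inc_of_subset hsub (fun e he => if_neg he), Finset.sum_insert, Finset.sum_pair n3]
          · simp only [Finset.mem_insert, Finset.mem_singleton, true_or, or_true, if_true, one_mul]
            rw [inc_add_inc hpa.symm hpb hab]
            exact CharTwo.add_self_eq_zero _
          · simp [n4, n5]) (by intro _ _; simp)
    simp at k5
    omega
  · intro e he x hx hxe
    rcases hcase e he with h | h | ⟨h, h'⟩
    · subst h
      refine ⟨_, he₀, hs1 hx, fun h => hxe ?_⟩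
      rw [hx1 x hx (Sym2.mem_iff.1 h)]; simp
    · subst h
      refine ⟨_, he₀, hs2 hx, fun h => hxe ?_⟩
      rw [hx2 x hx (Sym2.mem_iff.1 h)]; simp
    · exact ⟨e, h', hx, hxe⟩
  · intro e he hpe'
    rcases hcase e he with h | h | ⟨h, h'⟩
    · subst h; simp
    · subst h; simp
    · exact (hold e h h' p hp hpe').1

/-- All terminals are made nodes. -/
lemma exists_isNet_terminals {N : ℕ} {X F : Fin N → Plane} {t : Sym2 Plane →₀ ℝ} (ht : IsNet X F t) :
    ∃ t', IsNet X F t' ∧ cycleRank t'.support ≤ cycleRank t.support ∧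
      ∀ i, ∀ e ∈ t'.support, X i ∈ seg e → X i ∈ e := by
  classical
  induction hn : (Finset.univ.filter fun i => ∃ e ∈ t.support, X i ∈ seg e ∧ X i ∉ e).card
    using Nat.strong_induction_on generalizing t with | _ n ih =>
  by_cases h : ∃ i, ∃ e ∈ t.support, X i ∈ seg e ∧ X i ∉ e
  · obtain ⟨i, e, he, h1, h2⟩ := h
    obtain ⟨t₁, k1, k2, k3, k4⟩ := exists_isNet_insert ht he h1 h2
    obtain ⟨t₂, l1, l2, l3⟩ := ih _ (by
      rw [← hn]
      refine Finset.card_lt_card ⟨fun j hj => ?_, fun h => ?_⟩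
      · simp only [Finset.mem_filter, Finset.mem_univ, true_and] at hj ⊢
        obtain ⟨f, hf, hj1, hj2⟩ := hj
        exact k3 f hf _ hj1 hj2
      · have := h (x := i) (by simp only [Finset.mem_filter, Finset.mem_univ, true_and]; exact ⟨e, he, h1, h2⟩)
        simp only [Finset.mem_filter, Finset.mem_univ, true_and] at this
        obtain ⟨f, hf, hj1, hj2⟩ := this
        exact hj2 (k4 f hf hj1)) k1 rfl
    exact ⟨t₂, l1, l2.trans k2, l3⟩
  · push Not at h
    exact ⟨t, ht, le_rfl, h⟩

/-! ### Convex polygons -/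

/-- The corners `C` of a strictly convex polygon, with the counterclockwise successor map `nx`. -/
structure IsPolygon (C : Finset Plane) (nx : Plane → Plane) : Prop where
  nonempty : C.Nonempty
  maps : ∀ c ∈ C, nx c ∈ C
  ne : ∀ c ∈ C, nx c ≠ c
  ne_two : ∀ c ∈ C, nx (nx c) ≠ c
  left : ∀ c ∈ C, ∀ d ∈ C, d ≠ c → d ≠ nx c → 0 < cr (nx c - c) (d - c)

namespace IsPolygon

variable {C : Finset Plane} {nx : Plane → Plane}

/-- If `c` and `d` had the same successor, each would lie strictly left of the side out of the
other. The two cross products are opposite signed areas of one triangle. -/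
lemma injOn (h : IsPolygon C nx) : Set.InjOn nx C := by
  intro c hc d hd hcd
  by_contra hne
  have h1 := h.left c hc d hd (Ne.symm hne) (hcd ▸ (h.ne d hd).symm)
  have h2 := h.left d hd c hc hne (hcd ▸ (h.ne c hc).symm)
  rw [← hcd] at h2
  have : cr (nx c - c) (d - c) = -cr (nx c - d) (c - d) := by
    simp [cr]; ring
  linarith

lemma exists_pv (h : IsPolygon C nx) :
    ∃ pv : Plane → Plane, ∀ c ∈ C, pv c ∈ C ∧ nx (pv c) = c ∧ pv (nx c) = c := by
  have hsurj : Set.SurjOn nx C C :=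
    Finset.surjOn_of_injOn_of_card_le nx (fun c hc => h.maps c hc) h.injOn le_rfl
  refine ⟨Function.invFunOn nx C, fun c hc => ⟨?_, ?_, ?_⟩⟩
  · exact Function.invFunOn_mem (hsurj hc)
  · exact Function.invFunOn_eq (hsurj hc)
  · exact h.injOn.leftInvOn_invFunOn hc

lemma left_nonneg (h : IsPolygon C nx) {c d : Plane} (hc : c ∈ C) (hd : d ∈ C) :
    0 ≤ cr (nx c - c) (d - c) := by
  by_cases h1 : d = c
  · simp [h1]
  by_cases h2 : d = nx c
  · simp [h2]
  exact (h.left c hc d hd h1 h2).le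

lemma turn (h : IsPolygon C nx) {c : Plane} (hc : c ∈ C) :
    0 < cr (nx c - c) (nx (nx c) - nx c) := by
  have := h.left c hc _ (h.maps _ (h.maps c hc)) (h.ne_two c hc) (h.ne _ (h.maps c hc))
  have e : cr (nx c - c) (nx (nx c) - c) = cr (nx c - c) (nx (nx c) - nx c) := by
    simp [cr]; ring
  rwa [e] at this

/-- A point left of both sides at `d` lies in the cone spanned at `d` by these sides, with
coefficients given by the Plücker relation. So a functional that does not decrease towards the two
neighbours of `d` is minimal at `d`: a local minimum over the corners is a global one. -/
lemma cone (h : IsPolygon C nx) {p d u x : Plane} (hp : p ∈ C) (hpd : nx p = d)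
    (h1 : 0 ≤ cr u (nx d - d)) (h2 : cr u (d - p) ≤ 0) (h3 : 0 ≤ cr (d - p) (x - p))
    (h4 : 0 ≤ cr (nx d - d) (x - d)) : 0 ≤ cr u (x - d) := by
  subst hpd
  have h5 := h.turn hp
  have h6 := cr_mul_cr (nx p - p) (nx (nx p) - nx p) u (x - nx p)
  have h7 : cr (nx p - p) (x - nx p) = cr (nx p - p) (x - p) := by simp [cr]; ring
  rw [h7, cr_anticomm (nx p - p) u] at h6
  have h8 : 0 ≤ cr (nx p - p) (nx (nx p) - nx p) * cr u (x - nx p) := by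
    rw [h6]
    exact add_nonneg (mul_nonneg h1 h3) (mul_nonneg (by linarith) h4)
  exact nonneg_of_mul_nonneg_right h8 h5

/-- A linear functional on the plane is a cross product. -/
lemma _root_.PlaneWeb.exists_cr_eq (f : Plane →L[ℝ] ℝ) : ∃ v : Plane, ∀ y, cr v y = f y := by
  refine ⟨!₂[f (EuclideanSpace.single 1 1), -f (EuclideanSpace.single 0 1)], fun y => ?_⟩
  have : y = y 0 • EuclideanSpace.single 0 (1 : ℝ) + y 1 • EuclideanSpace.single 1 (1 : ℝ) := by
    apply plane_ext <;> simp
  conv_rhs => rw [this]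
  rw [map_add, map_smul, map_smul]
  simp [cr]
  ring

/-- A functional separating `x` from the corners takes its least corner value at some `d`. By `cone`
its value at `x` is no smaller. -/
lemma mem_convexHull (h : IsPolygon C nx) {x : Plane} (hx : ∀ c ∈ C, 0 ≤ cr (nx c - c) (x - c)) :
    x ∈ convexHull ℝ (C : Set Plane) := by
  by_contra hx'
  obtain ⟨f, u, hf1, hf2⟩ := geometric_hahn_banach_closed_point (convex_convexHull ℝ (C : Set Plane))
    (C.finite_toSet.isCompact_convexHull (𝕜 := ℝ)).isClosed hx'
  obtain ⟨v, hv⟩ := exists_cr_eq (-f)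
  obtain ⟨d, hd, hmin⟩ := C.exists_min_image (fun d => cr v d) h.nonempty
  obtain ⟨pv, hpv⟩ := h.exists_pv
  have h1 := h.cone (u := v) (x := x) (hpv d hd).1 (hpv d hd).2.1
    (by rw [cr_sub_right]; linarith [hmin _ (h.maps d hd)])
    (by rw [cr_sub_right]; linarith [hmin _ (hpv d hd).1])
    (by have := hx _ (hpv d hd).1; rwa [(hpv d hd).2.1] at this) (hx d hd)
  rw [cr_sub_right, hv, hv] at h1
  have := hf1 d (subset_convexHull ℝ _ hd)
  simp at h1
  linarith

lemma le_of_mem_convexHull {S : Set Plane} {u : Plane} {r : ℝ} (hS : ∀ c ∈ S, r ≤ cr u c)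
    {x : Plane} (hx : x ∈ convexHull ℝ S) : r ≤ cr u x := by
  have hconv : Convex ℝ {y : Plane | r ≤ cr u y} := by
    refine convex_halfSpace_ge ⟨cr_add_right u, fun c y => ?_⟩ r
    rw [cr_smul_right, smul_eq_mul]
  exact convexHull_min (fun c hc => hS c hc) hconv hx

/-- Only the whole set of corners is closed under the successor map. -/
lemma eq_of_closed (h : IsPolygon C nx) {D : Finset Plane} (hDC : D ⊆ C) (hD : D.Nonempty)
    (hcl : ∀ c ∈ D, nx c ∈ D) : D = C := by
  by_contra hne
  obtain ⟨c, hc, hcD⟩ : ∃ c ∈ C, c ∉ D := by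
    by_contra h'
    push Not at h'
    exact hne (Finset.Subset.antisymm hDC h')
  -- Let `c` be a missing corner and `d` the corner of `D` closest to the line of the side out of
  -- `c`. Since `nx` permutes `D`, both neighbours of `d` are in `D`, and `cone` puts `c` no closer
  -- to its own side than `d`. Strict convexity leaves only `d = nx c`, whose predecessor `c` would
  -- then be in `D`.
  obtain ⟨d, hd, hmin⟩ := D.exists_min_image (fun d => cr (nx c - c) d) hD
  have hsurj : Set.SurjOn nx D D :=
    Finset.surjOn_of_injOn_of_card_le nx (fun c hc => hcl c hc) (h.injOn.mono hDC) le_rfl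
  obtain ⟨p, hp, hpd⟩ := hsurj hd
  have hp : p ∈ D := hp
  have h1 := h.cone (u := nx c - c) (x := c) (hDC hp) hpd
    (by rw [cr_sub_right]; linarith [hmin _ (hcl d hd)])
    (by rw [cr_sub_right]; linarith [hmin _ hp])
    (by have := h.left_nonneg (hDC hp) hc; rwa [hpd] at this)
    (h.left_nonneg (hDC hd) hc)
  have hdc : d ≠ c := fun h' => hcD (h' ▸ hd)
  by_cases hdn : d = nx c
  · have : p = c := h.injOn (hDC hp) hc (hpd.trans hdn)
    exact hcD (this ▸ hp)
  · have h2 := h.left c hc d (hDC hd) hdc hdn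
    have : cr (nx c - c) (d - c) = -cr (nx c - c) (c - d) := by simp [cr]; ring
    linarith

end IsPolygon

/-! ### Shrinking a polygon -/

/-- The unit vector along a side. -/
noncomputable def sdir (nx : Plane → Plane) (c : Plane) : Plane := udir (nx c - c)

/-- The corner forces of a polygon with side tensions `a`. -/
noncomputable def cornerForce (nx pv : Plane → Plane) (a : Plane → ℝ) (c : Plane) : Plane :=
  a c • sdir nx c - a (pv c) • sdir nx (pv c)

/-- The corners `c` of a polygon move along `c + s • w c` until, at the time `T`, the first sides
have length zero. The side at `c` then has the length `len c`. -/
structure Collapse (C : Finset Plane) (nx pv : Plane → Plane) (a : Plane → ℝ) (w : Plane → Plane)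
    (T : ℝ) (len : Plane → ℝ) : Prop where
  poly : IsPolygon C nx
  pv_mem : ∀ c ∈ C, pv c ∈ C
  nx_pv : ∀ c ∈ C, nx (pv c) = c
  pv_nx : ∀ c ∈ C, pv (nx c) = c
  a_pos : ∀ c ∈ C, 0 < a c
  T_pos : 0 < T
  w_eq : ∀ c ∈ C, ∃ ρ : ℝ, 0 < ρ ∧ w c = ρ • cornerForce nx pv a c
  cr_w : ∀ c ∈ C, a c * cr (sdir nx c) (w c) = 1
  cr_w_pv : ∀ c ∈ C, a (pv c) * cr (sdir nx (pv c)) (w c) = 1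
  side : ∀ c ∈ C, (nx c + T • w (nx c)) - (c + T • w c) = len c • sdir nx c
  len_nonneg : ∀ c ∈ C, 0 ≤ len c
  len_eq_zero : ∃ c ∈ C, len c = 0
  convex : ∀ s, 0 ≤ s → s ≤ T → ∀ c ∈ C, ∀ d ∈ C,
    0 ≤ cr (sdir nx c) ((d + s • w d) - (c + s • w c))
  strict : ∀ s, 0 ≤ s → s < T → ∀ c ∈ C, ∀ d ∈ C, d ≠ c → d ≠ nx c →
    0 < cr (sdir nx c) ((d + s • w d) - (c + s • w c))

lemma sdir_ne_zero {C : Finset Plane} {nx : Plane → Plane} (h : IsPolygon C nx) {c : Plane}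
    (hc : c ∈ C) : sdir nx c ≠ 0 := udir_ne_zero (sub_ne_zero.2 (h.ne c hc))

lemma norm_inv_pos {C : Finset Plane} {nx : Plane → Plane} (h : IsPolygon C nx) {c : Plane}
    (hc : c ∈ C) : 0 < ‖nx c - c‖⁻¹ := inv_pos.2 (norm_pos_iff.2 (sub_ne_zero.2 (h.ne c hc)))

/-- With each corner moving along its corner force at a suitable speed, every side moves inwards
parallel to itself at speed `1 / a c`. The rates `κ c` at which the sides shorten have a positive
sum when weighted by `a c`, so some side shortens, and `T` is the first time at which a length
vanishes. Until then side directions do not change, which keeps the polygon convex. -/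
lemma exists_collapse {C : Finset Plane} {nx : Plane → Plane} (h : IsPolygon C nx) {a : Plane → ℝ}
    (ha : ∀ c ∈ C, 0 < a c) : ∃ pv w T len, Collapse C nx pv a w T len := by
  obtain ⟨pv, hpv⟩ := h.exists_pv
  have hpm : ∀ c ∈ C, pv c ∈ C := fun c hc => (hpv c hc).1
  have hnp : ∀ c ∈ C, nx (pv c) = c := fun c hc => (hpv c hc).2.1
  have hpn : ∀ c ∈ C, pv (nx c) = c := fun c hc => (hpv c hc).2.2
  set u := sdir nx with hu
  set k : Plane → ℝ := fun c => cr (u (pv c)) (u c) with hk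
  have hkpos : ∀ c ∈ C, 0 < k c := by
    intro c hc
    have h1 := h.turn (hpm c hc)
    rw [hnp c hc] at h1
    simp only [hk, hu, sdir, udir, cr_smul_left, cr_smul_right, hnp c hc]
    have h2 := norm_inv_pos h hc
    have h3 := norm_inv_pos h (hpm c hc)
    rw [hnp c hc] at h3
    positivity
  set g := cornerForce nx pv a with hg
  -- The factor makes the corner recede from both of its sides at unit rate, when distance from a
  -- side is multiplied by the tension of that side. The two ends of a side thus stay level, and the
  -- side keeps its direction.
  set w : Plane → Plane := fun c => (a c * a (pv c) * k c)⁻¹ • g c with hw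
  have hρ : ∀ c ∈ C, 0 < (a c * a (pv c) * k c)⁻¹ := fun c hc =>
    inv_pos.2 (mul_pos (mul_pos (ha c hc) (ha _ (hpm c hc))) (hkpos c hc))
  have hw1 : ∀ c ∈ C, a c * cr (u c) (w c) = 1 := by
    intro c hc
    have h1 := (ha c hc).ne'
    have h2 := (ha _ (hpm c hc)).ne'
    have h3 := (hkpos c hc).ne'
    simp only [hw, hg, cornerForce, cr_smul_right, cr_sub_right]
    rw [← hu, cr_self, cr_anticomm (u c) (u (pv c))]
    change a c * ((a c * a (pv c) * k c)⁻¹ * (a c * 0 - a (pv c) * -k c)) = 1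
    field_simp
    ring
  have hw2 : ∀ c ∈ C, a (pv c) * cr (u (pv c)) (w c) = 1 := by
    intro c hc
    have h1 := (ha c hc).ne'
    have h2 := (ha _ (hpm c hc)).ne'
    have h3 := (hkpos c hc).ne'
    simp only [hw, hg, cornerForce, cr_smul_right, cr_sub_right]
    rw [← hu, cr_self]
    change a (pv c) * ((a c * a (pv c) * k c)⁻¹ * (a c * k c - a (pv c) * 0)) = 1
    field_simp
    ring
  have hκ : ∀ c ∈ C, ∃ κ : ℝ, w c - w (nx c) = κ • u c := by
    intro c hc
    refine exists_smul_of_cr_eq_zero (sdir_ne_zero h hc) ?_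
    have h1 := hw1 c hc
    have h2 := hw2 _ (h.maps c hc)
    rw [hpn c hc] at h2
    have h3 : a c * (cr (u c) (w c) - cr (u c) (w (nx c))) = 0 := by linarith
    rw [cr_sub_right]
    exact (mul_eq_zero.1 h3).resolve_left (ha c hc).ne'
  choose! κ hκ using hκ
  have hlen : ∀ s : ℝ, ∀ c ∈ C, (nx c + s • w (nx c)) - (c + s • w c) =
      (‖nx c - c‖ - s * κ c) • u c := by
    intro s c hc
    rw [sub_smul, mul_smul, ← hκ c hc, hu, sdir, norm_smul_udir, smul_sub]
    abel
  have huu : ∀ c ∈ C, inner ℝ (u c) (u c) = 1 := by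
    intro c hc
    have : ‖nx c - c‖ ≠ 0 := (norm_pos_iff.2 (sub_ne_zero.2 (h.ne c hc))).ne'
    rw [real_inner_self_eq_norm_sq, hu, sdir, udir, norm_smul, norm_inv, norm_norm,
      inv_mul_cancel₀ this, one_pow]
  -- Summation by parts turns the weighted shortening rates into the sum of the inner products of `w
  -- c` with the corner force `g c`, and `w c` is a positive multiple of `g c ≠ 0`.
  have hsum : 0 < ∑ c ∈ C, a c * κ c := by
    have h1 : ∀ c ∈ C, a c * κ c = inner ℝ (w c) (a c • u c) - inner ℝ (w (nx c)) (a c • u c) := by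
      intro c hc
      rw [← inner_sub_left, hκ c hc, inner_smul_left, inner_smul_right, huu c hc]
      simp; ring
    have h2 : ∑ c ∈ C, inner ℝ (w (nx c)) (a c • u c) =
        ∑ c ∈ C, inner ℝ (w c) (a (pv c) • u (pv c)) := by
      refine Finset.sum_bij' (fun c _ => nx c) (fun c _ => pv c) (fun c hc => h.maps c hc)
        (fun c hc => hpm c hc) (fun c hc => hpn c hc) (fun c hc => hnp c hc) fun c hc => ?_
      rw [hpn c hc]
    rw [Finset.sum_congr rfl h1, Finset.sum_sub_distrib, h2, ← Finset.sum_sub_distrib]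
    refine Finset.sum_pos (fun c hc => ?_) h.nonempty
    rw [← inner_sub_right]
    change 0 < inner ℝ ((a c * a (pv c) * k c)⁻¹ • g c) (g c)
    rw [inner_smul_left, real_inner_self_eq_norm_sq]
    have hgc : g c ≠ 0 := by
      intro h0
      have := hw1 c hc
      simp [hw, h0] at this
    have := hρ c hc
    have := norm_pos_iff.2 hgc
    simp only [conj_trivial]
    positivity
  obtain ⟨c₁, hc₁, hκ₁⟩ : ∃ c ∈ C, 0 < κ c := by
    by_contra hcon
    push Not at hcon
    exact absurd hsum (not_lt.2 (Finset.sum_nonpos fun c hc =>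
      mul_nonpos_of_nonneg_of_nonpos (ha c hc).le (hcon c hc)))
  obtain ⟨c₀, hc₀, hmin⟩ := (C.filter fun c => 0 < κ c).exists_min_image
    (fun c => ‖nx c - c‖ / κ c) ⟨c₁, Finset.mem_filter.2 ⟨hc₁, hκ₁⟩⟩
  obtain ⟨hc₀, hκ₀⟩ := Finset.mem_filter.1 hc₀
  set T := ‖nx c₀ - c₀‖ / κ c₀ with hT
  have hnpos : ∀ c ∈ C, 0 < ‖nx c - c‖ := fun c hc => norm_pos_iff.2 (sub_ne_zero.2 (h.ne c hc))
  have hTpos : 0 < T := div_pos (hnpos c₀ hc₀) hκ₀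
  have hTle : ∀ c ∈ C, T * κ c ≤ ‖nx c - c‖ := by
    intro c hc
    rcases le_or_gt (κ c) 0 with h1 | h1
    · exact (mul_nonpos_of_nonneg_of_nonpos hTpos.le h1).trans (norm_nonneg _)
    · exact (le_div_iff₀ h1).1 (hmin c (Finset.mem_filter.2 ⟨hc, h1⟩))
  have hlpos : ∀ s, 0 ≤ s → s < T → ∀ c ∈ C, 0 < ‖nx c - c‖ - s * κ c := by
    intro s h0 hs c hc
    rcases le_or_gt (κ c) 0 with h1 | h1
    · have := mul_nonpos_of_nonneg_of_nonpos h0 h1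
      linarith [hnpos c hc]
    · have := hTle c hc
      nlinarith
  have hcr : ∀ c ∈ C, ∀ y, cr (u c) y = ‖nx c - c‖⁻¹ * cr (nx c - c) y := fun c _ y =>
    cr_udir_left _ _
  have hconv : ∀ s, 0 ≤ s → s < T → ∀ c ∈ C, ∀ d ∈ C,
      0 ≤ cr (u c) ((d + s • w d) - (c + s • w c)) := by
    intro s h0 hs c hc d' hd'
    -- Let `d` be lowest over the side at `c` at time `s`. Its two sides still have positive length
    -- and the old directions, so by `cone` it was also lowest at time zero. Hence `d` is an end of
    -- that side, and the side is still lowest.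
    obtain ⟨d, hd, hm⟩ := C.exists_min_image (fun d => cr (u c) (d + s • w d)) h.nonempty
    have e1 : 0 ≤ cr (u c) (u d) := by
      have := hm _ (h.maps d hd)
      have h2 : cr (u c) ((nx d + s • w (nx d)) - (d + s • w d)) ≥ 0 := by
        rw [cr_sub_right]; linarith
      rw [hlen s d hd, cr_smul_right] at h2
      exact nonneg_of_mul_nonneg_right h2 (hlpos s h0 hs d hd)
    have e2 : cr (u c) (u (pv d)) ≤ 0 := by
      have := hm _ (hpm d hd)
      have h2 := hlen s _ (hpm d hd)
      rw [hnp d hd] at h2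
      have h3 : cr (u c) ((d + s • w d) - (pv d + s • w (pv d))) ≤ 0 := by
        rw [cr_sub_right]; linarith
      rw [h2, cr_smul_right] at h3
      have h4 := hlpos s h0 hs _ (hpm d hd)
      rw [hnp d hd] at h4
      exact nonpos_of_mul_nonpos_right h3 h4
    have e3 : 0 ≤ cr (u c) (c - d) := by
      refine h.cone (hpm d hd) (hnp d hd) ?_ ?_ ?_ ?_
      · rw [← norm_smul_udir (nx d - d), cr_smul_right]
        exact mul_nonneg (norm_nonneg _) e1
      · rw [← norm_smul_udir (d - pv d), cr_smul_right]
        have : udir (d - pv d) = u (pv d) := by rw [hu, sdir, hnp d hd]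
        rw [this]
        exact mul_nonpos_of_nonneg_of_nonpos (norm_nonneg _) e2
      · have := h.left_nonneg (hpm d hd) hc
        rwa [hnp d hd] at this
      · exact h.left_nonneg hd hc
    have e4 : cr (u c) (d + s • w d) = cr (u c) (c + s • w c) := by
      by_cases d1 : d = c
      · rw [d1]
      by_cases d2 : d = nx c
      · have := hlen s c hc
        rw [d2, ← sub_eq_zero, ← cr_sub_right, this, cr_smul_right, cr_self, mul_zero]
      · have h2 := h.left c hc d hd d1 d2
        have h3 : 0 < cr (u c) (d - c) := by
          rw [hcr c hc]; exact mul_pos (inv_pos.2 (hnpos c hc)) h2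
        rw [← neg_sub, cr_neg_right] at h3
        linarith
    rw [cr_sub_right]
    have := hm d' hd'
    linarith
  have hexp : ∀ s : ℝ, ∀ c d, cr (u c) ((d + s • w d) - (c + s • w c)) =
      cr (u c) (d - c) + s * cr (u c) (w d - w c) := by
    intro s c d
    rw [← cr_smul_right, ← cr_add_right]
    congr 1
    rw [smul_sub]; abel
  have hconvT : ∀ s, 0 ≤ s → s ≤ T → ∀ c ∈ C, ∀ d ∈ C,
      0 ≤ cr (u c) ((d + s • w d) - (c + s • w c)) := by
    intro s h0 hs c hc d hd
    rcases lt_or_eq_of_le hs with hs | hs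
    · exact hconv s h0 hs c hc d hd
    rw [hs]
    by_contra hneg
    rw [hexp] at hneg
    push Not at hneg
    -- The quantity `A + s * B` is affine in the time `s`. If it were negative at `T`, it would
    -- already be negative shortly before.
    set A := cr (u c) (d - c)
    set B := cr (u c) (w d - w c)
    have hA : 0 ≤ A := by
      have := hconv 0 le_rfl hTpos c hc d hd
      rw [hexp] at this
      linarith
    have hB : B < 0 := by
      by_contra hB
      have := mul_nonneg hTpos.le (not_lt.1 hB)
      linarith
    have h1 := hconv ((A / (-B) + T) / 2) (by have := div_nonneg hA (neg_nonneg.2 hB.le); linarith)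
      (by
        have : A / (-B) < T := by rw [div_lt_iff₀ (by linarith)]; linarith
        linarith) c hc d hd
    rw [hexp] at h1
    change 0 ≤ A + _ * B at h1
    have h2 : A / (-B) * B = -A := by
      have := hB.ne
      field_simp
    nlinarith
  refine ⟨pv, w, T, fun c => ‖nx c - c‖ - T * κ c, h, hpm, hnp, hpn, ha, hTpos, ?_, hw1, hw2, hlen T,
    fun c hc => sub_nonneg.2 (hTle c hc), ⟨c₀, hc₀, ?_⟩, hconvT, ?_⟩
  · exact fun c hc => ⟨_, hρ c hc, rfl⟩
  · simp only [hT]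
    field_simp
    ring
  -- An affine function of time that is positive at `0` and nonnegative at `T` is positive before
  -- `T`.
  · intro s h0 hs c hc d hd d1 d2
    have h1 := hconvT T hTpos.le le_rfl c hc d hd
    rw [hexp] at h1
    rw [hexp]
    have h2 : 0 < cr (u c) (d - c) := by
      rw [hcr c hc]; exact mul_pos (inv_pos.2 (hnpos c hc)) (h.left c hc d hd d1 d2)
    by_contra hneg
    push Not at hneg
    have h3 : cr (u c) (w d - w c) < 0 := by
      by_contra h4
      have := mul_nonneg h0 (not_lt.1 h4)
      linarith
    nlinarith

lemma norm_udir {v : Plane} (h : v ≠ 0) : ‖udir v‖ = 1 := by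
  rw [udir, norm_smul, norm_inv, norm_norm, inv_mul_cancel₀ (norm_ne_zero_iff.2 h)]

lemma eq_or_eq_neg_of_cr_eq_zero {a b : Plane} (ha : ‖a‖ = 1) (hb : ‖b‖ = 1) (h : cr a b = 0) :
    b = a ∨ b = -a := by
  obtain ⟨r, rfl⟩ := exists_smul_of_cr_eq_zero (a := a) (by rintro rfl; simp at ha) h
  rw [norm_smul, ha, mul_one, Real.norm_eq_abs] at hb
  rcases (abs_eq zero_le_one).1 hb with h | h
  · left; rw [h, one_smul]
  · right; rw [h, neg_smul, one_smul]

/-! ### The polygon at the moment when its first sides vanish -/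

namespace Collapse

variable {C : Finset Plane} {nx pv : Plane → Plane} {a : Plane → ℝ} {w : Plane → Plane} {T : ℝ}
  {len : Plane → ℝ}

lemma norm_sdir (h : Collapse C nx pv a w T len) {c : Plane} (hc : c ∈ C) : ‖sdir nx c‖ = 1 :=
  norm_udir (sub_ne_zero.2 (h.poly.ne c hc))

lemma cr_sdir (h : Collapse C nx pv a w T len) {c d : Plane} (hc : c ∈ C) (hd : d ∈ C) (h1 : d ≠ c)
    (h2 : d ≠ nx c) : 0 < cr (sdir nx c) (d - c) := by
  have := h.strict 0 le_rfl h.T_pos c hc d hd h1 h2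
  simpa using this

/-- The number `a e * cr (sdir nx e) (x - e)` is the depth of `x` behind the side at `e`, scaled so
that the moving side has depth exactly `s` at time `s`. Convexity keeps all corners at least as
deep. Depth is what separates old edges, prongs and final sides later on. -/
lemma depth_ge (h : Collapse C nx pv a w T len) {s : ℝ} (h0 : 0 ≤ s) (hs : s ≤ T) {c e : Plane}
    (hc : c ∈ C) (he : e ∈ C) : s ≤ a e * cr (sdir nx e) (c + s • w c - e) := by
  have h1 := h.convex s h0 hs e he c hc
  have h2 := h.cr_w e he
  have h3 : cr (sdir nx e) (c + s • w c - e) =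
      cr (sdir nx e) ((c + s • w c) - (e + s • w e)) + s * cr (sdir nx e) (w e) := by
    rw [← cr_smul_right, ← cr_add_right]; congr 1; abel
  rw [h3]
  have := mul_nonneg (h.a_pos e he).le h1
  nlinarith

lemma depth_gt (h : Collapse C nx pv a w T len) {s : ℝ} (h0 : 0 ≤ s) (hs : s < T) {c e : Plane}
    (hc : c ∈ C) (he : e ∈ C) (hce : c ≠ e) (hcn : c ≠ nx e) :
    s < a e * cr (sdir nx e) (c + s • w c - e) := by
  have h1 := h.strict s h0 hs e he c hc hce hcn
  have h2 := h.cr_w e he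
  have h3 : cr (sdir nx e) (c + s • w c - e) =
      cr (sdir nx e) ((c + s • w c) - (e + s • w e)) + s * cr (sdir nx e) (w e) := by
    rw [← cr_smul_right, ← cr_add_right]; congr 1; abel
  rw [h3]
  have := mul_pos (h.a_pos e he) h1
  nlinarith

lemma depth_self (h : Collapse C nx pv a w T len) (s : ℝ) {c : Plane} (hc : c ∈ C) :
    a c * cr (sdir nx c) (c + s • w c - c) = s := by
  have h2 := h.cr_w c hc
  rw [add_sub_cancel_left, cr_smul_right]
  linear_combination s * h2

/-- Two sides of equal direction would lie on one line by convexity, and strict convexity would then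
make each of the two corners the successor of the other. -/
lemma sdir_injOn (h : Collapse C nx pv a w T len) {c d : Plane} (hc : c ∈ C) (hd : d ∈ C)
    (hcd : sdir nx c = sdir nx d) : c = d := by
  by_contra hne
  have h1 := h.convex 0 le_rfl h.T_pos.le c hc d hd
  have h2 := h.convex 0 le_rfl h.T_pos.le d hd c hc
  simp only [zero_smul, add_zero] at h1 h2
  have h3 : cr (sdir nx c) (d - c) = -cr (sdir nx c) (c - d) := by rw [← cr_neg_right, neg_sub]
  rw [← hcd] at h2
  have e1 : d = nx c := by
    by_contra h4
    have := h.cr_sdir hc hd (Ne.symm hne) h4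
    linarith
  have e2 : c = nx d := by
    by_contra h4
    have := h.cr_sdir hd hc hne h4
    rw [← hcd] at this
    linarith
  exact h.poly.ne_two c hc (by rw [← e1, ← e2])

lemma side' (h : Collapse C nx pv a w T len) {c : Plane} (hc : c ∈ C) :
    nx c + T • w (nx c) = c + T • w c + len c • sdir nx c := by
  rw [← h.side c hc]; abel

lemma side_eq_iff (h : Collapse C nx pv a w T len) {c : Plane} (hc : c ∈ C) :
    nx c + T • w (nx c) = c + T • w c ↔ len c = 0 := by
  rw [h.side' hc]
  constructor
  · intro h1
    have : len c • sdir nx c = 0 := by simpa using h1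
    exact (smul_eq_zero.1 this).resolve_right (sdir_ne_zero h.poly hc)
  · intro h1; simp [h1]

/-- Otherwise the corners that end up at this point would be closed under `nx`. They would be all
corners, and no side would survive. -/
lemma exists_out (h : Collapse C nx pv a w T len) {c e : Plane} (hc : c ∈ C) (he : e ∈ C)
    (hle : 0 < len e) : ∃ d ∈ C, d + T • w d = c + T • w c ∧ 0 < len d := by
  by_contra hcon
  push Not at hcon
  have hz : ∀ d ∈ C, d + T • w d = c + T • w c → len d = 0 := fun d hd h1 =>
    le_antisymm (hcon d hd h1) (h.len_nonneg d hd)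
  have := h.poly.eq_of_closed (D := C.filter fun d => d + T • w d = c + T • w c)
    (Finset.filter_subset _ _) ⟨c, by simp [hc]⟩ (by
      intro d hd
      rw [Finset.mem_filter] at hd ⊢
      exact ⟨h.poly.maps d hd.1, ((h.side_eq_iff hd.1).2 (hz d hd.1 hd.2)).trans hd.2⟩)
  rw [← this, Finset.mem_filter] at he
  exact hle.ne' (hz e he.1 he.2)

/-- As for `exists_out`, with the corners that end up elsewhere: without a surviving side arriving
here they would be closed under `nx`. -/
lemma exists_in (h : Collapse C nx pv a w T len) {c e : Plane} (hc : c ∈ C) (he : e ∈ C)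
    (hle : 0 < len e) : ∃ d ∈ C, nx d + T • w (nx d) = c + T • w c ∧ 0 < len d := by
  by_contra hcon
  push Not at hcon
  have hz : ∀ d ∈ C, nx d + T • w (nx d) = c + T • w c → len d = 0 := fun d hd h1 =>
    le_antisymm (hcon d hd h1) (h.len_nonneg d hd)
  by_cases hne : ∃ d ∈ C, d + T • w d ≠ c + T • w c
  · obtain ⟨d, hd, hdc⟩ := hne
    have := h.poly.eq_of_closed (D := C.filter fun d => d + T • w d ≠ c + T • w c)
      (Finset.filter_subset _ _) ⟨d, by simp [hd, hdc]⟩ (by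
        intro d hd
        rw [Finset.mem_filter] at hd ⊢
        refine ⟨h.poly.maps d hd.1, fun h1 => hd.2 ?_⟩
        rw [← h1]
        exact ((h.side_eq_iff hd.1).2 (hz d hd.1 h1)).symm)
    rw [← this, Finset.mem_filter] at hc
    exact hc.2 rfl
  · push Not at hne
    refine hle.ne' ((h.side_eq_iff he).1 ?_)
    rw [hne e he, hne _ (h.poly.maps e he)]

/-- A point that lies strictly between two points of the final polygon: all sides at it are
parallel to the line through them. -/
lemma cr_eq_zero_of_between (h : Collapse C nx pv a w T len) {d x y u : Plane} (hd : d ∈ C)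
    {q : Plane} (hq : cr (sdir nx d) q = cr (sdir nx d) (d + T • w d))
    (hx : ∃ c ∈ C, x = c + T • w c) (hy : ∃ c ∈ C, y = c + T • w c) {r s : ℝ} (hr : 0 < r)
    (hs : 0 < s) (hxq : x = q - r • u) (hyq : y = q + s • u) : cr (sdir nx d) u = 0 := by
  obtain ⟨c, hc, rfl⟩ := hx
  obtain ⟨c', hc', rfl⟩ := hy
  have h1 := h.convex T h.T_pos.le le_rfl d hd c hc
  have h2 := h.convex T h.T_pos.le le_rfl d hd c' hc'
  rw [hxq, cr_sub_right, cr_sub_right, hq, cr_smul_right] at h1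
  rw [hyq, cr_sub_right, cr_add_right, hq, cr_smul_right] at h2
  have h3 : 0 ≤ s * cr (sdir nx d) u := by linarith
  have h4 : 0 ≤ -(r * cr (sdir nx d) u) := by linarith
  have h5 := nonneg_of_mul_nonneg_right h3 hs
  nlinarith

/-- At a final corner strictly inside a final side, the surviving sides that leave and reach it are
parallel to that side. If one has the same direction it is that very side, and the corner is an end.
If both are opposite they coincide, and a side from a point to itself has length zero. -/
lemma mem_endpoints (h : Collapse C nx pv a w T len) {c e : Plane} (hc : c ∈ C) (he : e ∈ C)
    (hle : 0 < len e) (hseg : c + T • w c ∈ segment ℝ (e + T • w e) (nx e + T • w (nx e))) :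
    c + T • w c = e + T • w e ∨ c + T • w c = nx e + T • w (nx e) := by
  by_contra hcon
  push Not at hcon
  obtain ⟨θ, h0, h1, hθ⟩ := exists_param_of_mem_segment hseg hcon.1 hcon.2
  rw [h.side e he, smul_smul] at hθ
  have hx : ∃ c ∈ C, e + T • w e = c + T • w c := ⟨e, he, rfl⟩
  have hy : ∃ c ∈ C, nx e + T • w (nx e) = c + T • w c := ⟨_, h.poly.maps e he, rfl⟩
  have p1 : 0 < θ * len e := by positivity
  have p2 : 0 < (1 - θ) * len e := mul_pos (by linarith) hle
  have q1 : e + T • w e = c + T • w c - (θ * len e) • sdir nx e := by rw [hθ]; abel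
  have q2 : nx e + T • w (nx e) = c + T • w c + ((1 - θ) * len e) • sdir nx e := by
    rw [h.side' he, hθ, add_assoc _ ((θ * len e) • _), ← add_smul]; congr 2; ring
  obtain ⟨d, hd, hdc, hld⟩ := h.exists_out hc he hle
  obtain ⟨f, hf, hfc, hlf⟩ := h.exists_in hc he hle
  have r1 := h.cr_eq_zero_of_between hd (q := c + T • w c) (by rw [hdc]) hx hy p1 p2 q1 q2
  have r2 := h.cr_eq_zero_of_between hf (q := c + T • w c)
    (by rw [← hfc, h.side' hf, cr_add_right, cr_smul_right, cr_self]; ring) hx hy p1 p2 q1 q2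
  rcases eq_or_eq_neg_of_cr_eq_zero (h.norm_sdir hd) (h.norm_sdir he) r1 with k | k
  · rw [← h.sdir_injOn he hd k] at hdc
    exact hcon.1 hdc.symm
  rcases eq_or_eq_neg_of_cr_eq_zero (h.norm_sdir hf) (h.norm_sdir he) r2 with l | l
  · rw [← h.sdir_injOn he hf l] at hfc
    exact hcon.2 hfc.symm
  · have : f = d := h.sdir_injOn hf hd (by rw [← neg_inj, ← l, k])
    subst this
    exact hlf.ne' ((h.side_eq_iff hf).1 (hfc.trans hdc.symm))

open Classical in
/-- The final corners. -/
noncomputable def corners (C : Finset Plane) (w : Plane → Plane) (T : ℝ) : Finset Plane :=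
  C.image fun c => c + T • w c

open Classical in
/-- The final sides. -/
noncomputable def sides (C : Finset Plane) (nx w : Plane → Plane) (T : ℝ) (len : Plane → ℝ) :
    Finset (Sym2 Plane) :=
  (C.filter fun c => 0 < len c).image fun c => s(c + T • w c, nx c + T • w (nx c))

lemma mem_corners {x : Plane} : x ∈ corners C w T ↔ ∃ c ∈ C, c + T • w c = x := by
  simp [corners]

lemma mem_sides {x : Sym2 Plane} : x ∈ sides C nx w T len ↔
    ∃ c ∈ C, 0 < len c ∧ s(c + T • w c, nx c + T • w (nx c)) = x := by
  simp [sides, and_assoc]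

/-- The final polygon has fewer corners, or it is degenerate and has fewer sides than corners. -/
lemma card_sides (h : Collapse C nx pv a w T len) :
    (sides C nx w T len).card < (corners C w T).card ∨
    (sides C nx w T len).card ≤ (corners C w T).card ∧ (corners C w T).card < C.card ∧
      ∃ nx' : Plane → Plane, IsPolygon (corners C w T) nx' ∧
        (∀ c ∈ C, 0 < len c → nx' (c + T • w c) = nx c + T • w (nx c)) ∧
        ∀ p ∈ corners C w T, ∃ c ∈ C, 0 < len c ∧ p = c + T • w c := by
  classical
  -- All sides vanish at once: no final side remains, but there is a final corner.
  by_cases hall : ∀ e ∈ C, ¬ 0 < len e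
  · left
    have : sides C nx w T len = ∅ := by
      rw [sides, Finset.filter_false_of_mem hall, Finset.image_empty]
    rw [this, Finset.card_empty, Finset.card_pos]
    exact h.poly.nonempty.image _
  push Not at hall
  obtain ⟨e₀, he₀, hle₀⟩ := hall
  -- Two surviving sides run in opposite directions on one line: the polygon has become a segment,
  -- with one edge covered twice and at least two corners.
  by_cases hdeg : ∃ e ∈ C, ∃ f ∈ C, 0 < len e ∧ 0 < len f ∧ sdir nx f = -sdir nx e ∧
      cr (sdir nx e) (f + T • w f - (e + T • w e)) = 0
  · left
    obtain ⟨e, he, f, hf, hle, hlf, hef, hline⟩ := hdeg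
    have hall : ∀ c ∈ C, cr (sdir nx e) (c + T • w c - (e + T • w e)) = 0 := by
      intro c hc
      have h1 := h.convex T h.T_pos.le le_rfl e he c hc
      have h2 := h.convex T h.T_pos.le le_rfl f hf c hc
      rw [hef, cr_neg_left, cr_sub_right] at h2
      rw [cr_sub_right] at hline h1 ⊢
      linarith
    have hdir : ∀ d ∈ C, 0 < len d → d = e ∨ d = f := by
      intro d hd hld
      have h1 := hall d hd
      have h2 := hall _ (h.poly.maps d hd)
      rw [h.side' hd] at h2
      rw [cr_sub_right] at h1 h2
      rw [cr_add_right, cr_smul_right] at h2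
      have h3 : len d * cr (sdir nx e) (sdir nx d) = 0 := by linarith
      have h4 := (mul_eq_zero.1 h3).resolve_left hld.ne'
      rcases eq_or_eq_neg_of_cr_eq_zero (h.norm_sdir he) (h.norm_sdir hd) h4 with k | k
      · exact Or.inl (h.sdir_injOn hd he k)
      · exact Or.inr (h.sdir_injOn hd hf (k.trans hef.symm))
    have hne : nx e + T • w (nx e) ≠ e + T • w e := fun k => hle.ne' ((h.side_eq_iff he).1 k)
    have hnf : nx f + T • w (nx f) ≠ f + T • w f := fun k => hlf.ne' ((h.side_eq_iff hf).1 k)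
    have k1 : f + T • w f = nx e + T • w (nx e) := by
      obtain ⟨d, hd, hd1, hd2⟩ := h.exists_out (h.poly.maps e he) he hle
      rcases hdir d hd hd2 with rfl | rfl
      · exact absurd hd1.symm hne
      · exact hd1
    have k2 : e + T • w e = nx f + T • w (nx f) := by
      obtain ⟨d, hd, hd1, hd2⟩ := h.exists_out (h.poly.maps f hf) he hle
      rcases hdir d hd hd2 with rfl | rfl
      · exact hd1
      · exact absurd hd1.symm hnf
    have l1 : (sides C nx w T len).card ≤ 1 := by
      rw [Finset.card_le_one]
      have : ∀ x ∈ sides C nx w T len, x = s(e + T • w e, nx e + T • w (nx e)) := by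
        intro x hx
        obtain ⟨c, hc, hlc, rfl⟩ := mem_sides.1 hx
        rcases hdir c hc hlc with rfl | rfl
        · rfl
        · rw [k1, ← k2, Sym2.eq_swap]
      intro x hx y hy
      rw [this x hx, this y hy]
    have l2 : 1 < (corners C w T).card := Finset.one_lt_card.2
      ⟨_, mem_corners.2 ⟨_, h.poly.maps e he, rfl⟩, _, mem_corners.2 ⟨e, he, rfl⟩, hne⟩
    omega
  · right
    push Not at hdeg
    have hout : ∀ p ∈ corners C w T, ∃ d ∈ C, d + T • w d = p ∧ 0 < len d := by
      intro p hp
      obtain ⟨c, hc, rfl⟩ := mem_corners.1 hp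
      exact h.exists_out hc he₀ hle₀
    choose! out ho1 ho2 ho3 using hout
    -- Of two surviving sides with the same start, each ends weakly left of the other, so they are
    -- parallel. Opposite directions are the degenerate case just excluded.
    have huniq : ∀ d₁ ∈ C, ∀ d₂ ∈ C, 0 < len d₁ → 0 < len d₂ → d₁ + T • w d₁ = d₂ + T • w d₂ →
        d₁ = d₂ := by
      intro d₁ h₁ d₂ h₂ l₁ l₂ heq
      have k1 := h.convex T h.T_pos.le le_rfl d₁ h₁ _ (h.poly.maps d₂ h₂)
      have k2 := h.convex T h.T_pos.le le_rfl d₂ h₂ _ (h.poly.maps d₁ h₁)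
      rw [h.side' h₂, heq, add_sub_cancel_left, cr_smul_right] at k1
      rw [h.side' h₁, heq, add_sub_cancel_left, cr_smul_right] at k2
      have k3 := nonneg_of_mul_nonneg_right k1 l₂
      have k4 := nonneg_of_mul_nonneg_right k2 l₁
      have k5 := cr_anticomm (sdir nx d₁) (sdir nx d₂)
      rcases eq_or_eq_neg_of_cr_eq_zero (h.norm_sdir h₁) (h.norm_sdir h₂) (by linarith) with k | k
      · exact (h.sdir_injOn h₂ h₁ k).symm
      · exact absurd (by rw [heq, sub_self, cr_zero_right]) (hdeg d₁ h₁ d₂ h₂ l₁ l₂ k)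
    have hcard : (corners C w T).card = (C.filter fun c => 0 < len c).card := by
      have : corners C w T = (C.filter fun c => 0 < len c).image fun c => c + T • w c := by
        ext p
        constructor
        · intro hp
          exact Finset.mem_image.2 ⟨out p, Finset.mem_filter.2 ⟨ho1 p hp, ho3 p hp⟩, ho2 p hp⟩
        · intro hp
          obtain ⟨c, hc, rfl⟩ := Finset.mem_image.1 hp
          exact mem_corners.2 ⟨c, (Finset.mem_filter.1 hc).1, rfl⟩
      rw [this, Finset.card_image_of_injOn]
      intro d₁ h₁ d₂ h₂ heq
      simp only [Finset.coe_filter, Set.mem_ofPred_eq] at h₁ h₂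
      exact huniq d₁ h₁.1 d₂ h₂.1 h₁.2 h₂.2 heq
    have hmaps : ∀ p ∈ corners C w T, nx (out p) + T • w (nx (out p)) ∈ corners C w T :=
      fun p hp => mem_corners.2 ⟨_, h.poly.maps _ (ho1 p hp), rfl⟩
    have hstep : ∀ p ∈ corners C w T, nx (out p) + T • w (nx (out p)) =
        p + len (out p) • sdir nx (out p) := by
      intro p hp
      rw [h.side' (ho1 p hp), ho2 p hp]
    have hpar : ∀ p ∈ corners C w T, ∀ d ∈ C, 0 < len d → cr (sdir nx d) (sdir nx (out p)) = 0 →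
        cr (sdir nx (out p)) (d + T • w d - p) = 0 → d = out p := by
      intro p hp d hd hld h1 h2
      rcases eq_or_eq_neg_of_cr_eq_zero (h.norm_sdir hd) (h.norm_sdir (ho1 p hp)) h1 with k | k
      · exact h.sdir_injOn hd (ho1 p hp) k.symm
      · exfalso
        refine hdeg _ (ho1 p hp) d hd (ho3 p hp) hld (by rw [k, neg_neg]) ?_
        rw [ho2 p hp]; exact h2
    refine ⟨hcard ▸ Finset.card_image_le, ?_, fun p => nx (out p) + T • w (nx (out p)),
      ⟨h.poly.nonempty.image _, hmaps, ?_, ?_, ?_⟩, ?_, ?_⟩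
    · rw [hcard]
      obtain ⟨c, hc, hlc⟩ := h.len_eq_zero
      refine Finset.card_lt_card ⟨Finset.filter_subset _ _, fun hsub => ?_⟩
      exact (Finset.mem_filter.1 (hsub hc)).2.ne' hlc
    · intro p hp heq
      rw [hstep p hp] at heq
      have : len (out p) • sdir nx (out p) = 0 := by simpa using heq
      rcases smul_eq_zero.1 this with k | k
      · exact (ho3 p hp).ne' k
      · exact sdir_ne_zero h.poly (ho1 p hp) k
    · intro p hp heq
      beta_reduce at heq
      set q := nx (out p) + T • w (nx (out p)) with hq
      rw [hstep q (hmaps p hp), hq, hstep p hp, add_assoc, add_eq_left, ← hstep p hp, ← hq] at heq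
      have h1 : cr (sdir nx (out q)) (sdir nx (out p)) = 0 := by
        have : cr (sdir nx (out q)) (len (out p) • sdir nx (out p) + len (out q) • sdir nx (out q)) = 0 := by
          rw [heq, cr_zero_right]
        rw [cr_add_right, cr_smul_right, cr_smul_right, cr_self, mul_zero, add_zero] at this
        exact (mul_eq_zero.1 this).resolve_left (ho3 p hp).ne'
      have h2 := hpar p hp _ (ho1 q (hmaps p hp)) (ho3 q (hmaps p hp)) h1 (by
        rw [ho2 q (hmaps p hp), hq, hstep p hp, add_sub_cancel_left, cr_smul_right, cr_self, mul_zero])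
      rw [h2, ← add_smul] at heq
      rcases smul_eq_zero.1 heq with k | k
      · have := ho3 p hp; linarith
      · exact sdir_ne_zero h.poly (ho1 p hp) k
    · intro p hp q hq hqp hqn
      beta_reduce at hqn ⊢
      rw [hstep p hp] at hqn ⊢
      rw [add_sub_cancel_left, cr_smul_left]
      refine mul_pos (ho3 p hp) ?_
      have hge : 0 ≤ cr (sdir nx (out p)) (q - p) := by
        obtain ⟨c, hc, rfl⟩ := mem_corners.1 hq
        have := h.convex T h.T_pos.le le_rfl _ (ho1 p hp) c hc
        rwa [ho2 p hp] at this
      -- A further corner `q` on the line of the side out of `p` has a parameter `μ` there. If it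
      -- comes before `p` or beyond the end of the side, that end is strictly between two corners,
      -- so a second side is parallel to this one. If it lies within, `mem_endpoints` applies.
      refine lt_of_le_of_ne hge fun hzero => ?_
      obtain ⟨μ, hμ⟩ := exists_smul_of_cr_eq_zero (sdir_ne_zero h.poly (ho1 p hp)) hzero.symm
      have hqμ : q = p + μ • sdir nx (out p) := by rw [← hμ]; abel
      have hμ0 : μ ≠ 0 := by rintro rfl; simp at hqμ; exact hqp hqμ
      have hμl : μ ≠ len (out p) := by rintro rfl; exact hqn hqμ
      have hp' := hmaps p hp
      rw [hstep p hp] at hp'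
      have ex : ∀ x ∈ corners C w T, ∃ c ∈ C, x = c + T • w c := fun x hx => by
        obtain ⟨c, hc, h1⟩ := mem_corners.1 hx; exact ⟨c, hc, h1.symm⟩
      rcases lt_or_gt_of_ne hμ0 with hneg | hpos
      · obtain ⟨c, hc, hcp⟩ := ex p hp
        obtain ⟨f, hf, hfp, hlf⟩ := h.exists_in hc he₀ hle₀
        rw [← hcp] at hfp
        have h1 := h.cr_eq_zero_of_between hf (q := p) (u := sdir nx (out p))
          (by rw [← hfp, h.side' hf, cr_add_right, cr_smul_right, cr_self]; ring) (ex q hq) (ex _ hp')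
          (r := -μ) (s := len (out p)) (by linarith) (ho3 p hp) (by rw [hqμ, neg_smul]; abel) rfl
        have hfp' : f + T • w f - p = -(len f • sdir nx f) := by
          rw [← hfp, h.side' hf]; abel
        have h2 := hpar p hp f hf hlf h1 (by
          rw [hfp', cr_neg_right, cr_smul_right, cr_anticomm, h1]; simp)
        have h3 := ho2 p hp
        rw [← h2] at h3
        exact hlf.ne' ((h.side_eq_iff hf).1 (hfp.trans h3.symm))
      · rcases lt_or_gt_of_ne hμl with hlt | hgt
        · obtain ⟨c, hc, hcq⟩ := ex q hq
          have h1 := h.mem_endpoints hc (ho1 p hp) (ho3 p hp) (by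
            rw [← hcq, ho2 p hp, hstep p hp, hqμ, mem_segment_iff_smul]
            refine ⟨μ / len (out p), div_nonneg hpos.le (ho3 p hp).le,
              (div_le_one (ho3 p hp)).2 hlt.le, ?_⟩
            rw [add_sub_cancel_left, smul_smul, div_mul_cancel₀ _ (ho3 p hp).ne'])
          rw [← hcq, ho2 p hp, hstep p hp] at h1
          exact h1.elim hqp hqn
        · set p₂ := p + len (out p) • sdir nx (out p) with hp₂
          have h1 := h.cr_eq_zero_of_between (ho1 p₂ hp') (q := p₂) (u := sdir nx (out p))
            (by rw [ho2 p₂ hp']) (ex p hp) (ex q hq) (ho3 p hp) (s := μ - len (out p)) (by linarith)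
            (by rw [hp₂]; abel) (by rw [hp₂, hqμ, sub_smul]; abel)
          have h2 := hpar p hp _ (ho1 p₂ hp') (ho3 p₂ hp') h1 (by
            rw [ho2 p₂ hp', hp₂, add_sub_cancel_left, cr_smul_right, cr_self, mul_zero])
          have h3 := ho2 p₂ hp'
          rw [h2, ho2 p hp, hp₂] at h3
          have : len (out p) • sdir nx (out p) = 0 := by simpa using h3.symm
          rcases smul_eq_zero.1 this with k | k
          · exact (ho3 p hp).ne' k
          · exact sdir_ne_zero h.poly (ho1 p hp) k
    · intro c hc hlc
      have hm : c + T • w c ∈ corners C w T := mem_corners.2 ⟨c, hc, rfl⟩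
      beta_reduce
      rw [huniq _ (ho1 _ hm) c hc (ho3 _ hm) hlc (ho2 _ hm)]
    · intro p hp
      exact ⟨out p, ho1 p hp, ho3 p hp, (ho2 p hp).symm⟩

end Collapse

/-! ### Removing convex cells -/

/-- A convex polygon whose sides are covered by edges and whose interior meets no edge. -/
structure IsCell (E : Finset (Sym2 Plane)) (C : Finset Plane) (nx : Plane → Plane) : Prop where
  poly : IsPolygon C nx
  covered : ∀ c ∈ C, ∀ x ∈ segment ℝ c (nx c), ∃ e ∈ E, x ∈ seg e
  empty : ∀ e ∈ E, ∀ x ∈ seg e, ∃ c ∈ C, cr (nx c - c) (x - c) ≤ 0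
  corner : ∀ c ∈ C, ∃ e ∈ E, c ∈ e

lemma NonCrossing.subset {E E' : Finset (Sym2 Plane)} (h : NonCrossing E') (hE : E ⊆ E') :
    NonCrossing E :=
  ⟨fun e he => h.not_isDiag e (hE he), fun e he f hf => h.mem e (hE he) f (hE hf)⟩

lemma NonCrossing.mem_of_node {E : Finset (Sym2 Plane)} (h : NonCrossing E) {e f : Sym2 Plane}
    (he : e ∈ E) (hf : f ∈ E) {x : Plane} (hx : x ∈ f) (hxe : x ∈ seg e) : x ∈ e := by
  by_cases hef : e = f
  · exact hef ▸ hx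
  · exact h.mem e he f hf hef x hxe (mem_seg_of_mem hx)

/-- A segment covered by edges that has no node in its interior is an edge. -/
lemma mem_of_covered {E : Finset (Sym2 Plane)} (h : NonCrossing E) {p q : Plane} (hpq : p ≠ q)
    (hp : ∃ e ∈ E, p ∈ e) (hq : ∃ e ∈ E, q ∈ e)
    (hcov : ∀ x ∈ segment ℝ p q, ∃ e ∈ E, x ∈ seg e)
    (hno : ∀ e ∈ E, ∀ x ∈ e, x ∈ segment ℝ p q → x = p ∨ x = q) : s(p, q) ∈ E := by
  have hd : q - p ≠ 0 := sub_ne_zero.2 hpq.symm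
  have hin : ∀ θ ∈ Ioo (0 : ℝ) 1, p + θ • (q - p) ∈ segment ℝ p q := fun θ hθ =>
    mem_segment_iff_smul.2 ⟨θ, hθ.1.le, hθ.2.le, rfl⟩
  have h1 : ∀ θ ∈ Ioo (0 : ℝ) 1, ∃ e ∈ E, p + θ • (q - p) ∈ seg e := fun θ hθ => hcov _ (hin θ hθ)
  choose! g hg1 hg2 using h1
  -- The segment has infinitely many inner points and there are finitely many edges. One edge
  -- therefore contains two of the points and is collinear with the segment.
  obtain ⟨θ, hθ, μ, hμ, hne, heq⟩ := (Set.Ioo_infinite (zero_lt_one' ℝ)).exists_ne_map_eq_of_mapsTo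
    (fun θ hθ => (hg1 θ hθ : g θ ∈ (E : Set (Sym2 Plane)))) E.finite_toSet
  have k1 := hg1 θ hθ
  have k2 := hg2 θ hθ
  have k3 := hg2 μ hμ
  rw [← heq] at k3
  generalize hgθ : g θ = e at k1 k2 k3
  induction e with | h r s =>
  have hrs : r ≠ s := by simpa using h.not_isDiag _ k1
  obtain ⟨c, hc⟩ := sub_eq_smul_of_mem_segment k2 k3
  have hc' : (μ - θ) • (q - p) = c • (s - r) := by rw [← hc, sub_smul]; abel
  have hpar : cr (q - p) (s - r) = 0 := by
    have h2 : cr ((μ - θ) • (q - p)) (q - p) = c * cr (s - r) (q - p) := by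
      rw [hc', cr_smul_left]
    rw [cr_smul_left, cr_self, mul_zero] at h2
    have hc0 : c ≠ 0 := by
      rintro rfl
      rw [zero_smul] at hc'
      rcases smul_eq_zero.1 hc' with k | k
      · exact hne (by linarith)
      · exact hd k
    rw [cr_anticomm, (mul_eq_zero.1 h2.symm).resolve_left hc0, neg_zero]
  have hx1 : p + θ • (q - p) ≠ p := by
    intro hx
    rw [add_eq_left] at hx
    rcases smul_eq_zero.1 hx with k | k
    · exact hθ.1.ne' k
    · exact hd k
  have hx2 : p + θ • (q - p) ≠ q := by
    intro hx
    have : p + θ • (q - p) = p + (1 : ℝ) • (q - p) := by rw [hx]; simp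
    exact hθ.2.ne (line_injective hd this)
  have hxr : ∀ y, y ∈ s(r, s) → p + θ • (q - p) ≠ y := by
    rintro y hy rfl
    exact (hno _ k1 _ hy (hin θ hθ)).elim hx1 hx2
  rw [eq_of_overlap hpq hrs hpar (hin θ hθ) k2 hx1 hx2 (hxr r (by simp)) (hxr s (by simp))
    (fun y hy hy' => hno _ k1 y (Sym2.mem_iff.2 hy) hy')]
  · exact k1
  · rintro y hy hy'
    have : ∃ e ∈ E, y ∈ e := by rcases hy with rfl | rfl <;> assumption
    obtain ⟨e, he, hye⟩ := this
    exact Sym2.mem_iff.1 (h.mem_of_node k1 he hye hy')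

/-- The side of a cell is a chain of edges. -/
lemma IsCell.exists_chain {E : Finset (Sym2 Plane)} {C : Finset Plane} {nx : Plane → Plane}
    (hC : IsCell E C nx) (hE : NonCrossing E) {c : Plane} (hc : c ∈ C) :
    ∃ G ⊆ E, (∀ f ∈ G, seg f ⊆ segment ℝ c (nx c)) ∧ (∀ x, ∑ f ∈ G, pull x f = pull x s(c, nx c)) ∧
      ∀ x, ∑ f ∈ G, inc x f = inc x s(c, nx c) := by
  classical
  have hV : ∀ x, x ∈ E.biUnion (fun e => e.toFinset) ↔ ∃ e ∈ E, x ∈ e := by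
    intro x; simp
  obtain ⟨G, h1, h2, h3⟩ := PlaneWeb.exists_chain (E.biUnion fun e => e.toFinset) c (nx c)
    (hC.poly.ne c hc).symm ((hV c).2 (hC.corner c hc)) ((hV _).2 (hC.corner _ (hC.poly.maps c hc)))
  refine ⟨G, fun f hf => ?_, fun f hf => (h1 f hf).2.1, h2, h3⟩
  obtain ⟨k1, k2, k3, k4⟩ := h1 f hf
  induction f with | h p q =>
  refine mem_of_covered hE (by simpa using k1) ((hV p).1 (k3 p (by simp))) ((hV q).1 (k3 q (by simp)))
    (fun x hx => hC.covered c hc x (k2 hx)) fun e he x hx hx' => ?_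
  exact Sym2.mem_iff.1 (k4 x ((hV x).2 ⟨e, he, hx⟩) hx')

/-- The mod two boundary at a vertex. -/
noncomputable def boundary {α : Type*} (E : Finset (Sym2 α)) (v : α) :
    (Sym2 α → ZMod 2) →ₗ[ZMod 2] ZMod 2 where
  toFun z := ∑ e ∈ E, z e * inc v e
  map_add' x y := by simp [add_mul, Finset.sum_add_distrib]
  map_smul' c x := by simp [mul_assoc, Finset.mul_sum]

open Classical in
/-- The indicator of an edge, as a chain mod two. -/
noncomputable def delta {α : Type*} (e : Sym2 α) : Sym2 α → ZMod 2 := fun f => if f = e then 1 else 0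

lemma delta_self {α : Type*} (e : Sym2 α) : delta e e = 1 := if_pos rfl

lemma delta_of_ne {α : Type*} {e f : Sym2 α} (h : f ≠ e) : delta e f = 0 := if_neg h

lemma boundary_delta {α : Type*} {E : Finset (Sym2 α)} {e : Sym2 α} (he : e ∈ E) (v : α) :
    boundary E v (delta e) = inc v e := by
  change ∑ f ∈ E, delta e f * inc v f = _
  rw [Finset.sum_eq_single e]
  · simp [delta_self]
  · intro f _ hf; simp [delta_of_ne hf]
  · intro h; exact absurd he h

/-! ### Prongs and final sides drawn into the cell -/

namespace Collapse

variable {C : Finset Plane} {nx pv : Plane → Plane} {a : Plane → ℝ} {w : Plane → Plane} {T : ℝ}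
  {len : Plane → ℝ}

lemma mem_prong_iff {c x : Plane} (hT : 0 < T) : x ∈ segment ℝ c (c + T • w c) ↔
    ∃ s, 0 ≤ s ∧ s ≤ T ∧ x = c + s • w c := by
  rw [mem_segment_iff_smul]
  constructor
  · rintro ⟨θ, h0, h1, rfl⟩
    exact ⟨θ * T, by positivity, by nlinarith, by rw [add_sub_cancel_left, smul_smul]⟩
  · rintro ⟨s, h0, h1, rfl⟩
    refine ⟨s / T, by positivity, (div_le_one hT).2 h1, ?_⟩
    rw [add_sub_cancel_left, smul_smul, div_mul_cancel₀ _ hT.ne']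

lemma w_ne_zero (h : Collapse C nx pv a w T len) {c : Plane} (hc : c ∈ C) : w c ≠ 0 := by
  intro h0
  have := h.cr_w c hc
  simp [h0] at this

/-- Depth at least `T` behind a fixed side is a half plane condition, and the final corners satisfy
it by `depth_ge`. -/
lemma le_depth_of_mem_hull (h : Collapse C nx pv a w T len) {x e : Plane} (he : e ∈ C)
    (hx : x ∈ convexHull ℝ (corners C w T : Set Plane)) : T ≤ a e * cr (sdir nx e) (x - e) := by
  have hS : ∀ y ∈ (corners C w T : Set Plane), T / a e + cr (sdir nx e) e ≤ cr (sdir nx e) y := by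
    intro y hy
    obtain ⟨c, hc, rfl⟩ := mem_corners.1 hy
    have := h.depth_ge h.T_pos.le le_rfl hc he
    rw [cr_sub_right] at this
    have h2 : T / a e ≤ cr (sdir nx e) (c + T • w c) - cr (sdir nx e) e := by
      rw [div_le_iff₀ (h.a_pos e he)]; linarith
    linarith
  have h3 := IsPolygon.le_of_mem_convexHull hS hx
  have h4 : T / a e ≤ cr (sdir nx e) (x - e) := by rw [cr_sub_right]; linarith
  rwa [div_le_iff₀ (h.a_pos e he), mul_comm] at h4

lemma segment_side_subset (h : Collapse C nx pv a w T len) {c : Plane} (hc : c ∈ C) :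
    segment ℝ (c + T • w c) (nx c + T • w (nx c)) ⊆ convexHull ℝ (corners C w T : Set Plane) :=
  (convex_convexHull ℝ _).segment_subset (subset_convexHull ℝ _ (mem_corners.2 ⟨c, hc, rfl⟩))
    (subset_convexHull ℝ _ (mem_corners.2 ⟨_, h.poly.maps c hc, rfl⟩))

open Classical in
/-- The edges that join the corners to their final positions. -/
noncomputable def prongs (C : Finset Plane) (w : Plane → Plane) (T : ℝ) : Finset (Sym2 Plane) :=
  C.image fun c => s(c, c + T • w c)

lemma mem_prongs {x : Sym2 Plane} : x ∈ prongs C w T ↔ ∃ c ∈ C, s(c, c + T • w c) = x := by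
  simp [prongs]

lemma depth_nonpos (h : Collapse C nx pv a w T len) {E : Finset (Sym2 Plane)} (hC : IsCell E C nx)
    {e : Sym2 Plane} (he : e ∈ E) {x : Plane} (hx : x ∈ seg e) :
    ∃ c ∈ C, a c * cr (sdir nx c) (x - c) ≤ 0 := by
  obtain ⟨c, hc, h1⟩ := hC.empty e he x hx
  refine ⟨c, hc, mul_nonpos_of_nonneg_of_nonpos (h.a_pos c hc).le ?_⟩
  rw [sdir, cr_udir_left]
  exact mul_nonpos_of_nonneg_of_nonpos (inv_nonneg.2 (norm_nonneg _)) h1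

/-- The interior of a cell meets no edge, so a point of an old edge has nonpositive depth behind
some side, whereas final corners have depth at least `T > 0` behind every side. -/
lemma corners_notMem (h : Collapse C nx pv a w T len) {E : Finset (Sym2 Plane)} (hC : IsCell E C nx)
    {e : Sym2 Plane} (he : e ∈ E) {p : Plane} (hp : p ∈ corners C w T) : p ∉ e := by
  intro hpe
  obtain ⟨d, hd, h1⟩ := h.depth_nonpos hC he (mem_seg_of_mem hpe)
  have := h.le_depth_of_mem_hull hd (subset_convexHull ℝ _ hp)
  linarith [h.T_pos]

open Classical in
-- Depth keeps the three kinds of edges apart. Points of old edges have depth at most `0` behind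
-- some side. The point of a prong at time `s` has depth `s` behind the side at its own corner and
-- at least `s` behind the others. The final polygon has depth at least `T` everywhere. So a prong
-- meets old edges at its start only and final sides at its end only. Two prongs meet only at equal
-- times, and before `T` this would make each corner the successor of the other. Final sides are
-- compared by `eq_of_overlap`.
lemma nonCrossing (h : Collapse C nx pv a w T len) {E : Finset (Sym2 Plane)} (hE : NonCrossing E)
    (hC : IsCell E C nx) : NonCrossing (E ∪ (prongs C w T ∪ sides C nx w T len)) := by
  have hT := h.T_pos
  have hcase : ∀ e ∈ E ∪ (prongs C w T ∪ sides C nx w T len), e ∈ E ∨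
      (∃ c ∈ C, s(c, c + T • w c) = e) ∨
      ∃ c ∈ C, 0 < len c ∧ s(c + T • w c, nx c + T • w (nx c)) = e := by
    intro e he
    rw [Finset.mem_union, Finset.mem_union, mem_prongs, mem_sides] at he
    exact he
  have hop : ∀ e ∈ E, ∀ c ∈ C, ∀ x ∈ seg e, x ∈ segment ℝ c (c + T • w c) → x = c := by
    intro e he c hc x hx hx'
    obtain ⟨s, h0, h1, rfl⟩ := (mem_prong_iff hT).1 hx'
    obtain ⟨d, hd, h2⟩ := h.depth_nonpos hC he hx
    have h3 := h.depth_ge h0 h1 hc hd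
    have : s = 0 := by linarith
    simp [this]
  have hos : ∀ e ∈ E, ∀ c ∈ C, ∀ x ∈ seg e,
      x ∉ segment ℝ (c + T • w c) (nx c + T • w (nx c)) := by
    intro e he c hc x hx hx'
    obtain ⟨d, hd, h2⟩ := h.depth_nonpos hC he hx
    have h3 := h.le_depth_of_mem_hull hd (h.segment_side_subset hc hx')
    linarith
  have hps : ∀ c ∈ C, ∀ d ∈ C, ∀ x ∈ segment ℝ c (c + T • w c),
      x ∈ segment ℝ (d + T • w d) (nx d + T • w (nx d)) → x = c + T • w c := by
    intro c hc d hd x hx hx'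
    obtain ⟨s, h0, h1, rfl⟩ := (mem_prong_iff hT).1 hx
    have h3 := h.le_depth_of_mem_hull hc (h.segment_side_subset hd hx')
    rw [h.depth_self s hc] at h3
    rw [le_antisymm h1 h3]
  refine ⟨?_, ?_⟩
  · intro e he
    rcases hcase e he with he | ⟨c, hc, rfl⟩ | ⟨c, hc, hlc, rfl⟩
    · exact hE.not_isDiag e he
    · rw [Sym2.mk_isDiag_iff]
      intro h1
      have : T • w c = 0 := by simpa using h1.symm
      rcases smul_eq_zero.1 this with k | k
      · exact hT.ne' k
      · exact h.w_ne_zero hc k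
    · rw [Sym2.mk_isDiag_iff]
      exact fun h1 => hlc.ne' ((h.side_eq_iff hc).1 h1.symm)
  · intro e he f hf hne x hx hx'
    rcases hcase e he with he | ⟨c, hc, rfl⟩ | ⟨c, hc, hlc, rfl⟩ <;>
      rcases hcase f hf with hf | ⟨d, hd, rfl⟩ | ⟨d, hd, hld, rfl⟩
    · exact hE.mem e he f hf hne x hx hx'
    · have := hop e he d hd x hx hx'
      subst this
      obtain ⟨g, hg, hxg⟩ := hC.corner _ hd
      exact hE.mem_of_node he hg hxg hx
    · exact absurd hx' (hos e he d hd x hx)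
    · rw [hop f hf c hc x hx' hx]; simp
    · obtain ⟨s, s0, s1, hs⟩ := (mem_prong_iff hT).1 hx
      obtain ⟨r, r0, r1, hr⟩ := (mem_prong_iff hT).1 hx'
      have hcd : c ≠ d := by rintro rfl; exact hne rfl
      have k1 := h.depth_ge r0 r1 hd hc
      have k2 := h.depth_ge s0 s1 hc hd
      have k3 := h.depth_self s hc
      have k4 := h.depth_self r hd
      rw [← hr] at k1 k4
      rw [← hs] at k2 k3
      have hsr : s = r := by linarith
      subst hsr
      rcases lt_or_eq_of_le s1 with hlt | heq
      · exfalso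
        have e1 : d = nx c := by
          by_contra hdn
          have := h.depth_gt s0 hlt hd hc hcd.symm hdn
          rw [← hr] at this
          linarith
        have e2 : c = nx d := by
          by_contra hdn
          have := h.depth_gt s0 hlt hc hd hcd hdn
          rw [← hs] at this
          linarith
        exact h.poly.ne_two c hc (by rw [← e1, ← e2])
      · rw [hs, heq]; simp
    · rw [hps c hc d hd x hx hx']; simp
    · exact absurd hx (hos f hf c hc x hx')
    · have h1 := hps d hd c hc x hx' hx
      rw [h1] at hx ⊢
      exact Sym2.mem_iff.2 (h.mem_endpoints hd hc hlc hx)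
    · by_contra hxe
      rw [Sym2.mem_iff, not_or] at hxe
      have hme : ∀ y, y = d + T • w d ∨ y = nx d + T • w (nx d) → y ∈ segment ℝ (c + T • w c)
          (nx c + T • w (nx c)) → y = c + T • w c ∨ y = nx c + T • w (nx c) := by
        rintro y (rfl | rfl) hy
        · exact h.mem_endpoints hd hc hlc hy
        · exact h.mem_endpoints (h.poly.maps d hd) hc hlc hy
      have hmf : ∀ y, y = c + T • w c ∨ y = nx c + T • w (nx c) → y ∈ segment ℝ (d + T • w d)
          (nx d + T • w (nx d)) → y = d + T • w d ∨ y = nx d + T • w (nx d) := by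
        rintro y (rfl | rfl) hy
        · exact h.mem_endpoints hc hd hld hy
        · exact h.mem_endpoints (h.poly.maps c hc) hd hld hy
      have x3 : x ≠ d + T • w d := fun k => (hme x (Or.inl k) hx).elim hxe.1 hxe.2
      have x4 : x ≠ nx d + T • w (nx d) := fun k => (hme x (Or.inr k) hx).elim hxe.1 hxe.2
      refine hne (eq_of_overlap (fun k => hlc.ne' ((h.side_eq_iff hc).1 k.symm))
        (fun k => hld.ne' ((h.side_eq_iff hd).1 k.symm)) ?_ hx hx' hxe.1 hxe.2 x3 x4 hme hmf)
      rw [h.side c hc, h.side d hd, cr_smul_left, cr_smul_right]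
      obtain ⟨θ, t0, t1, hθ⟩ := exists_param_of_mem_segment hx hxe.1 hxe.2
      obtain ⟨μ, m0, m1, hμ⟩ := exists_param_of_mem_segment hx' x3 x4
      rw [h.side c hc, smul_smul] at hθ
      rw [h.side d hd, smul_smul] at hμ
      have := h.cr_eq_zero_of_between hc (q := x) (u := sdir nx d) (x := d + T • w d)
        (y := nx d + T • w (nx d))
        (by rw [hθ, cr_add_right, cr_smul_right, cr_self, mul_zero, add_zero])
        ⟨d, hd, rfl⟩ ⟨_, h.poly.maps d hd, rfl⟩ (r := μ * len d) (s := (1 - μ) * len d) (by positivity)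
        (mul_pos (by linarith) hld) (eq_sub_of_add_eq hμ.symm)
        (by rw [h.side' hd, hμ, add_assoc _ ((μ * len d) • _), ← add_smul]; congr 2; ring)
      rw [this, mul_zero, mul_zero]

end Collapse

/-! ### Equilibrium and cycle rank after the replacement -/

namespace Collapse

variable {C : Finset Plane} {nx pv : Plane → Plane} {a : Plane → ℝ} {w : Plane → Plane} {T : ℝ}
  {len : Plane → ℝ}

open Classical in
/-- The tensions after the sides of a cell, made of the edges `G`, have moved. -/
noncomputable def newTension (t : Sym2 Plane →₀ ℝ) (C : Finset Plane) (nx pv : Plane → Plane)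
    (a : Plane → ℝ) (w : Plane → Plane) (T : ℝ) (len : Plane → ℝ)
    (G : Plane → Finset (Sym2 Plane)) : Sym2 Plane →₀ ℝ :=
  (t - ∑ c ∈ C, a c • ∑ f ∈ G c, Finsupp.single f 1) +
    (∑ c ∈ C, Finsupp.single s(c, c + T • w c) ‖cornerForce nx pv a c‖ +
      ∑ c ∈ C with 0 < len c, Finsupp.single s(c + T • w c, nx c + T • w (nx c)) (a c))

open Classical in
lemma pull_side (nx : Plane → Plane) (c v : Plane) :
    pull v s(c, nx c) = (if v = c then sdir nx c else 0) - (if v = nx c then sdir nx c else 0) := by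
  have e : udir (c - nx c) = -sdir nx c := by rw [← neg_sub, udir_neg, sdir]
  rw [pull_mk, e, show udir (nx c - c) = sdir nx c from rfl]
  split_ifs <;> simp

open Classical in
lemma norm_smul_pull_prong (h : Collapse C nx pv a w T len) {c : Plane} (hc : c ∈ C) (v : Plane) :
    ‖cornerForce nx pv a c‖ • pull v s(c, c + T • w c) =
      (if v = c then cornerForce nx pv a c else 0) -
        (if v = c + T • w c then cornerForce nx pv a c else 0) := by
  obtain ⟨ρ, hρ, hw⟩ := h.w_eq c hc
  have e1 : udir (c + T • w c - c) = udir (cornerForce nx pv a c) := by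
    rw [add_sub_cancel_left, udir_smul h.T_pos, hw, udir_smul hρ]
  have e2 : udir (c - (c + T • w c)) = -udir (cornerForce nx pv a c) := by
    rw [← neg_sub, udir_neg, e1]
  rw [pull_mk, e1, e2, smul_add, sub_eq_add_neg]
  congr 1
  · split_ifs
    · rw [norm_smul_udir]
    · simp
  · split_ifs
    · rw [smul_neg, norm_smul_udir]
    · simp

open Classical in
-- The ends of a vanished side coincide, so its contribution is zero on the right as well. This
-- allows sums over all corners.
lemma smul_pull_side (h : Collapse C nx pv a w T len) {c : Plane} (hc : c ∈ C) (v : Plane) :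
    (if 0 < len c then a c • pull v s(c + T • w c, nx c + T • w (nx c)) else 0) =
      (if v = c + T • w c then a c • sdir nx c else 0) -
        (if v = nx c + T • w (nx c) then a c • sdir nx c else 0) := by
  by_cases hl : 0 < len c
  · rw [if_pos hl, pull_mk, h.side c hc, udir_smul hl]
    have e1 : udir (sdir nx c) = sdir nx c := by
      have := norm_smul_udir (sdir nx c)
      rwa [h.norm_sdir hc, one_smul] at this
    have e2 : udir (c + T • w c - (nx c + T • w (nx c))) = -sdir nx c := by
      rw [← neg_sub, udir_neg, h.side c hc, udir_smul hl, e1]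
    rw [e1, e2, smul_add, sub_eq_add_neg]
    congr 1
    · split_ifs <;> simp
    · split_ifs <;> simp
  · have : len c = 0 := le_antisymm (not_lt.1 hl) (h.len_nonneg c hc)
    rw [if_neg hl, (h.side_eq_iff hc).2 this, sub_self]

/-- Taking off the tensions `a` removes the corner force at each corner, and the pull of the prong
restores it. At the far end the pull of the prong is opposite and cancels the corner force of the
final polygon, whose sides have the same directions and tensions. -/
lemma force_newTension (h : Collapse C nx pv a w T len) (t : Sym2 Plane →₀ ℝ)
    {G : Plane → Finset (Sym2 Plane)}
    (hG : ∀ c ∈ C, ∀ x, ∑ f ∈ G c, pull x f = pull x s(c, nx c)) (v : Plane) :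
    force v (newTension t C nx pv a w T len G) = force v t := by
  classical
  have e1 : force v (∑ c ∈ C, a c • ∑ f ∈ G c, Finsupp.single f 1) =
      ∑ c ∈ C, ((if v = c then a c • sdir nx c else 0) - (if v = nx c then a c • sdir nx c else 0)) := by
    rw [map_sum]
    refine Finset.sum_congr rfl fun c hc => ?_
    rw [map_smul, map_sum]
    simp only [force_single, one_smul]
    rw [hG c hc, pull_side, smul_sub, smul_ite, smul_ite, smul_zero]
  have e2 : force v (∑ c ∈ C, Finsupp.single s(c, c + T • w c) ‖cornerForce nx pv a c‖) =
      ∑ c ∈ C, ((if v = c then cornerForce nx pv a c else 0) -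
        (if v = c + T • w c then cornerForce nx pv a c else 0)) := by
    rw [map_sum]
    exact Finset.sum_congr rfl fun c hc => by rw [force_single, h.norm_smul_pull_prong hc]
  have e3 : force v (∑ c ∈ C with 0 < len c,
      Finsupp.single s(c + T • w c, nx c + T • w (nx c)) (a c)) =
      ∑ c ∈ C, ((if v = c + T • w c then a c • sdir nx c else 0) -
        (if v = nx c + T • w (nx c) then a c • sdir nx c else 0)) := by
    rw [map_sum, Finset.sum_filter]
    exact Finset.sum_congr rfl fun c hc => by rw [force_single, h.smul_pull_side hc]
  have r : ∀ φ : Plane → Plane, ∑ c ∈ C, (if v = φ (nx c) then a c • sdir nx c else 0) =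
      ∑ c ∈ C, (if v = φ c then a (pv c) • sdir nx (pv c) else 0) := by
    intro φ
    refine Finset.sum_bij' (fun c _ => nx c) (fun c _ => pv c) (fun c hc => h.poly.maps c hc)
      (fun c hc => h.pv_mem c hc) (fun c hc => h.pv_nx c hc) (fun c hc => h.nx_pv c hc) fun c hc => ?_
    rw [h.pv_nx c hc]
  have r1 := r id
  have r2 := r fun c => c + T • w c
  simp only [id] at r1
  rw [newTension, map_add, map_add, map_sub, e1, e2, e3, Finset.sum_sub_distrib,
    Finset.sum_sub_distrib, Finset.sum_sub_distrib, r1, r2]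
  have key : ∀ c ∈ C, ∀ φ : Plane → Plane, (if v = φ c then cornerForce nx pv a c else 0) =
      (if v = φ c then a c • sdir nx c else 0) - (if v = φ c then a (pv c) • sdir nx (pv c) else 0) := by
    intro c _ φ
    split_ifs
    · rfl
    · simp
  have k1 := Finset.sum_congr rfl fun c hc => key c hc id
  have k2 := Finset.sum_congr rfl fun c hc => key c hc fun c => c + T • w c
  simp only [id] at k1
  rw [k1, k2, Finset.sum_sub_distrib, Finset.sum_sub_distrib]
  abel

end Collapse

/-- Sides that share a nondegenerate segment lie on one line, so `d - c` is parallel to the side out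
of `c`. That contradicts strict convexity, or the turn at `d` when `d = nx c`. -/
lemma IsCell.disjoint_sides {E : Finset (Sym2 Plane)} {C : Finset Plane} {nx : Plane → Plane}
    (hC : IsCell E C nx) {c d : Plane} (hc : c ∈ C) (hd : d ∈ C) {f : Sym2 Plane} (hf : ¬ f.IsDiag)
    (h1 : seg f ⊆ segment ℝ c (nx c)) (h2 : seg f ⊆ segment ℝ d (nx d)) : c = d := by
  induction f with | h p q =>
  have hpq : p ≠ q := by simpa using hf
  have hs : p - q ≠ 0 := sub_ne_zero.2 hpq
  by_contra hcd
  obtain ⟨r, hr⟩ := sub_eq_smul_of_mem_segment (h1 (right_mem_segment ℝ p q)) (h1 (left_mem_segment ℝ p q))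
  obtain ⟨s, hs'⟩ := sub_eq_smul_of_mem_segment (h2 (right_mem_segment ℝ p q)) (h2 (left_mem_segment ℝ p q))
  have hr0 : r ≠ 0 := by rintro rfl; rw [zero_smul] at hr; exact hs hr
  have hs0 : s ≠ 0 := by rintro rfl; rw [zero_smul] at hs'; exact hs hs'
  have hpar : cr (nx c - c) (nx d - d) = 0 := by
    have : r * (s * cr (nx c - c) (nx d - d)) = 0 := by
      rw [← cr_smul_right, ← cr_smul_left, ← hr, ← hs', cr_self]
    exact (mul_eq_zero.1 ((mul_eq_zero.1 this).resolve_left hr0)).resolve_left hs0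
  have hd0 : cr (nx c - c) (d - c) = 0 := by
    obtain ⟨θ, -, -, e1⟩ := mem_segment_iff_smul.1 (h1 (left_mem_segment ℝ p q))
    obtain ⟨μ, -, -, e2⟩ := mem_segment_iff_smul.1 (h2 (left_mem_segment ℝ p q))
    have : d - c = θ • (nx c - c) - μ • (nx d - d) := by
      have h3 : c + θ • (nx c - c) = d + μ • (nx d - d) := e1.symm.trans e2
      rw [sub_eq_sub_iff_add_eq_add, ← h3, add_comm]
    rw [this, cr_sub_right, cr_smul_right, cr_smul_right, cr_self, hpar]; ring
  by_cases hdn : d = nx c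
  · have := hC.poly.turn hc
    rw [hdn] at hpar
    rw [hpar] at this
    exact lt_irrefl _ this
  · have := hC.poly.left c hc d hd (Ne.symm hcd) hdn
    rw [hd0] at this
    exact lt_irrefl _ this

lemma inc_triangle {α : Type*} {c n p : α} (h1 : c ≠ n) (h2 : c ≠ p) (h3 : p ≠ n) (v : α) :
    inc v s(c, n) + (inc v s(c, p) + inc v s(n, p)) = 0 := by
  rw [Sym2.eq_swap (a := n), inc_add_inc h2 h3 h1]
  exact CharTwo.add_self_eq_zero _

lemma inc_quadrilateral {α : Type*} {c n p q : α} (h1 : c ≠ n) (h2 : c ≠ p) (h3 : p ≠ q)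
    (h4 : q ≠ n) (h5 : p ≠ n) (v : α) :
    inc v s(c, n) + (inc v s(c, p) + (inc v s(p, q) + inc v s(n, q))) = 0 := by
  rw [Sym2.eq_swap (a := n), inc_add_inc h3 h4 h5, inc_add_inc h2 h5 h1]
  exact CharTwo.add_self_eq_zero _

open Classical in
/-- The cycle formed by a chain `G` from `p` to `q` and a detour over the new corners `p'`, `q'`. -/
noncomputable def collar {α : Type*} (G : Finset (Sym2 α)) (p q p' q' : α) : Sym2 α → ZMod 2 :=
  ∑ f ∈ G, delta f + (delta s(p, p') + ((if p' = q' then 0 else delta s(p', q')) + delta s(q, q')))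

lemma collar_mem {α : Type*} {E G : Finset (Sym2 α)} {p q p' q' : α} (hG : ∀ f ∈ G, f ∈ E)
    (hinc : ∀ v, ∑ f ∈ G, inc v f = inc v s(p, q)) (hp : s(p, p') ∈ E) (hq : s(q, q') ∈ E)
    (hs : p' ≠ q' → s(p', q') ∈ E) (hpq : p ≠ q) (hpp : p ≠ p') (hqq : q' ≠ q)
    (hqp : p' ≠ q) : collar G p q p' q' ∈ cycleSpace E := by
  have hz : ∀ f ∈ E, ∀ e ∉ E, delta f e = 0 := fun f hf e he =>
    delta_of_ne (by rintro rfl; exact he hf)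
  refine ⟨fun e he => ?_, fun v => ?_⟩
  · have k1 : (∑ f ∈ G, delta f) e = 0 := by
      rw [Finset.sum_apply]
      exact Finset.sum_eq_zero fun f hf => hz f (hG f hf) e he
    simp only [collar, Pi.add_apply, k1, hz _ hp e he, hz _ hq e he]
    split_ifs with h
    · simp
    · simp [hz _ (hs h) e he]
  · change boundary E v (collar G p q p' q') = 0
    have k1 : boundary E v (∑ f ∈ G, delta f) = inc v s(p, q) := by
      rw [map_sum, ← hinc v]
      exact Finset.sum_congr rfl fun f hf => boundary_delta (hG f hf) v
    rw [collar, map_add, map_add, map_add, k1, boundary_delta hp, boundary_delta hq]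
    split_ifs with h
    · subst h
      rw [map_zero, zero_add]
      exact inc_triangle hpq hpp hqq v
    · rw [boundary_delta (hs h)]
      exact inc_quadrilateral hpq hpp h hqq hqp v

lemma collar_of_mem {α : Type*} {G : Finset (Sym2 α)} {p q p' q' : α} {e : Sym2 α} (he : e ∈ G)
    (hp : e ≠ s(p, p')) (hq : e ≠ s(q, q')) (hs : p' ≠ q' → e ≠ s(p', q')) :
    collar G p q p' q' e = 1 := by
  have k1 : (∑ f ∈ G, delta f) e = 1 := by
    rw [Finset.sum_apply, Finset.sum_eq_single e (fun f _ hf => delta_of_ne hf.symm)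
      (fun h => absurd he h), delta_self]
  simp only [collar, Pi.add_apply, k1, delta_of_ne hp, delta_of_ne hq]
  split_ifs with h
  · simp
  · simp [delta_of_ne (hs h)]

lemma collar_of_notMem {α : Type*} {G : Finset (Sym2 α)} {p q p' q' : α} {e : Sym2 α} (he : e ∉ G)
    (hp : e ≠ s(p, p')) (hq : e ≠ s(q, q')) (hs : p' ≠ q' → e ≠ s(p', q')) :
    collar G p q p' q' e = 0 := by
  have k1 : (∑ f ∈ G, delta f) e = 0 := by
    rw [Finset.sum_apply]
    exact Finset.sum_eq_zero fun f hf => delta_of_ne (by rintro rfl; exact he hf)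
  simp only [collar, Pi.add_apply, k1, delta_of_ne hp, delta_of_ne hq]
  split_ifs with h
  · simp
  · simp [delta_of_ne (hs h)]

set_option maxHeartbeats 400000 in
/-- One step of the removal of a convex cell. -/
lemma IsNet.shrink_cell {N : ℕ} {X F : Fin N → Plane} {t : Sym2 Plane →₀ ℝ} (ht : IsNet X F t)
    {C : Finset Plane} {nx : Plane → Plane} (hC : IsCell t.support C nx) :
    ∃ t', IsNet X F t' ∧ (cycleRank t'.support < cycleRank t.support ∨
      cycleRank t'.support ≤ cycleRank t.support ∧
        ∃ C' nx', IsCell t'.support C' nx' ∧ C'.card < C.card) := by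
  classical
  have hch : ∀ c ∈ C, ∃ G ⊆ t.support, (∀ f ∈ G, seg f ⊆ segment ℝ c (nx c)) ∧
      (∀ x, ∑ f ∈ G, pull x f = pull x s(c, nx c)) ∧ ∀ x, ∑ f ∈ G, inc x f = inc x s(c, nx c) :=
    fun c hc => hC.exists_chain ht.nonCrossing hc
  choose! G hGE hGseg hGpull hGinc using hch
  have hGdisj : ∀ c ∈ C, ∀ d ∈ C, ∀ f ∈ G c, f ∈ G d → c = d := fun c hc d hd f hf hf' =>
    hC.disjoint_sides hc hd (ht.nonCrossing.not_isDiag f (hGE c hc hf)) (hGseg c hc f hf)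
      (hGseg d hd f hf')
  have hmin : ∀ c ∈ C, ∃ e ∈ G c, ∀ f ∈ G c, t e ≤ t f := by
    intro c hc
    refine (G c).exists_min_image t ?_
    by_contra hne
    rw [Finset.not_nonempty_iff_eq_empty] at hne
    have := hGpull c hc c
    rw [hne, Finset.sum_empty, pull_left (hC.poly.ne c hc).symm] at this
    exact sdir_ne_zero hC.poly hc this.symm
  choose! m hmG hmle using hmin
  -- The least tension along the side: subtracting it leaves nonnegative tensions and makes the edge
  -- `m c` disappear.
  set a : Plane → ℝ := fun c => t (m c) with ha
  obtain ⟨pv, w, T, len, h⟩ := exists_collapse hC.poly (a := a)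
    (fun c hc => ht.pos _ (hGE c hc (hmG c hc)))
  have hT := h.T_pos
  set t₁ : Sym2 Plane →₀ ℝ := t - ∑ c ∈ C, a c • ∑ f ∈ G c, Finsupp.single f 1 with ht₁
  set B : Sym2 Plane →₀ ℝ :=
    ∑ c ∈ C, Finsupp.single s(c, c + T • w c) ‖cornerForce nx pv a c‖ with hB
  set S : Sym2 Plane →₀ ℝ :=
    ∑ c ∈ C with 0 < len c, Finsupp.single s(c + T • w c, nx c + T • w (nx c)) (a c) with hS
  set t' := Collapse.newTension t C nx pv a w T len G with ht'
  have htt : t' = t₁ + (B + S) := by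
    rw [ht', ht₁, hB, hS, Collapse.newTension]
  have ht₁app : ∀ f, t₁ f = t f - ∑ c ∈ C, a c * (if f ∈ G c then 1 else 0) := by
    intro f
    rw [ht₁, Finsupp.sub_apply, Finsupp.finsetSum_apply]
    congr 1
    refine Finset.sum_congr rfl fun c _ => ?_
    rw [Finsupp.smul_apply, Finsupp.finsetSum_apply, smul_eq_mul]
    congr 1
    simp [Finsupp.single_apply]
  have ht₁in : ∀ c ∈ C, ∀ f ∈ G c, t₁ f = t f - a c := by
    intro c hc f hf
    rw [ht₁app, Finset.sum_eq_single c]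
    · simp [hf]
    · intro d hd hdc
      rw [if_neg fun hf' => hdc (hGdisj d hd c hc f hf' hf), mul_zero]
    · exact fun hc' => absurd hc hc'
  have ht₁out : ∀ f, (∀ c ∈ C, f ∉ G c) → t₁ f = t f := by
    intro f hf
    rw [ht₁app, Finset.sum_eq_zero fun c hc => by rw [if_neg (hf c hc), mul_zero], sub_zero]
  have htnn : ∀ e, 0 ≤ t e := by
    intro e
    by_cases he : e ∈ t.support
    · exact (ht.pos e he).le
    · rw [Finsupp.notMem_support_iff.1 he]
  have ht₁nn : ∀ f, 0 ≤ t₁ f := by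
    intro f
    by_cases hf : ∃ c ∈ C, f ∈ G c
    · obtain ⟨c, hc, hf⟩ := hf
      rw [ht₁in c hc f hf]
      exact sub_nonneg.2 (hmle c hc f hf)
    · push Not at hf
      rw [ht₁out f hf]
      exact htnn f
  have ht₁supp : ∀ f, t₁ f ≠ 0 → f ∈ t.support := by
    intro f hf
    by_cases hf' : ∃ c ∈ C, f ∈ G c
    · obtain ⟨c, hc, hf'⟩ := hf'
      exact hGE c hc hf'
    · push Not at hf'
      rw [ht₁out f hf'] at hf
      exact Finsupp.mem_support_iff.2 hf
  have ht₁m : ∀ c ∈ C, t₁ (m c) = 0 := fun c hc => by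
    rw [ht₁in c hc _ (hmG c hc)]; exact sub_self _
  have hBapp : ∀ f, B f = ∑ c ∈ C, if s(c, c + T • w c) = f then ‖cornerForce nx pv a c‖ else 0 := by
    intro f
    rw [hB, Finsupp.finsetSum_apply]
    exact Finset.sum_congr rfl fun c _ => Finsupp.single_apply
  have hSapp : ∀ f, S f = ∑ c ∈ C with 0 < len c,
      if s(c + T • w c, nx c + T • w (nx c)) = f then a c else 0 := by
    intro f
    rw [hS, Finsupp.finsetSum_apply]
    exact Finset.sum_congr rfl fun c _ => Finsupp.single_apply
  have hBnn : ∀ f, 0 ≤ B f := by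
    intro f
    rw [hBapp]
    exact Finset.sum_nonneg fun c _ => by split_ifs <;> positivity
  have hSterm : ∀ f, ∀ c ∈ C.filter (fun c => 0 < len c),
      0 ≤ if s(c + T • w c, nx c + T • w (nx c)) = f then a c else 0 := fun f c hc => by
    have := h.a_pos c (Finset.mem_filter.1 hc).1
    split_ifs
    · exact this.le
    · exact le_rfl
  have hSnn : ∀ f, 0 ≤ S f := by
    intro f
    rw [hSapp]
    exact Finset.sum_nonneg (hSterm f)
  have hBsupp : ∀ f, B f ≠ 0 → f ∈ Collapse.prongs C w T := by
    intro f hf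
    by_contra hcon
    refine hf ?_
    rw [hBapp]
    refine Finset.sum_eq_zero fun c hc => if_neg fun heq => hcon ?_
    exact Collapse.mem_prongs.2 ⟨c, hc, heq⟩
  have hSsupp : ∀ f, S f ≠ 0 → f ∈ Collapse.sides C nx w T len := by
    intro f hf
    by_contra hcon
    refine hf ?_
    rw [hSapp]
    refine Finset.sum_eq_zero fun c hc => if_neg fun heq => hcon ?_
    exact Collapse.mem_sides.2 ⟨c, (Finset.mem_filter.1 hc).1, (Finset.mem_filter.1 hc).2, heq⟩
  have htapp : ∀ f, t' f = t₁ f + (B f + S f) := fun f => by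
    rw [htt, Finsupp.add_apply, Finsupp.add_apply]
  set E' := t.support ∪ (Collapse.prongs C w T ∪ Collapse.sides C nx w T len) with hE'
  have hnew : ∀ e ∈ Collapse.prongs C w T ∪ Collapse.sides C nx w T len, e ∉ t.support := by
    intro e he hmem
    rcases Finset.mem_union.1 he with he | he
    · obtain ⟨c, hc, rfl⟩ := Collapse.mem_prongs.1 he
      exact h.corners_notMem hC hmem (Collapse.mem_corners.2 ⟨c, hc, rfl⟩) (by simp)
    · obtain ⟨c, hc, -, rfl⟩ := Collapse.mem_sides.1 he
      exact h.corners_notMem hC hmem (Collapse.mem_corners.2 ⟨c, hc, rfl⟩) (by simp)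
  have hsub : t'.support ⊆ E' := by
    intro f hf
    rw [Finsupp.mem_support_iff, htapp] at hf
    rw [hE', Finset.mem_union, Finset.mem_union]
    by_contra hcon
    push Not at hcon
    have h1 : t₁ f = 0 := by by_contra k; exact hcon.1 (ht₁supp f k)
    have h2 : B f = 0 := by by_contra k; exact hcon.2.1 (hBsupp f k)
    have h3 : S f = 0 := by by_contra k; exact hcon.2.2 (hSsupp f k)
    rw [h1, h2, h3] at hf
    simp at hf
  have hmE : ∀ c ∈ C, m c ∈ t.support := fun c hc => hGE c hc (hmG c hc)
  have hm' : ∀ c ∈ C, m c ∉ t'.support := by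
    intro c hc hmem
    rw [Finsupp.mem_support_iff, htapp, ht₁m c hc, zero_add] at hmem
    have h2 : B (m c) = 0 := by
      by_contra k
      exact hnew _ (Finset.mem_union_left _ (hBsupp _ k)) (hmE c hc)
    have h3 : S (m c) = 0 := by
      by_contra k
      exact hnew _ (Finset.mem_union_right _ (hSsupp _ k)) (hmE c hc)
    rw [h2, h3] at hmem
    simp at hmem
  have hsideT : ∀ c ∈ C, 0 < len c → s(c + T • w c, nx c + T • w (nx c)) ∈ t'.support := by
    intro c hc hlc
    rw [Finsupp.mem_support_iff, htapp]
    have h3 : 0 < S s(c + T • w c, nx c + T • w (nx c)) := by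
      rw [hSapp]
      refine Finset.sum_pos' (hSterm _) ⟨c, Finset.mem_filter.2 ⟨hc, hlc⟩, ?_⟩
      rw [if_pos rfl]
      exact h.a_pos c hc
    have h1 := ht₁nn s(c + T • w c, nx c + T • w (nx c))
    have h2 := hBnn s(c + T • w c, nx c + T • w (nx c))
    linarith
  have hNC := h.nonCrossing ht.nonCrossing hC
  refine ⟨t', ⟨?_, hNC.subset hsub, ?_⟩, ?_⟩
  · intro e he
    refine lt_of_le_of_ne ?_ (Finsupp.mem_support_iff.1 he).symm
    rw [htapp]
    have := ht₁nn e; have := hBnn e; have := hSnn e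
    linarith
  · intro v
    rw [ht', h.force_newTension t hGpull, ht.balance]
  -- The new vertices are the final corners. The prong of a corner leads to it from an old node, so
  -- it meets the new vertices in that corner only.
  have hrank1 : cycleRank E' + (Collapse.corners C w T).card ≤
      cycleRank t.support + (Collapse.prongs C w T ∪ Collapse.sides C nx w T len).card := by
    refine cycleRank_add_le Finset.subset_union_left (fun e => ?_) _
      (fun p hp e he => h.corners_notMem hC he hp) fun p hp => ?_
    · rw [Finset.mem_union (s := t.support)]
      constructor
      · exact fun he => ⟨Or.inr he, hnew e he⟩
      · rintro ⟨h1 | h1, h2⟩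
        · exact absurd h1 h2
        · exact h1
    · obtain ⟨c, hc, rfl⟩ := Collapse.mem_corners.1 hp
      refine ⟨s(c, c + T • w c), Finset.mem_union_left _ (Collapse.mem_prongs.2 ⟨c, hc, rfl⟩),
        fun q hq => ?_⟩
      rw [Sym2.mem_iff]
      constructor
      · rintro (rfl | h1)
        · obtain ⟨e, he, hqe⟩ := hC.corner _ hc
          exact absurd hqe (h.corners_notMem hC he hq)
        · exact h1
      · exact Or.inr
  have hprong : ∀ c ∈ C, s(c, c + T • w c) ∈ E' := fun c hc =>
    Finset.mem_union_right _ (Finset.mem_union_left _ (Collapse.mem_prongs.2 ⟨c, hc, rfl⟩))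
  have hside : ∀ c ∈ C, 0 < len c → s(c + T • w c, nx c + T • w (nx c)) ∈ E' := fun c hc hl =>
    Finset.mem_union_right _ (Finset.mem_union_right _ (Collapse.mem_sides.2 ⟨c, hc, hl, rfl⟩))
  have hnE : ∀ c ∈ C, ∀ d ∈ C, c ≠ d + T • w d := by
    rintro c hc d hd heq
    obtain ⟨e, he, hce⟩ := hC.corner c hc
    rw [heq] at hce
    exact h.corners_notMem hC he (Collapse.mem_corners.2 ⟨d, hd, rfl⟩) hce
  -- The collar over side `c`, made of its chain, two prongs and the final side, is a cycle that
  -- contains `m c` and no other `m d`. The `C.card` lost edges thus lower the rank by at least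
  -- their number.
  have hrank2 : cycleRank t'.support + C.card ≤ cycleRank E' := by
    have := cycleRank_remove_le (ι := C) hsub (fun c => m c.1) (fun c => hm' c.1 c.2)
      (fun c => collar (G c.1) c.1 (nx c.1) (c.1 + T • w c.1) (nx c.1 + T • w (nx c.1))) ?_ ?_
    · rwa [Fintype.card_coe] at this
    · rintro ⟨c, hc⟩
      have hcn := h.poly.maps c hc
      refine collar_mem (fun f hf => Finset.mem_union_left _ (hGE c hc hf)) (hGinc c hc)
        (hprong c hc) (hprong _ hcn) (fun hne => hside c hc ?_) (h.poly.ne c hc).symm (hnE c hc c hc)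
        (hnE _ hcn _ hcn).symm (hnE _ hcn c hc).symm
      refine lt_of_le_of_ne (h.len_nonneg c hc) fun h0 => hne ?_
      exact ((h.side_eq_iff hc).2 h0.symm).symm
    · rintro ⟨c, hc⟩ ⟨d, hd⟩
      have hcn := h.poly.maps c hc
      have k : ∀ f ∈ Collapse.prongs C w T ∪ Collapse.sides C nx w T len, m d ≠ f :=
        fun f hf heq => hnew f hf (heq ▸ hmE d hd)
      have k1 := k _ (Finset.mem_union_left _ (Collapse.mem_prongs.2 ⟨c, hc, rfl⟩))
      have k2 := k _ (Finset.mem_union_left _ (Collapse.mem_prongs.2 ⟨_, hcn, rfl⟩))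
      have k3 : c + T • w c ≠ nx c + T • w (nx c) →
          m d ≠ s(c + T • w c, nx c + T • w (nx c)) := fun hne =>
        k _ (Finset.mem_union_right _ (Collapse.mem_sides.2 ⟨c, hc,
          lt_of_le_of_ne (h.len_nonneg c hc) fun h0 => hne ((h.side_eq_iff hc).2 h0.symm).symm, rfl⟩))
      simp only [Subtype.mk.injEq]
      by_cases hcd : c = d
      · subst hcd
        rw [if_pos rfl, collar_of_mem (hmG c hc) k1 k2 k3]
      · rw [if_neg hcd]
        exact collar_of_notMem (fun hm => hcd (hGdisj c hc d hd _ hm (hmG d hd))) k1 k2 k3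
  have hcardN : (Collapse.prongs C w T ∪ Collapse.sides C nx w T len).card ≤
      C.card + (Collapse.sides C nx w T len).card :=
    (Finset.card_union_le _ _).trans (Nat.add_le_add_right Finset.card_image_le _)
  -- Since there are at most `C.card` prongs, the two estimates leave a change of at most the number
  -- of final sides minus that of final corners.
  rcases h.card_sides with hlt | ⟨hle, hcard, nx', hpoly, hnx', hcov⟩
  · left; omega
  · right
    refine ⟨by omega, _, nx', ⟨hpoly, ?_, ?_, ?_⟩, hcard⟩
    · intro p hp x hx
      obtain ⟨c, hc, hlc, rfl⟩ := hcov p hp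
      rw [hnx' c hc hlc] at hx
      exact ⟨_, hsideT c hc hlc, hx⟩
    · intro e he x hx
      by_contra hcon
      push Not at hcon
      have hhull := hpoly.mem_convexHull fun c hc => (hcon c hc).le
      rcases Finset.mem_union.1 (hsub he) with he' | he'
      · obtain ⟨d, hd, h1⟩ := h.depth_nonpos hC he' hx
        have := h.le_depth_of_mem_hull hd hhull
        linarith
      rcases Finset.mem_union.1 he' with he' | he'
      · obtain ⟨c, hc, rfl⟩ := Collapse.mem_prongs.1 he'
        obtain ⟨s, s0, s1, rfl⟩ := (Collapse.mem_prong_iff hT).1 hx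
        have h1 := h.le_depth_of_mem_hull hc hhull
        rw [h.depth_self s hc] at h1
        have h2 : s = T := le_antisymm s1 h1
        subst h2
        have := hcon _ (Collapse.mem_corners.2 ⟨c, hc, rfl⟩)
        rw [sub_self, cr_zero_right] at this
        exact lt_irrefl _ this
      · obtain ⟨c, hc, hlc, rfl⟩ := Collapse.mem_sides.1 he'
        have := hcon _ (Collapse.mem_corners.2 ⟨c, hc, rfl⟩)
        rw [hnx' c hc hlc] at this
        obtain ⟨θ, -, -, rfl⟩ := mem_segment_iff_smul.1 hx
        rw [add_sub_cancel_left, cr_smul_right, cr_self, mul_zero] at this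
        exact lt_irrefl _ this
    · intro p hp
      obtain ⟨c, hc, hlc, rfl⟩ := hcov p hp
      exact ⟨_, hsideT c hc hlc, by simp⟩

/-- A net with a convex cell can be replaced by a net with fewer cycles. -/
lemma IsNet.exists_cycleRank_lt {N : ℕ} {X F : Fin N → Plane} {t : Sym2 Plane →₀ ℝ}
    (ht : IsNet X F t) {C : Finset Plane} {nx : Plane → Plane} (hC : IsCell t.support C nx) :
    ∃ t', IsNet X F t' ∧ cycleRank t'.support < cycleRank t.support := by
  induction hn : C.card using Nat.strong_induction_on generalizing t C nx with | _ n ih =>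
  obtain ⟨t', ht', h | ⟨h1, C', nx', hC', h2⟩⟩ := ht.shrink_cell hC
  · exact ⟨t', ht', h⟩
  · obtain ⟨t'', ht'', h3⟩ := ih _ (hn ▸ h2) ht' hC' rfl
    exact ⟨t'', ht'', h3.trans_le h1⟩

/-- A net with all terminals as nodes that has no convex cells. -/
lemma exists_isNet_no_cell {N : ℕ} (X F : Fin N → Plane) (W : Web) (hW : W.Supports X F) :
    ∃ t, IsNet X F t ∧ (∀ i, ∀ e ∈ t.support, X i ∈ seg e → X i ∈ e) ∧
      ∀ C nx, ¬ IsCell t.support C nx := by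
  classical
  obtain ⟨t₀, ht₀⟩ := exists_isNet_of_supports X F W hW
  -- Take the least cycle rank of any net for these forces. Inserting the terminals afterwards does
  -- not raise it, so a cell would still contradict minimality.
  have hex : ∃ n, ∃ t, IsNet X F t ∧ cycleRank t.support = n := ⟨_, t₀, ht₀, rfl⟩
  obtain ⟨t₁, ht₁, hr⟩ := Nat.find_spec hex
  obtain ⟨t, ht, hle, hX⟩ := exists_isNet_terminals ht₁
  refine ⟨t, ht, hX, fun C nx hC => ?_⟩
  obtain ⟨t', ht', hlt⟩ := ht.exists_cycleRank_lt hC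
  exact Nat.find_min hex (hr ▸ hlt.trans_le hle) ⟨t', ht', rfl⟩

/-! ### Local convexity implies convexity -/

lemma exists_box {γ : ℝ → ℝ → Plane} (hγ : Continuous fun q : ℝ × ℝ => γ q.1 q.2) (s τ : ℝ) {r : ℝ}
    (hr : 0 < r) : ∃ δ > 0, ∀ s' τ', |s' - s| < δ → |τ' - τ| < δ →
      γ s' τ' ∈ Metric.ball (γ s τ) r := by
  have hat : ContinuousAt (fun q : ℝ × ℝ => γ q.1 q.2) (s, τ) := hγ.continuousAt
  obtain ⟨δ, hδ, hball⟩ := Metric.continuousAt_iff.1 hat r hr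
  refine ⟨δ, hδ, fun s' τ' h1 h2 => ?_⟩
  have h := @hball (s', τ') 
  refine h ?_
  rw [Prod.dist_eq, max_lt_iff, Real.dist_eq, Real.dist_eq]
  exact ⟨h1, h2⟩

/-- Here `γ s τ` sweeps the triangle: it divides the segment from `b` to the point `τ` of `[a, c]`
in the ratio `s`. If some point is outside `U`, take the lowest bad level `s` and the first bad `τ`
on it. Everything below the level, and everything before `τ` on it, lies in `U`. In a small ball the
points just before `τ`, and those just below the level after `τ`, therefore belong to one component
of `U`, which is convex. The bad point is the midpoint of an interior point and a closure point of
this component, hence in it. -/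
lemma segment_subset_of_locally_convex {U : Set Plane} (hU : IsOpen U)
    (hloc : ∀ x, ∃ r > 0, ∀ z ∈ U ∩ Metric.ball x r,
      Convex ℝ (connectedComponentIn (U ∩ Metric.ball x r) z))
    {a b c : Plane} (hab : segment ℝ a b ⊆ U) (hbc : segment ℝ b c ⊆ U) : segment ℝ a c ⊆ U := by
  obtain ⟨γ, hγ⟩ : ∃ γ : ℝ → ℝ → Plane,
    γ = fun s τ => b + s • ((1 - τ) • (a - b) + τ • (c - b)) := ⟨_, rfl⟩
  have hγc : Continuous fun q : ℝ × ℝ => γ q.1 q.2 := by rw [hγ]; fun_prop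
  suffices H : ∀ s ∈ Icc (0 : ℝ) 1, ∀ τ ∈ Icc (0 : ℝ) 1, γ s τ ∈ U by
    intro x hx
    obtain ⟨θ, h0, h1, rfl⟩ := mem_segment_iff_smul.1 hx
    convert H 1 ⟨zero_le_one, le_rfl⟩ θ ⟨h0, h1⟩ using 1
    simp only [hγ]; module
  have hleft : ∀ s ∈ Icc (0 : ℝ) 1, γ s 0 ∈ U := fun s hs => hab <| by
    rw [segment_symm]
    refine mem_segment_iff_smul.2 ⟨s, hs.1, hs.2, ?_⟩
    simp only [hγ]; module
  have hright : ∀ s ∈ Icc (0 : ℝ) 1, γ s 1 ∈ U := fun s hs => hbc <| by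
    refine mem_segment_iff_smul.2 ⟨s, hs.1, hs.2, ?_⟩
    simp only [hγ]; module
  by_contra hcon
  push Not at hcon
  obtain ⟨s₀, hs₀, τ₀, hτ₀, hbad₀⟩ := hcon
  have hK : IsCompact (Icc (0 : ℝ) 1 ×ˢ Icc (0 : ℝ) 1 ∩ (fun q : ℝ × ℝ => γ q.1 q.2) ⁻¹' Uᶜ) :=
    (isCompact_Icc.prod isCompact_Icc).inter_right (hU.isClosed_compl.preimage hγc)
  obtain ⟨⟨s, τ₁⟩, ⟨⟨hs, hτ₁⟩, hbad₁⟩, hmin⟩ :=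
    hK.exists_isMinOn ⟨(s₀, τ₀), ⟨hs₀, hτ₀⟩, hbad₀⟩ continuous_fst.continuousOn
  have hbelow : ∀ s' ∈ Icc (0 : ℝ) 1, s' < s → ∀ τ ∈ Icc (0 : ℝ) 1, γ s' τ ∈ U := by
    intro s' hs' hlt τ hτ
    by_contra hn
    exact absurd (hmin (a := (s', τ)) ⟨⟨hs', hτ⟩, hn⟩) (not_le.2 hlt)
  have hγs : Continuous (γ s) := hγc.comp (Continuous.prodMk_right s)
  have hK' : IsCompact (Icc (0 : ℝ) 1 ∩ γ s ⁻¹' Uᶜ) :=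
    isCompact_Icc.inter_right (hU.isClosed_compl.preimage hγs)
  obtain ⟨τ, ⟨hτ, hbad⟩, hminτ⟩ := hK'.exists_isMinOn ⟨τ₁, hτ₁, hbad₁⟩ continuous_id.continuousOn
  have hτbelow : ∀ τ' ∈ Icc (0 : ℝ) 1, τ' < τ → γ s τ' ∈ U := by
    intro τ' hτ' hlt
    by_contra hn
    exact absurd (hminτ (a := τ') ⟨hτ', hn⟩) (not_le.2 hlt)
  have hs0 : 0 < s := by
    refine lt_of_le_of_ne hs.1 ?_
    rintro rfl
    apply hbad
    have := hleft 0 hs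
    simpa [hγ] using this
  have hτ0 : 0 < τ := by
    refine lt_of_le_of_ne hτ.1 ?_
    rintro rfl
    exact hbad (hleft s hs)
  have hτ1 : τ < 1 := by
    refine lt_of_le_of_ne hτ.2 ?_
    rintro rfl
    exact hbad (hright s hs)
  obtain ⟨r, hr, hconv⟩ := hloc (γ s τ)
  obtain ⟨δ, hδ, hB⟩ := exists_box hγc s τ hr
  obtain ⟨η, hη0, hη⟩ : ∃ η > 0, η < δ ∧ η < τ ∧ η < 1 - τ ∧ η < s := by
    refine ⟨min (min δ τ) (min (1 - τ) s) / 2, ?_, ?_⟩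
    · have : 0 < 1 - τ := by linarith
      positivity
    · have h0 : 0 < min (min δ τ) (min (1 - τ) s) := by
        have : 0 < 1 - τ := by linarith
        positivity
      have h1 := min_le_left (min δ τ) (min (1 - τ) s)
      have h2 := min_le_right (min δ τ) (min (1 - τ) s)
      have h3 := min_le_left δ τ
      have h4 := min_le_right δ τ
      have h5 := min_le_left (1 - τ) s
      have h6 := min_le_right (1 - τ) s
      refine ⟨?_, ?_, ?_, ?_⟩ <;> linarith
  obtain ⟨hηδ, hητ, hη1, hηs⟩ := hη
  set V := U ∩ Metric.ball (γ s τ) r with hV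
  have hVo : IsOpen V := hU.inter Metric.isOpen_ball
  have hy : γ s (τ - η) ∈ V :=
    ⟨hτbelow _ ⟨by linarith, by linarith⟩ (by linarith), hB _ _ (by simpa using hδ) (by
      rw [show τ - η - τ = -η by ring, abs_neg, abs_of_pos hη0]; exact hηδ)⟩
  set Q := connectedComponentIn V (γ s (τ - η)) with hQ
  have hQconv : Convex ℝ Q := hconv _ hy
  have hQo : IsOpen Q := hVo.connectedComponentIn
  have hyQ : γ s (τ - η) ∈ Q := mem_connectedComponentIn hy
  have hnear : ∀ s', s - η < s' → s' < s → γ s' (τ + η) ∈ Q := by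
    intro s' h1 h2
    have hpre : IsPreconnected (segment ℝ (γ s (τ - η)) (γ s' (τ - η)) ∪
        segment ℝ (γ s' (τ - η)) (γ s' (τ + η))) :=
      IsPreconnected.union (γ s' (τ - η)) (right_mem_segment _ _ _) (left_mem_segment _ _ _)
        (convex_segment _ _).isPreconnected (convex_segment _ _).isPreconnected
    refine hpre.subset_connectedComponentIn (Or.inl (left_mem_segment _ _ _)) ?_
      (Or.inr (right_mem_segment _ _ _))
    rintro x (hx | hx)
    · obtain ⟨θ, t0, t1, rfl⟩ := mem_segment_iff_smul.1 hx
      have e : γ s (τ - η) + θ • (γ s' (τ - η) - γ s (τ - η)) = γ (s + θ * (s' - s)) (τ - η) := by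
        simp only [hγ]; module
      rw [e]
      rcases t0.eq_or_lt with rfl | t0
      · simpa using hy
      · have hlt : s + θ * (s' - s) < s := by nlinarith
        have hgt : s - η < s + θ * (s' - s) := by nlinarith
        refine ⟨hbelow _ ⟨by linarith, by linarith [hs.2]⟩ hlt _ ⟨by linarith, by linarith⟩,
          hB _ _ ?_ ?_⟩
        · rw [abs_lt]; constructor <;> linarith
        · rw [abs_lt]; constructor <;> linarith
    · obtain ⟨θ, t0, t1, rfl⟩ := mem_segment_iff_smul.1 hx
      have e : γ s' (τ - η) + θ • (γ s' (τ + η) - γ s' (τ - η)) = γ s' (τ - η + 2 * θ * η) := by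
        simp only [hγ]; module
      rw [e]
      have k1 : 0 ≤ θ * η := by positivity
      have k2 : θ * η ≤ η := by nlinarith
      refine ⟨hbelow _ ⟨by linarith, by linarith [hs.2]⟩ h2 _ ⟨by linarith, by linarith⟩,
          hB _ _ ?_ ?_⟩
      · rw [abs_lt]; constructor <;> linarith
      · rw [abs_lt]; constructor <;> linarith
  have hz : γ s (τ + η) ∈ closure Q := by
    have hlim : Tendsto (fun s' => γ s' (τ + η)) (𝓝[<] s) (𝓝 (γ s (τ + η))) := by
      have : Continuous fun s' => γ s' (τ + η) := hγc.comp (Continuous.prodMk_left (τ + η))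
      exact this.continuousAt.tendsto.mono_left nhdsWithin_le_nhds
    refine mem_closure_of_tendsto hlim ?_
    filter_upwards [Ioo_mem_nhdsLT (show s - η < s by linarith)] with s' hs'
    exact hnear s' hs'.1 hs'.2
  have hmem : γ s τ ∈ interior Q := by
    refine hQconv.openSegment_interior_closure_subset_interior
      (hQo.interior_eq.symm ▸ hyQ) hz ⟨1 / 2, 1 / 2, by norm_num, by norm_num, by norm_num, ?_⟩
    simp only [hγ]; module
  exact hbad (connectedComponentIn_subset _ _ (interior_subset hmem)).1

/-- The Tietze–Nakajima theorem for open connected sets. -/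
lemma convex_of_locally_convex {U : Set Plane} (hU : IsOpen U) (hc : IsPreconnected U)
    (hloc : ∀ x, ∃ r > 0, ∀ z ∈ U ∩ Metric.ball x r,
      Convex ℝ (connectedComponentIn (U ∩ Metric.ball x r) z)) : Convex ℝ U := by
  rw [convex_iff_segment_subset]
  intro a ha b hb
  have step : ∀ x y ε, Metric.ball x ε ⊆ U → y ∈ Metric.ball x ε → segment ℝ y x ⊆ U :=
    fun x y ε hε hy => ((convex_ball x ε).segment_subset hy
      (Metric.mem_ball_self (Metric.pos_of_mem_ball hy))).trans hε
  -- The points visible from `a` form an open set, closed relative to `U`, because a short segment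
  -- may be appended to a long one.
  suffices H : U ⊆ {x | segment ℝ a x ⊆ U} from H hb
  refine hc.subset_of_closure_inter_subset (u := {x | segment ℝ a x ⊆ U}) ?_ ⟨a, ha, by simpa⟩ ?_
  · rw [Metric.isOpen_iff]
    intro x hx
    obtain ⟨ε, hε, hball⟩ := Metric.isOpen_iff.1 hU x (hx (right_mem_segment _ _ _))
    refine ⟨ε, hε, fun y hy => segment_subset_of_locally_convex hU hloc hx ?_⟩
    rw [segment_symm]
    exact step x y ε hball hy
  · rintro x ⟨hx, hxU⟩
    obtain ⟨ε, hε, hball⟩ := Metric.isOpen_iff.1 hU x hxU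
    obtain ⟨y, hy, hyx⟩ := Metric.mem_closure_iff.1 hx ε hε
    exact segment_subset_of_locally_convex hU hloc hy
      (step x y ε hball (by rwa [Metric.mem_ball, dist_comm]))

/-! ### Sectors -/

/-- `m` is a combination of all vectors of `D` with positive coefficients; this is what it entails
for linear functionals. -/
structure IsResultant (D : Finset Plane) (m : Plane) : Prop where
  nonneg : ∀ a, (∀ d ∈ D, 0 ≤ cr a d) → 0 ≤ cr a m
  pos : ∀ a, (∀ d ∈ D, 0 ≤ cr a d) → (∃ d ∈ D, 0 < cr a d) → 0 < cr a m

/-- The union of the rays from `x` in the directions of `D`. -/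
def rays (D : Finset Plane) (x : Plane) : Set Plane := {y | ∃ d ∈ D, ∃ s : ℝ, 0 ≤ s ∧ y = x + s • d}

/-- The minimised ratio is minus the cotangent of the angle from `z` to `d`, which increases on `(0,
π)`. The minimiser is therefore the first direction met when turning left from `z`. -/
lemma exists_first_left (D : Finset Plane) {z : Plane} (hL : ∃ d ∈ D, 0 < cr z d) :
    ∃ d ∈ D, 0 < cr z d ∧ ∀ d' ∈ D, 0 < cr z d' → 0 ≤ cr d d' := by
  classical
  obtain ⟨d₀, hd₀, hz₀⟩ := hL
  have hz : z ≠ 0 := by rintro rfl; simp at hz₀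
  obtain ⟨d, hd, hmin⟩ := Finset.exists_min_image {d ∈ D | 0 < cr z d}
    (fun d => cr (rot z) d / cr z d) ⟨d₀, Finset.mem_filter.2 ⟨hd₀, hz₀⟩⟩
  obtain ⟨hdD, hzd⟩ := Finset.mem_filter.1 hd
  refine ⟨d, hdD, hzd, fun d' hd' hzd' => ?_⟩
  have h1 := hmin d' (Finset.mem_filter.2 ⟨hd', hzd'⟩)
  rw [div_le_div_iff₀ hzd hzd'] at h1
  have h2 := cr_mul_cr z (rot z) d d'
  have h3 := cr_rot_pos hz
  have h4 := cr_anticomm d (rot z)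
  have : 0 ≤ cr z (rot z) * cr d d' := by rw [h2, h4]; linarith
  exact nonneg_of_mul_nonneg_right this h3

lemma exists_first_right (D : Finset Plane) {z : Plane} (hL : ∃ d ∈ D, cr z d < 0) :
    ∃ d ∈ D, cr z d < 0 ∧ ∀ d' ∈ D, cr z d' < 0 → 0 ≤ cr d' d := by
  classical
  obtain ⟨d₀, hd₀, hz₀⟩ := hL
  have hz : z ≠ 0 := by rintro rfl; simp at hz₀
  obtain ⟨d, hd, hmin⟩ := Finset.exists_min_image {d ∈ D | cr z d < 0}
    (fun d => cr (rot z) d / -cr z d) ⟨d₀, Finset.mem_filter.2 ⟨hd₀, hz₀⟩⟩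
  obtain ⟨hdD, hzd⟩ := Finset.mem_filter.1 hd
  refine ⟨d, hdD, hzd, fun d' hd' hzd' => ?_⟩
  have h1 := hmin d' (Finset.mem_filter.2 ⟨hd', hzd'⟩)
  rw [div_le_div_iff₀ (neg_pos.2 hzd) (neg_pos.2 hzd')] at h1
  have h2 := cr_mul_cr z (rot z) d' d
  have h3 := cr_rot_pos hz
  have h4 := cr_anticomm d' (rot z)
  have : 0 ≤ cr z (rot z) * cr d' d := by rw [h2, h4]; linarith
  exact nonneg_of_mul_nonneg_right this h3

/-- A sector of angle at most `π` between consecutive rays is a component of their complement. -/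
lemma convex_sector {D : Finset Plane} {x z p q : Plane} {r : ℝ} (hz : x + z ∈ Metric.ball x r)
    (hzD : x + z ∉ rays D x) (hp : p ∈ D) (hq : q ∈ D) (hzp : cr z p < 0) (hzq : 0 < cr z q)
    (hp' : ∀ d ∈ D, cr z d < 0 → 0 ≤ cr d p) (hq' : ∀ d ∈ D, 0 < cr z d → 0 ≤ cr q d)
    (hpq : 0 ≤ cr p q) :
    Convex ℝ (connectedComponentIn ((rays D x)ᶜ ∩ Metric.ball x r) (x + z)) := by
  have hz0 : z ≠ 0 := by rintro rfl; simp at hzp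
  set S := {y | 0 < cr p (y - x)} ∩ {y | 0 < cr (y - x) q} with hS
  have hSo : IsOpen S := by
    refine (isOpen_lt continuous_const ?_).inter (isOpen_lt continuous_const ?_) <;> fun_prop
  have hSconv : Convex ℝ S := by
    intro u hu v hv α β hα hβ hαβ
    have e : α • u + β • v - x = α • (u - x) + β • (v - x) := by
      have : α • u + β • v - x = α • (u - x) + β • (v - x) + (α + β - 1) • x := by module
      rw [this, hαβ]; simp
    have hpos : ∀ A B : ℝ, 0 < A → 0 < B → 0 < α * A + β * B := by
      intro A B hA hB
      rcases hα.eq_or_lt with rfl | h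
      · have : β = 1 := by linarith
        simpa [this] using hB
      · have := mul_pos h hA
        have := mul_nonneg hβ hB.le
        linarith
    refine ⟨?_, ?_⟩
    · change 0 < cr p _
      rw [e, cr_add_right, cr_smul_right, cr_smul_right]
      exact hpos _ _ hu.1 hv.1
    · change 0 < cr _ q
      rw [e, cr_add_left, cr_smul_left, cr_smul_left]
      exact hpos _ _ hu.2 hv.2
  have hzS : x + z ∈ S := by
    refine ⟨?_, ?_⟩
    · change 0 < cr p _
      rw [add_sub_cancel_left, cr_anticomm]; linarith
    · change 0 < cr _ q
      rwa [add_sub_cancel_left]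
  have hop : ∀ d ∈ D, cr z d = 0 → ∃ l : ℝ, l ≤ 0 ∧ d = l • z := by
    intro d hd h0
    obtain ⟨l, rfl⟩ := exists_smul_of_cr_eq_zero hz0 h0
    refine ⟨l, not_lt.1 fun hl => hzD ⟨_, hd, l⁻¹, by positivity, ?_⟩, rfl⟩
    rw [smul_smul, inv_mul_cancel₀ hl.ne', one_smul]
  have hSD : S ⊆ (rays D x)ᶜ := by
    rintro _ ⟨h1, h2⟩ ⟨d, hd, s, hs, rfl⟩
    replace h1 : 0 < cr p (x + s • d - x) := h1
    replace h2 : 0 < cr (x + s • d - x) q := h2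
    rw [add_sub_cancel_left, cr_smul_right] at h1
    rw [add_sub_cancel_left, cr_smul_left] at h2
    have hs' : 0 < s := hs.lt_of_ne (by rintro rfl; simp at h1)
    replace h1 := pos_of_mul_pos_right h1 hs
    replace h2 := pos_of_mul_pos_right h2 hs
    rcases lt_trichotomy (cr z d) 0 with h | h | h
    · have := hp' d hd h
      rw [cr_anticomm] at this
      linarith
    · obtain ⟨l, hl, rfl⟩ := hop d hd h
      rw [cr_smul_left] at h2
      nlinarith
    · have := hq' d hd h
      rw [cr_anticomm] at this
      linarith
  have hcomp : connectedComponentIn ((rays D x)ᶜ ∩ Metric.ball x r) (x + z) =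
      S ∩ Metric.ball x r := by
    refine Subset.antisymm (subset_inter ?_ ((connectedComponentIn_subset _ _).trans
      inter_subset_right)) ?_
    · refine isPreconnected_connectedComponentIn.subset_of_closure_inter_subset hSo
        ⟨_, mem_connectedComponentIn ⟨hzD, hz⟩, hzS⟩ ?_
      rintro y ⟨hy, hyc⟩
      have hyD := (connectedComponentIn_subset _ _ hyc).1
      have h1 : 0 ≤ cr p (y - x) := by
        have : closure S ⊆ {y | 0 ≤ cr p (y - x)} := closure_minimal (fun y hy =>
          (show 0 < cr p (y - x) from hy.1).le)
          (isClosed_le continuous_const (by fun_prop))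
        exact this hy
      have h2 : 0 ≤ cr (y - x) q := by
        have : closure S ⊆ {y | 0 ≤ cr (y - x) q} := closure_minimal (fun y hy =>
          (show 0 < cr (y - x) q from hy.2).le)
          (isClosed_le continuous_const (by fun_prop))
        exact this hy
      have hp0 : p ≠ 0 := by rintro rfl; simp at hzp
      have hq0 : q ≠ 0 := by rintro rfl; simp at hzq
      -- For a sector of angle exactly `π` the boundary line of `S` consists of the two opposite
      -- rays along `p` and `q`. For smaller angles the far half of either line violates the other
      -- inequality.
      have hpq0 : cr p q = 0 → ∃ μ : ℝ, μ < 0 ∧ q = μ • p := by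
        intro h0
        obtain ⟨μ, rfl⟩ := exists_smul_of_cr_eq_zero hp0 h0
        rw [cr_smul_right] at hzq
        exact ⟨μ, by nlinarith, rfl⟩
      refine ⟨lt_of_le_of_ne h1 fun h0 => ?_, lt_of_le_of_ne h2 fun h0 => ?_⟩
      · obtain ⟨s, hs⟩ := exists_smul_of_cr_eq_zero hp0 h0.symm
        rcases le_or_gt 0 s with hs0 | hs0
        · exact hyD ⟨p, hp, s, hs0, by rw [← hs]; simp⟩
        · rw [hs, cr_smul_left] at h2
          obtain ⟨μ, hμ, rfl⟩ := hpq0 (le_antisymm (by nlinarith) hpq)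
          refine hyD ⟨_, hq, s / μ, by rw [div_nonneg_iff]; right; exact ⟨hs0.le, hμ.le⟩, ?_⟩
          rw [smul_smul, div_mul_cancel₀ _ hμ.ne, ← hs]; simp
      · obtain ⟨s, hs⟩ := exists_smul_of_cr_eq_zero hq0 (by rw [cr_anticomm, ← h0, neg_zero])
        rcases le_or_gt 0 s with hs0 | hs0
        · exact hyD ⟨q, hq, s, hs0, by rw [← hs]; simp⟩
        · rw [hs, cr_smul_right] at h1
          obtain ⟨μ, hμ, rfl⟩ := hpq0 (le_antisymm (by nlinarith) hpq)
          refine hyD ⟨_, hp, s * μ, by nlinarith, ?_⟩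
          rw [← smul_smul, ← hs]; simp
    · exact ((hSconv.inter (convex_ball _ _)).isPreconnected).subset_connectedComponentIn
        ⟨hzS, hz⟩ (inter_subset_inter_left _ hSD)
  rw [hcomp]
  exact hSconv.inter (convex_ball _ _)

/-- Either the sector of `x + z` between rays from `x` is convex, or all the rays lie on one side of
a line through `x` with `x + z` strictly on the other side. -/
lemma convex_or_exists_functional {D : Finset Plane} (hD : D.Nonempty) {x z : Plane} {r : ℝ}
    (hz : x + z ∈ Metric.ball x r) (hzD : x + z ∉ rays D x) (hD0 : ∀ d ∈ D, d ≠ 0) :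
    Convex ℝ (connectedComponentIn ((rays D x)ᶜ ∩ Metric.ball x r) (x + z)) ∨
      ∃ a, (∀ d ∈ D, 0 ≤ cr a d) ∧ (∃ d ∈ D, 0 < cr a d) ∧ cr a z < 0 := by
  have hz0 : z ≠ 0 := by
    rintro rfl
    obtain ⟨d, hd⟩ := hD
    exact hzD ⟨d, hd, 0, le_rfl, by simp⟩
  have hop : ∀ d ∈ D, cr z d = 0 → ∃ l : ℝ, l < 0 ∧ d = l • z := by
    intro d hd h0
    obtain ⟨l, rfl⟩ := exists_smul_of_cr_eq_zero hz0 h0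
    have hl0 : l ≠ 0 := by rintro rfl; exact hD0 _ hd (zero_smul _ _)
    refine ⟨l, lt_of_le_of_ne (not_lt.1 fun hl => hzD ⟨_, hd, l⁻¹, by positivity, ?_⟩) hl0, rfl⟩
    rw [smul_smul, inv_mul_cancel₀ hl.ne', one_smul]
  have hrz := cr_rot_pos hz0
  by_cases hL : ∃ d ∈ D, 0 < cr z d
  · obtain ⟨q, hq, hzq, hq'⟩ := exists_first_left D hL
    have hqz : cr q z < 0 := by rw [cr_anticomm]; linarith
    have hqop : ∀ d ∈ D, cr z d = 0 → 0 < cr q d := by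
      intro d hd h0
      obtain ⟨l, hl, rfl⟩ := hop d hd h0
      rw [cr_smul_right]; nlinarith
    by_cases hR : ∃ d ∈ D, cr z d < 0
    · obtain ⟨p, hp, hzp, hp'⟩ := exists_first_right D hR
      rcases le_or_gt 0 (cr p q) with hpq | hpq
      · exact Or.inl (convex_sector hz hzD hp hq hzp hzq hp' hq' hpq)
      -- The sector has an angle greater than `π`, and its left bounding direction `q` itself gives
      -- the functional.
      · right
        have hqp : 0 < cr q p := by rw [cr_anticomm]; linarith
        refine ⟨q, fun d hd => ?_, ⟨p, hp, hqp⟩, hqz⟩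
        rcases lt_trichotomy (cr z d) 0 with h | h | h
        · have h1 := cr_mul_cr q p z d
          have h2 := hp' d hd h
          have h3 := cr_anticomm p d
          have h4 : cr q p * cr z d < 0 := mul_neg_of_pos_of_neg hqp h
          have h5 : 0 ≤ cr q z * cr p d := mul_nonneg_of_nonpos_of_nonpos hqz.le (by linarith)
          by_contra hcon
          have h6 : 0 < cr z p * cr q d := mul_pos_of_neg_of_neg hzp (not_le.1 hcon)
          linarith
        · exact (hqop d hd h).le
        · exact hq' d hd h
    · push Not at hR
      right
      -- With nothing to the right of `z`, the functional of `q` alone may vanish on all of `D`.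
      -- Adding `z` makes it positive at `q` and keeps it negative at `z`.
      refine ⟨q + z, fun d hd => ?_, ⟨q, hq, ?_⟩, ?_⟩
      · rw [cr_add_left]
        have h1 := hR d hd
        rcases h1.eq_or_lt with h | h
        · have := hqop d hd h.symm
          linarith
        · have := hq' d hd h
          linarith
      · rw [cr_add_left, cr_self]; linarith
      · rw [cr_add_left, cr_self]; linarith
  · push Not at hL
    right
    by_cases hR : ∃ d ∈ D, cr z d < 0
    · obtain ⟨p, hp, hzp, hp'⟩ := exists_first_right D hR
      refine ⟨-(p + z), fun d hd => ?_, ⟨p, hp, ?_⟩, ?_⟩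
      · rw [cr_neg_left, cr_add_left]
        have h1 := hL d hd
        rcases h1.eq_or_lt with h | h
        · obtain ⟨l, hl, rfl⟩ := hop d hd h
          have h3 := cr_anticomm p z
          rw [cr_smul_right, cr_smul_right, cr_self, h3]
          nlinarith
        · have := hp' d hd h
          have h3 := cr_anticomm p d
          linarith
      · rw [cr_neg_left, cr_add_left, cr_self]; linarith
      · have h3 := cr_anticomm p z
        rw [cr_neg_left, cr_add_left, cr_self]; linarith
    · push Not at hR
      have hrz' : cr (rot z) z < 0 := by rw [cr_anticomm]; linarith
      have hall : ∀ d ∈ D, 0 < cr (rot z) d := by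
        intro d hd
        obtain ⟨l, hl, rfl⟩ := hop d hd (le_antisymm (hL d hd) (hR d hd))
        rw [cr_smul_right]; nlinarith
      obtain ⟨d, hd⟩ := hD
      exact ⟨rot z, fun d hd => (hall d hd).le, ⟨d, hd, hall d hd⟩, hrz'⟩

/-! ### The union of the wires and the faces of a net -/

/-- The union of the wires in `E`. -/
def tr (E : Finset (Sym2 Plane)) : Set Plane := {x | ∃ e ∈ E, x ∈ seg e}

lemma isClosed_tr (E : Finset (Sym2 Plane)) : IsClosed (tr E) := by
  have : tr E = ⋃ e ∈ E, seg e := by ext x; simp [tr]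
  rw [this]
  exact E.finite_toSet.isClosed_biUnion fun e _ => (isCompact_seg e).isClosed

/-- A face: a connected component of the complement of the wires. -/
def IsFace (E : Finset (Sym2 Plane)) (U : Set Plane) : Prop :=
  ∃ x ∉ tr E, U = connectedComponentIn (tr E)ᶜ x

namespace IsFace

variable {E : Finset (Sym2 Plane)} {U U' : Set Plane}

lemma isOpen (h : IsFace E U) : IsOpen U := by
  obtain ⟨x, -, rfl⟩ := h
  exact (isClosed_tr E).isOpen_compl.connectedComponentIn

lemma isPreconnected (h : IsFace E U) : IsPreconnected U := by
  obtain ⟨x, -, rfl⟩ := h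
  exact isPreconnected_connectedComponentIn

lemma nonempty (h : IsFace E U) : U.Nonempty := by
  obtain ⟨x, hx, rfl⟩ := h
  exact ⟨x, mem_connectedComponentIn hx⟩

lemma notMem_tr (h : IsFace E U) {x : Plane} (hx : x ∈ U) : x ∉ tr E := by
  obtain ⟨y, -, rfl⟩ := h
  exact connectedComponentIn_subset _ _ hx

lemma subset_of_isPreconnected (h : IsFace E U) {S : Set Plane} (hS : IsPreconnected S)
    (hSt : ∀ x ∈ S, x ∉ tr E) {y : Plane} (hyS : y ∈ S) (hyU : y ∈ U) : S ⊆ U := by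
  obtain ⟨x, -, rfl⟩ := h
  rw [connectedComponentIn_eq hyU]
  exact hS.subset_connectedComponentIn hyS hSt

lemma eq_of_mem (h : IsFace E U) (h' : IsFace E U') {y : Plane} (hy : y ∈ U) (hy' : y ∈ U') :
    U = U' :=
  Subset.antisymm (h'.subset_of_isPreconnected h.isPreconnected (fun _ => h.notMem_tr) hy hy')
    (h.subset_of_isPreconnected h'.isPreconnected (fun _ => h'.notMem_tr) hy' hy)

lemma mem_tr_of_mem_closure (h : IsFace E U) {y : Plane} (hy : y ∈ closure U) (hyU : y ∉ U) :
    y ∈ tr E := by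
  by_contra hn
  obtain ⟨ε, hε, hball⟩ := Metric.isOpen_iff.1 (isClosed_tr E).isOpen_compl y hn
  obtain ⟨z, hz, hzy⟩ := Metric.mem_closure_iff.1 hy ε hε
  exact hyU (h.subset_of_isPreconnected (convex_ball y ε).isPreconnected hball
    (by rwa [Metric.mem_ball, dist_comm]) hz (Metric.mem_ball_self hε))

/-- A connected subset of the complement of the wires that meets the face stays in it. Locally the
components of the face may thus be computed from the wires alone. -/
lemma connectedComponentIn_inter (h : IsFace E U) {B : Set Plane} {z : Plane} (hz : z ∈ U ∩ B) :
    connectedComponentIn (U ∩ B) z = connectedComponentIn ((tr E)ᶜ ∩ B) z := by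
  refine Subset.antisymm (connectedComponentIn_mono _ (inter_subset_inter_left _
    fun x hx => h.notMem_tr hx)) ?_
  have hsub := connectedComponentIn_subset ((tr E)ᶜ ∩ B) z
  have hz' : z ∈ (tr E)ᶜ ∩ B := ⟨h.notMem_tr hz.1, hz.2⟩
  refine isPreconnected_connectedComponentIn.subset_connectedComponentIn
    (mem_connectedComponentIn hz') (subset_inter ?_ fun x hx => (hsub hx).2)
  exact h.subset_of_isPreconnected isPreconnected_connectedComponentIn (fun x hx => (hsub hx).1)
    (mem_connectedComponentIn hz') hz.1

end IsFace

/-! ### The wires near a point -/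

lemma cr_sum_right {ι : Type*} (s : Finset ι) (a : Plane) (f : ι → Plane) :
    cr a (∑ i ∈ s, f i) = ∑ i ∈ s, cr a (f i) := by
  classical
  induction s using Finset.induction_on with
  | empty => simp
  | insert i s hi ih => rw [Finset.sum_insert hi, Finset.sum_insert hi, cr_add_right, ih]

lemma eventually_mem_segment_iff {x q : Plane} (hq : q ≠ x) :
    ∀ᶠ y in 𝓝 x, y ∈ segment ℝ x q ↔ ∃ s : ℝ, 0 ≤ s ∧ y = x + s • udir (q - x) := by
  have h0 : 0 < ‖q - x‖ := norm_pos_iff.2 (sub_ne_zero.2 hq)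
  filter_upwards [Metric.ball_mem_nhds x h0] with y hy
  constructor
  · intro h
    obtain ⟨θ, t0, -, rfl⟩ := mem_segment_iff_smul.1 h
    refine ⟨θ * ‖q - x‖, by positivity, ?_⟩
    rw [mul_smul, norm_smul_udir]
  · rintro ⟨s, hs, rfl⟩
    rw [Metric.mem_ball, dist_eq_norm, add_sub_cancel_left, norm_smul, udir, norm_smul, norm_inv,
      norm_norm, inv_mul_cancel₀ h0.ne', mul_one, Real.norm_of_nonneg hs] at hy
    refine mem_segment_iff_smul.2 ⟨s * ‖q - x‖⁻¹, by positivity, ?_, ?_⟩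
    · rw [← div_eq_mul_inv, div_le_one h0]; exact hy.le
    · rw [mul_smul]; rfl

/-- At a node every wire through `x` ends there, so near `x` the net is the union of the rays along
the unit pulls. The force is their combination with the positive tensions as coefficients. -/
lemma exists_rays_of_mem {E : Finset (Sym2 Plane)} (hE : NonCrossing E) {x : Plane}
    {t : Sym2 Plane →₀ ℝ} (hsupp : t.support = E) (hpos : ∀ e ∈ E, 0 < t e) {e₀ : Sym2 Plane}
    (he₀ : e₀ ∈ E) (hx : x ∈ e₀) :
    ∃ D : Finset Plane, D.Nonempty ∧ (∀ d ∈ D, d ≠ 0) ∧ IsResultant D (force x t) ∧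
      ∀ᶠ y in 𝓝 x, y ∈ tr E ↔ y ∈ rays D x := by
  classical
  have hpull : ∀ e ∈ E, x ∈ e → ∃ q, q ≠ x ∧ e = s(x, q) ∧ pull x e = udir (q - x) := by
    intro e he hxe
    obtain ⟨q, rfl⟩ := hxe
    have hq : x ≠ q := fun h => hE.not_isDiag _ he (by rw [Sym2.mk_isDiag_iff]; exact h)
    exact ⟨q, hq.symm, rfl, pull_left hq⟩
  have hforce : ∀ a, cr a (force x t) = ∑ e ∈ E, t e * cr a (pull x e) := by
    intro a
    rw [force_apply, hsupp, cr_sum_right]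
    exact Finset.sum_congr rfl fun e _ => cr_smul_right _ _ _
  have hmem : ∀ e ∈ E, x ∈ e → pull x e ∈ ({e ∈ E | x ∈ e} : Finset _).image (pull x) :=
    fun e he hxe => Finset.mem_image_of_mem _ (Finset.mem_filter.2 ⟨he, hxe⟩)
  have hterm : ∀ a, (∀ d ∈ ({e ∈ E | x ∈ e} : Finset _).image (pull x), 0 ≤ cr a d) →
      ∀ e ∈ E, 0 ≤ t e * cr a (pull x e) := by
    intro a ha e he
    by_cases hxe : x ∈ e
    · exact mul_nonneg (hpos e he).le (ha _ (hmem e he hxe))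
    · rw [pull_of_notMem hxe]; simp
  refine ⟨({e ∈ E | x ∈ e} : Finset _).image (pull x), ⟨_, hmem e₀ he₀ hx⟩, ?_, ⟨?_, ?_⟩, ?_⟩
  · intro d hd
    obtain ⟨e, he, rfl⟩ := Finset.mem_image.1 hd
    obtain ⟨he, hxe⟩ := Finset.mem_filter.1 he
    obtain ⟨q, hq, -, h⟩ := hpull e he hxe
    rw [h]
    exact udir_ne_zero (sub_ne_zero.2 hq)
  · intro a ha
    rw [hforce]
    exact Finset.sum_nonneg (hterm a ha)
  · rintro a ha ⟨d, hd, hda⟩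
    obtain ⟨e, he, rfl⟩ := Finset.mem_image.1 hd
    obtain ⟨he, hxe⟩ := Finset.mem_filter.1 he
    rw [hforce]
    exact Finset.sum_pos' (hterm a ha) ⟨e, he, mul_pos (hpos e he) hda⟩
  · have key : ∀ e ∈ E, ∀ᶠ y in 𝓝 x, y ∈ seg e ↔ x ∈ e ∧ ∃ s : ℝ, 0 ≤ s ∧ y = x + s • pull x e := by
      intro e he
      by_cases hxe : x ∈ e
      · obtain ⟨q, hq, rfl, h⟩ := hpull e he hxe
        rw [h, seg_mk]
        filter_upwards [eventually_mem_segment_iff hq] with y hy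
        rw [hy]
        exact (and_iff_right hxe).symm
      · have hxs : x ∉ seg e := fun h => hxe (hE.mem_of_node he he₀ hx h)
        filter_upwards [(isCompact_seg e).isClosed.isOpen_compl.mem_nhds hxs] with y hy
        exact iff_of_false hy fun h => hxe h.1
    filter_upwards [(Finset.eventually_all E).2 key] with y hy
    constructor
    · rintro ⟨e, he, hye⟩
      obtain ⟨hxe, s, hs, rfl⟩ := (hy e he).1 hye
      exact ⟨_, hmem e he hxe, s, hs, rfl⟩
    · rintro ⟨d, hd, s, hs, rfl⟩
      obtain ⟨e, he, rfl⟩ := Finset.mem_image.1 hd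
      obtain ⟨he, hxe⟩ := Finset.mem_filter.1 he
      exact ⟨e, he, (hy e he).2 ⟨hxe, s, hs, rfl⟩⟩

lemma exists_rays_of_notMem {E : Finset (Sym2 Plane)} (hE : NonCrossing E) {x : Plane}
    {e : Sym2 Plane} (he : e ∈ E) (hxe : x ∈ seg e) (hx : x ∉ e) :
    ∃ d : Plane, d ≠ 0 ∧ ∀ᶠ y in 𝓝 x, y ∈ tr E ↔ y ∈ rays {d, -d} x := by
  induction e with | _ p q => ?_
  rw [Sym2.mem_iff] at hx
  push Not at hx
  rw [seg_mk] at hxe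
  obtain ⟨θ, h0, h1, rfl⟩ := exists_param_of_mem_segment hxe hx.1 hx.2
  set x := p + θ • (q - p)
  set d := q - p with hd
  have hd0 : d ≠ 0 := sub_ne_zero.2 (by
    rintro rfl; exact hE.not_isDiag _ he (by rw [Sym2.mk_isDiag_iff]))
  have hp : p = x + (-θ) • d := by simp only [x]; module
  have hq : q = x + (1 - θ) • d := by simp only [x, hd]; module
  refine ⟨d, hd0, ?_⟩
  have hother : ∀ f ∈ E, ∀ᶠ y in 𝓝 x, y ∈ seg f → f = s(p, q) := by
    intro f hf
    by_cases hfe : f = s(p, q)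
    · exact Eventually.of_forall fun _ _ => hfe
    · have hxs : x ∉ seg f := by
        intro h
        have := hE.mem _ he f hf (Ne.symm hfe) x hxe h
        rw [Sym2.mem_iff] at this
        tauto
      filter_upwards [(isCompact_seg f).isClosed.isOpen_compl.mem_nhds hxs] with y hy h
      exact absurd h hy
  have hr : 0 < min θ (1 - θ) * ‖d‖ := by
    have := norm_pos_iff.2 hd0
    have : 0 < 1 - θ := by linarith
    positivity
  filter_upwards [(Finset.eventually_all E).2 hother, Metric.ball_mem_nhds x hr] with y hy hyr
  have hside : ∀ s : ℝ, y = x + s • d → y ∈ segment ℝ p q := by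
    rintro s rfl
    rw [Metric.mem_ball, dist_eq_norm, add_sub_cancel_left, norm_smul] at hyr
    have h2 := lt_of_mul_lt_mul_right hyr (norm_nonneg d)
    rw [Real.norm_eq_abs, lt_min_iff, abs_lt, abs_lt] at h2
    rw [hp, hq]
    exact mem_segment_line (by linarith) (by linarith)
  constructor
  · rintro ⟨f, hf, hyf⟩
    rw [hy f hf hyf, seg_mk] at hyf
    obtain ⟨s, -, -, hs⟩ := mem_segment_iff_smul.1 hyf
    rcases le_total 0 (s - θ) with h | h
    · exact ⟨d, by simp, s - θ, h, by rw [hs]; simp only [x]; module⟩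
    · exact ⟨-d, by simp, θ - s, by linarith, by rw [hs]; simp only [x]; module⟩
  · rintro ⟨d', hd', s, hs, hys⟩
    refine ⟨_, he, ?_⟩
    rw [seg_mk]
    rw [Finset.mem_insert, Finset.mem_singleton] at hd'
    rcases hd' with rfl | rfl
    · exact hside s hys
    · exact hside (-s) (by rw [hys]; module)

lemma isResultant_pair (d : Plane) : IsResultant {d, -d} 0 := by
  refine ⟨fun a _ => by simp, ?_⟩
  rintro a ha ⟨d', hd', h⟩
  have h1 := ha d (by simp)
  have h2 := ha (-d) (by simp)
  rw [cr_neg_right] at h2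
  rw [Finset.mem_insert, Finset.mem_singleton] at hd'
  rcases hd' with rfl | rfl
  · linarith
  · rw [cr_neg_right] at h; linarith

lemma IsNet.exists_rays {N : ℕ} {X F : Fin N → Plane} {t : Sym2 Plane →₀ ℝ} (ht : IsNet X F t)
    {x : Plane} (hx : x ∈ tr t.support) :
    ∃ D : Finset Plane, D.Nonempty ∧ (∀ d ∈ D, d ≠ 0) ∧ IsResultant D (force x t) ∧
      ∀ᶠ y in 𝓝 x, y ∈ tr t.support ↔ y ∈ rays D x := by
  by_cases hv : ∃ e ∈ t.support, x ∈ e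
  · obtain ⟨e, he, hxe⟩ := hv
    exact exists_rays_of_mem ht.nonCrossing rfl ht.pos he hxe
  · push Not at hv
    obtain ⟨e, he, hxe⟩ := hx
    obtain ⟨d, hd, h⟩ := exists_rays_of_notMem ht.nonCrossing he hxe (hv e he)
    refine ⟨{d, -d}, by simp, by simpa using hd, ?_, h⟩
    have : force x t = 0 := by
      rw [force_apply]
      exact Finset.sum_eq_zero fun e he => by rw [pull_of_notMem (hv e he), smul_zero]
    rw [this]
    exact isResultant_pair d

/-! ### All wires lie in the convex hull of the terminals -/

/-- If a wire had an end outside the hull, a functional `a` would separate it. Take the end `v` with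
the largest value of `a`, and among ties of `rot a`. No terminal is at `v`, so the pulls there
balance. As none points to higher values of `a`, all are level, and then none has a component along
the level line either. Hence all pulls at `v` vanish, which is absurd. -/
lemma IsNet.tr_subset {N : ℕ} {X F : Fin N → Plane} {t : Sym2 Plane →₀ ℝ} (ht : IsNet X F t) :
    tr t.support ⊆ convexHull ℝ (range X) := by
  classical
  have hcl : IsClosed (convexHull ℝ (range X)) := (finite_range X).isClosed_convexHull ℝ
  suffices H : ∀ e ∈ t.support, ∀ p ∈ e, p ∈ convexHull ℝ (range X) by
    rintro x ⟨e, he, hx⟩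
    induction e with | _ p q => ?_
    exact (convex_convexHull ℝ _).segment_subset (H _ he p (by simp)) (H _ he q (by simp)) hx
  intro e₀ he₀ p hp
  by_contra hcon
  obtain ⟨a, ha0, haX⟩ : ∃ a ≠ 0, ∀ i, cr a (X i) < cr a p := by
    obtain ⟨f, u, hfu, hup⟩ := geometric_hahn_banach_closed_point (convex_convexHull ℝ _) hcl hcon
    obtain ⟨a, ha⟩ := exists_cr_eq f
    have hX : ∀ i, cr a (X i) < cr a p := fun i => by
      rw [ha, ha]
      exact (hfu _ (subset_convexHull ℝ _ ⟨i, rfl⟩)).trans hup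
    -- The zero functional separates only when there are no terminals, and then any other one
    -- serves.
    by_cases ha0 : a = 0
    · refine ⟨EuclideanSpace.single 0 1, by simp, fun i => ?_⟩
      have := hX i
      simp [ha0] at this
    · exact ⟨a, ha0, hX⟩
  obtain ⟨v₀, hv₀, hmax⟩ := Finset.exists_max_image (t.support.biUnion Sym2.toFinset) (cr a)
    ⟨p, Finset.mem_biUnion.2 ⟨e₀, he₀, Sym2.mem_toFinset.2 hp⟩⟩
  obtain ⟨v, hv, hmax'⟩ := Finset.exists_max_image
    {w ∈ t.support.biUnion Sym2.toFinset | cr a w = cr a v₀} (cr (rot a))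
    ⟨v₀, Finset.mem_filter.2 ⟨hv₀, rfl⟩⟩
  obtain ⟨hv, hva⟩ := Finset.mem_filter.1 hv
  have hvp : cr a p ≤ cr a v := by
    rw [hva]
    exact hmax p (Finset.mem_biUnion.2 ⟨e₀, he₀, Sym2.mem_toFinset.2 hp⟩)
  have hnX : ∀ i, X i ≠ v := by
    rintro i rfl
    exact absurd (haX i) (not_lt.2 hvp)
  have hF := ht.balance v
  rw [Finset.filter_false_of_mem (fun i _ => hnX i), Finset.sum_empty, zero_add, force_apply] at hF
  have hpull : ∀ e ∈ t.support, v ∈ e → ∃ q ∈ t.support.biUnion Sym2.toFinset, q ≠ v ∧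
      pull v e = udir (q - v) := by
    intro e he hve
    obtain ⟨q, rfl⟩ := hve
    have hq : v ≠ q := fun h => ht.nonCrossing.not_isDiag _ he (by rw [Sym2.mk_isDiag_iff]; exact h)
    exact ⟨q, Finset.mem_biUnion.2 ⟨_, he, Sym2.mem_toFinset.2 (by simp)⟩, hq.symm, pull_left hq⟩
  have hcr : ∀ {q : Plane}, cr a (udir (q - v)) = ‖q - v‖⁻¹ * (cr a q - cr a v) := by
    intro q; rw [udir, cr_smul_right, cr_sub_right]
  have hcr' : ∀ {q : Plane}, cr (rot a) (udir (q - v)) =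
      ‖q - v‖⁻¹ * (cr (rot a) q - cr (rot a) v) := by
    intro q; rw [udir, cr_smul_right, cr_sub_right]
  have key : ∀ b, (∀ e ∈ t.support, v ∈ e → cr b (pull v e) ≤ 0) →
      ∀ e ∈ t.support, v ∈ e → cr b (pull v e) = 0 := by
    intro b hb e he hve
    have h1 : ∑ e ∈ t.support, t e * cr b (pull v e) = 0 := by
      have := congrArg (cr b) hF
      rw [cr_sum_right, cr_zero_right] at this
      rw [← this]
      exact Finset.sum_congr rfl fun e _ => (cr_smul_right _ _ _).symm
    rw [Finset.sum_eq_zero_iff_of_nonpos] at h1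
    · exact (mul_eq_zero.1 (h1 e he)).resolve_left (ht.pos e he).ne'
    · intro e he
      by_cases hve : v ∈ e
      · exact mul_nonpos_of_nonneg_of_nonpos (ht.pos e he).le (hb e he hve)
      · rw [pull_of_notMem hve]; simp
  have h1 := key a fun e he hve => by
    obtain ⟨q, hqV, hq, h⟩ := hpull e he hve
    rw [h, hcr]
    refine mul_nonpos_of_nonneg_of_nonpos (by positivity) ?_
    have := hmax q hqV
    linarith
  have h1' : ∀ e ∈ t.support, v ∈ e → ∀ q, q ≠ v → pull v e = udir (q - v) → cr a q = cr a v := by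
    intro e he hve q hq h
    have := h1 e he hve
    rw [h, hcr] at this
    have h0 := norm_pos_iff.2 (sub_ne_zero.2 hq)
    have := (mul_eq_zero.1 this).resolve_left (by positivity)
    linarith
  have h2 := key (rot a) fun e he hve => by
    obtain ⟨q, hqV, hq, h⟩ := hpull e he hve
    rw [h, hcr']
    refine mul_nonpos_of_nonneg_of_nonpos (by positivity) ?_
    have := hmax' q (Finset.mem_filter.2 ⟨hqV, (h1' e he hve q hq h).trans hva⟩)
    linarith
  obtain ⟨e, he, hve⟩ := Finset.mem_biUnion.1 hv
  rw [Sym2.mem_toFinset] at hve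
  obtain ⟨q, hqV, hq, h⟩ := hpull e he hve
  have h3 := h1 e he hve
  have h4 := h2 e he hve
  have h5 := cr_smul_eq a (rot a) (pull v e)
  rw [h3, cr_anticomm (pull v e), h4, neg_zero, zero_smul, zero_smul, add_zero] at h5
  rw [h] at h5
  exact udir_ne_zero (sub_ne_zero.2 hq) ((smul_eq_zero.1 h5).resolve_left (cr_rot_pos ha0).ne')

/-! ### Bounded faces -/

section Faces

variable {N : ℕ} {X F : Fin N → Plane} {t : Sym2 Plane →₀ ℝ} {U : Set Plane}

lemma exists_ne_zero_cr_nonneg (a : Plane) : ∃ w : Plane, w ≠ 0 ∧ 0 ≤ cr a w := by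
  by_cases ha : a = 0
  · exact ⟨EuclideanSpace.single 0 1, by simp, by simp [ha]⟩
  · refine ⟨rot a, fun h => ?_, (cr_rot_pos ha).le⟩
    have := cr_rot_pos ha
    rw [h] at this
    simp at this

lemma not_isBounded_of_ray {U : Set Plane} {x w : Plane} (hw : w ≠ 0)
    (h : ∀ s : ℝ, 0 ≤ s → x + s • w ∈ U) : ¬ Bornology.IsBounded U := by
  intro hb
  obtain ⟨R, hR⟩ := hb.subset_closedBall 0
  have h0 := norm_pos_iff.2 hw
  have h1 := hR (h ((|R| + ‖x‖ + 1) / ‖w‖) (by positivity))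
  rw [mem_closedBall_zero_iff] at h1
  have h2 := norm_sub_le (x + ((|R| + ‖x‖ + 1) / ‖w‖) • w) x
  rw [add_sub_cancel_left, norm_smul, Real.norm_of_nonneg (by positivity),
    div_mul_cancel₀ _ h0.ne'] at h2
  have := le_abs_self R
  linarith

/-- A point of the face outside the hull lies in an open half plane free of wires. The half plane is
then part of the face and contains a ray. -/
lemma IsFace.subset_convexHull (ht : IsNet X F t) (hU : IsFace t.support U)
    (hb : Bornology.IsBounded U) : U ⊆ convexHull ℝ (range X) := by
  intro x hx
  by_contra hcon
  obtain ⟨f, u, hfu, hup⟩ := geometric_hahn_banach_closed_point (convex_convexHull ℝ _)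
    ((finite_range X).isClosed_convexHull ℝ) hcon
  obtain ⟨a, ha⟩ := exists_cr_eq f
  obtain ⟨w, hw0, hw⟩ := exists_ne_zero_cr_nonneg a
  rw [← ha] at hup
  have hS : IsPreconnected {y | u < cr a y} := by
    refine Convex.isPreconnected fun y hy z hz α β hα hβ hαβ => ?_
    change u < cr a _
    have h1 : u < cr a y := hy
    have h2 : u < cr a z := hz
    rw [cr_add_right, cr_smul_right, cr_smul_right]
    obtain rfl : β = 1 - α := by linarith
    rcases hα.eq_or_lt with rfl | h
    · simpa using h2
    · nlinarith
  have hsub : {y | u < cr a y} ⊆ U := hU.subset_of_isPreconnected hS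
    (fun y hy hyt => by
      have h1 : u < cr a y := hy
      have := hfu y (ht.tr_subset hyt)
      rw [← ha] at this
      linarith) hup hx
  refine not_isBounded_of_ray hw0 (x := x) (fun s hs => hsub ?_) hb
  change u < cr a _
  rw [cr_add_right, cr_smul_right]
  have := mul_nonneg hs hw
  linarith

/-- The functional `a` separates the rays at `x` from a part of the face `U`. -/
lemma IsFace.ball_subset {D : Finset Plane} {x z a : Plane} {r : ℝ} {E : Finset (Sym2 Plane)}
    (hU : IsFace E U) (hr : ∀ y ∈ Metric.ball x r, y ∈ tr E ↔ y ∈ rays D x)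
    (haD : ∀ d ∈ D, 0 ≤ cr a d) (hz : x + z ∈ U) (hzr : x + z ∈ Metric.ball x r)
    (haz : cr a z < 0) {y : Plane} (hy : cr a (y - x) < 0) (hyr : y ∈ Metric.ball x r) : y ∈ U := by
  refine hU.subset_of_isPreconnected (convex_segment (x + z) y).isPreconnected ?_
    (left_mem_segment _ _ _) hz (right_mem_segment _ _ _)
  intro v hv hvt
  have hvr := (convex_ball x r).segment_subset hzr hyr hv
  obtain ⟨d, hd, s, hs, rfl⟩ := (hr v hvr).1 hvt
  obtain ⟨θ, h0, h1, h⟩ := mem_segment_iff_smul.1 hv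
  have e : s • d = (1 - θ) • z + θ • (y - x) := by
    have : s • d = x + s • d - x := by module
    rw [this, h]; module
  have h2 := congrArg (cr a) e
  rw [cr_add_right, cr_smul_right, cr_smul_right, cr_smul_right] at h2
  have h3 := mul_nonneg hs (haD d hd)
  have h4 : (1 - θ) * cr a z + θ * cr a (y - x) < 0 := by
    rcases h0.eq_or_lt with rfl | h0
    · linarith
    · have := mul_neg_of_pos_of_neg h0 hy
      have := mul_nonpos_of_nonneg_of_nonpos (sub_nonneg.2 h1) haz.le
      linarith
  linarith

/-- Near a point of the net the wires are rays with resultant `force x t`. If a sector of `U` is not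
convex, all rays lie in a closed half plane, not all on its boundary, and the opposite open half of
a small ball is in `U`. The resultant is then nonzero, so equilibrium needs a terminal at `x`, and
the ray against the resultant starts in `U`. Moreover `x` is the midpoint of a point of `U`,
interior to the hull, and a point of a wire. -/
lemma IsFace.convex_or_terminal (ht : IsNet X F t) (hU : IsFace t.support U)
    (hb : Bornology.IsBounded U) (x : Plane) :
    (∃ r > 0, ∀ z ∈ U ∩ Metric.ball x r,
      Convex ℝ (connectedComponentIn (U ∩ Metric.ball x r) z)) ∨
    (x ∈ range X ∩ interior (convexHull ℝ (range X)) ∧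
      ∀ᶠ ε in 𝓝[>] (0 : ℝ), x - ε • force x t ∈ U) := by
  by_cases hx : x ∈ tr t.support
  · obtain ⟨D, hD, hD0, hm, hev⟩ := ht.exists_rays hx
    obtain ⟨r, hr0, hr⟩ := Metric.mem_nhds_iff.1 hev
    by_cases hall : ∀ z ∈ U ∩ Metric.ball x r,
        Convex ℝ (connectedComponentIn (U ∩ Metric.ball x r) z)
    · exact Or.inl ⟨r, hr0, hall⟩
    right
    push Not at hall
    obtain ⟨y, ⟨hyU, hyr⟩, hconv⟩ := hall
    obtain ⟨z, rfl⟩ : ∃ z, y = x + z := ⟨y - x, by simp⟩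
    have hset : (tr t.support)ᶜ ∩ Metric.ball x r = (rays D x)ᶜ ∩ Metric.ball x r := by
      ext v
      constructor
      · rintro ⟨h1, h2⟩; exact ⟨fun h => h1 ((hr h2).2 h), h2⟩
      · rintro ⟨h1, h2⟩; exact ⟨fun h => h1 ((hr h2).1 h), h2⟩
    rw [hU.connectedComponentIn_inter ⟨hyU, hyr⟩, hset] at hconv
    have hyD : x + z ∉ rays D x := fun h => hU.notMem_tr hyU ((hr hyr).2 h)
    obtain ⟨a, haD, hapos, haz⟩ := (convex_or_exists_functional hD hyr hyD hD0).resolve_left hconv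
    have ham := hm.pos a haD hapos
    have hhalf : ∀ y, cr a (y - x) < 0 → y ∈ Metric.ball x r → y ∈ U := fun y h1 h2 =>
      hU.ball_subset (fun y hy => hr hy) haD hyU hyr haz h1 h2
    have hm0 : force x t ≠ 0 := by
      intro h
      rw [h, cr_zero_right] at ham
      exact lt_irrefl _ ham
    have hlim : ∀ v : Plane, ∀ᶠ ε in 𝓝[>] (0 : ℝ), x + ε • v ∈ Metric.ball x r := by
      intro v
      have : Tendsto (fun ε : ℝ => x + ε • v) (𝓝[>] 0) (𝓝 x) := by
        have : Continuous fun ε : ℝ => x + ε • v := by fun_prop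
        have h := this.tendsto 0
        rw [zero_smul, add_zero] at h
        exact h.mono_left nhdsWithin_le_nhds
      exact this.eventually (Metric.ball_mem_nhds x hr0)
    refine ⟨⟨?_, ?_⟩, ?_⟩
    · by_contra hX
      have := ht.balance x
      rw [Finset.filter_false_of_mem (fun i _ h => hX ⟨i, h⟩), Finset.sum_empty, zero_add] at this
      exact hm0 this
    · obtain ⟨d, hd, had⟩ := hapos
      obtain ⟨ε, ⟨h1, h2⟩, h0⟩ := (((hlim d).and (hlim (-d))).and self_mem_nhdsWithin).exists
      replace h0 : 0 < ε := h0
      have k1 : x + ε • -d ∈ U := hhalf _ (by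
        rw [add_sub_cancel_left, smul_neg, cr_neg_right, cr_smul_right]
        have := mul_pos h0 had
        linarith) h2
      have k2 : x + ε • d ∈ tr t.support := (hr h1).2 ⟨d, hd, ε, h0.le, rfl⟩
      refine (convex_convexHull ℝ (range X)).openSegment_interior_self_subset_interior
        (interior_maximal (hU.subset_convexHull ht hb) hU.isOpen k1) (ht.tr_subset k2)
        ⟨1 / 2, 1 / 2, by norm_num, by norm_num, by norm_num, ?_⟩
      module
    · filter_upwards [hlim (-force x t), self_mem_nhdsWithin] with ε h1 h0
      replace h0 : 0 < ε := h0
      rw [sub_eq_add_neg, ← smul_neg]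
      refine hhalf _ ?_ h1
      rw [add_sub_cancel_left, smul_neg, cr_neg_right, cr_smul_right]
      have := mul_pos h0 ham
      linarith
  · left
    obtain ⟨r, hr0, hr⟩ := Metric.isOpen_iff.1 (isClosed_tr t.support).isOpen_compl x hx
    refine ⟨r, hr0, fun z hz => ?_⟩
    have hball := (convex_ball x r).isPreconnected
    have : U ∩ Metric.ball x r = Metric.ball x r :=
      inter_eq_right.2 (hU.subset_of_isPreconnected hball hr hz.2 hz.1)
    rw [this, hball.connectedComponentIn hz.2]
    exact convex_ball x r

/-! ### Convex faces -/

/-- Any other point of the closure is either in the open set `U` or inside a wire. In the latter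
case a half ball beside the wire belongs to `U`, and the closure contains a piece of the wire around
the point. -/
lemma IsFace.extremePoint_mem {E : Finset (Sym2 Plane)} (hE : NonCrossing E) (hU : IsFace E U)
    {c : Plane} (hc : c ∈ (closure U).extremePoints ℝ) : ∃ e ∈ E, c ∈ e := by
  have hmid : ∀ v : Plane, v ≠ 0 → c + v ∈ closure U → c + -v ∉ closure U := by
    intro v hv h1 h2
    have := hc.2 h1 h2 ⟨1 / 2, 1 / 2, by norm_num, by norm_num, by norm_num, by module⟩
    exact hv (by simpa using this)
  have hcU : c ∉ U := by
    intro hcU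
    obtain ⟨r, hr0, hr⟩ := Metric.isOpen_iff.1 hU.isOpen c hcU
    have hmem : ∀ s : ℝ, |s| = r / 2 → c + s • (EuclideanSpace.single 0 1 : Plane) ∈ closure U := by
      intro s hs
      refine subset_closure (hr ?_)
      rw [Metric.mem_ball, dist_eq_norm, add_sub_cancel_left, norm_smul, Real.norm_eq_abs, hs]
      simp; linarith
    refine hmid ((r / 2) • EuclideanSpace.single 0 1) ?_ (hmem _ (abs_of_pos (by linarith))) ?_
    · simp [hr0.ne']
    · rw [← neg_smul]
      exact hmem _ (by rw [abs_neg, abs_of_pos (by linarith)])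
  obtain ⟨e, he, hce⟩ := hU.mem_tr_of_mem_closure hc.1 hcU
  by_contra hcon
  push Not at hcon
  obtain ⟨d, hd0, hev⟩ := exists_rays_of_notMem hE he hce (hcon e he)
  obtain ⟨r, hr0, hr⟩ := Metric.mem_nhds_iff.1 hev
  obtain ⟨y, hyU, hyr⟩ := Metric.mem_closure_iff.1 hc.1 r hr0
  rw [dist_comm] at hyr
  obtain ⟨z, rfl⟩ : ∃ z, y = c + z := ⟨y - c, by simp⟩
  have hdz : cr d z ≠ 0 := by
    intro h0
    obtain ⟨l, rfl⟩ := exists_smul_of_cr_eq_zero hd0 h0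
    refine hU.notMem_tr hyU ((hr hyr).2 ?_)
    rcases le_total 0 l with h | h
    · exact ⟨d, by simp, l, h, rfl⟩
    · exact ⟨-d, by simp, -l, by linarith, by module⟩
  obtain ⟨a, had, haz⟩ : ∃ a, cr a d = 0 ∧ cr a z < 0 := by
    rcases hdz.lt_or_gt with h | h
    · exact ⟨d, cr_self d, h⟩
    · exact ⟨-d, by simp [cr_neg_left], by rw [cr_neg_left]; linarith⟩
  have hhalf : ∀ y, cr a (y - c) < 0 → y ∈ Metric.ball c r → y ∈ U := fun y h1 h2 =>
    hU.ball_subset (fun y hy => hr hy) (by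
      intro d' hd'
      rw [Finset.mem_insert, Finset.mem_singleton] at hd'
      rcases hd' with rfl | rfl
      · exact had.ge
      · rw [cr_neg_right, had, neg_zero]) hyU hyr haz h1 h2
  have hcl : ∀ s : ℝ, |s| * ‖d‖ < r → c + s • d ∈ closure U := by
    intro s hs
    have hlim : Tendsto (fun ε : ℝ => c + s • d + ε • z) (𝓝[>] 0) (𝓝 (c + s • d)) := by
      have : Continuous fun ε : ℝ => c + s • d + ε • z := by fun_prop
      have h := this.tendsto 0
      rw [zero_smul, add_zero] at h
      exact h.mono_left nhdsWithin_le_nhds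
    refine mem_closure_of_tendsto hlim ?_
    have hmem : c + s • d ∈ Metric.ball c r := by
      rwa [Metric.mem_ball, dist_eq_norm, add_sub_cancel_left, norm_smul, Real.norm_eq_abs]
    filter_upwards [hlim.eventually (Metric.isOpen_ball.mem_nhds hmem), self_mem_nhdsWithin]
      with ε h1 h0
    replace h0 : 0 < ε := h0
    refine hhalf _ ?_ h1
    rw [add_assoc, add_sub_cancel_left, cr_add_right, cr_smul_right, cr_smul_right, had, mul_zero,
      zero_add]
    exact mul_neg_of_pos_of_neg h0 haz
  have hn := norm_pos_iff.2 hd0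
  have habs : |r / 2 / ‖d‖| * ‖d‖ < r := by
    rw [abs_of_pos (by positivity), div_mul_cancel₀ _ hn.ne']; linarith
  refine hmid ((r / 2 / ‖d‖) • d) (smul_ne_zero (by positivity) hd0) (hcl _ habs) ?_
  rw [← neg_smul]
  exact hcl _ (by rwa [abs_neg])

lemma cr_ne_zero_of_extremePoints {S : Set Plane} {c d e : Plane} (hc : c ∈ S.extremePoints ℝ)
    (hd : d ∈ S.extremePoints ℝ) (he : e ∈ S.extremePoints ℝ) (hcd : d ≠ c) (hce : e ≠ c)
    (hde : e ≠ d) : cr (d - c) (e - c) ≠ 0 := by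
  intro h0
  obtain ⟨s, hs⟩ := exists_smul_of_cr_eq_zero (sub_ne_zero.2 hcd) h0
  have he' : e = c + s • (d - c) := by rw [← hs]; simp
  have hs0 : s ≠ 0 := by rintro rfl; simp at he'; exact hce he'
  have hs1 : s ≠ 1 := by rintro rfl; simp at he'; exact hde he'
  rcases lt_or_gt_of_ne hs0 with h | h
  · refine hcd (hc.2 hd.1 he.1 ⟨-s / (1 - s), 1 / (1 - s), ?_, ?_, ?_, ?_⟩)
    · exact div_pos (by linarith) (by linarith)
    · exact div_pos (by linarith) (by linarith)
    · rw [← add_div]; exact (div_eq_one_iff_eq (by linarith)).2 (by ring)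
    · have h1 : 1 - s ≠ 0 := by linarith
      have k1 : -s / (1 - s) + 1 / (1 - s) * s = 0 := by ring
      have k2 : 1 / (1 - s) * (1 - s) = 1 := by field_simp
      calc (-s / (1 - s)) • d + (1 / (1 - s)) • e
          = (-s / (1 - s) + 1 / (1 - s) * s) • d + (1 / (1 - s) * (1 - s)) • c := by
            rw [he']; module
        _ = c := by rw [k1, k2]; simp
  · rcases lt_or_gt_of_ne hs1 with h1 | h1
    · exact hce.symm (he.2 hc.1 hd.1 ⟨1 - s, s, by linarith, h, by ring, by rw [he']; module⟩)
    · refine hcd.symm (hd.2 hc.1 he.1 ⟨1 - 1 / s, 1 / s, ?_, by positivity, by ring, ?_⟩)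
      · rw [sub_pos, div_lt_one h]; exact h1
      · rw [he', smul_add, smul_smul, div_mul_cancel₀ _ hs0]; module

/-- A finite set in convex position with nonempty interior of its hull is the set of corners of a
polygon. -/
lemma exists_isPolygon {C : Finset Plane} (hne : C.Nonempty)
    (hC : ∀ c ∈ C, c ∉ convexHull ℝ ((C : Set Plane) \ {c}))
    (hcol : ∀ c ∈ C, ∀ d ∈ C, ∀ e ∈ C, d ≠ c → e ≠ c → e ≠ d → cr (d - c) (e - c) ≠ 0)
    (hthree : ∀ c ∈ C, ∀ d ∈ C, ∃ e ∈ C, e ≠ c ∧ e ≠ d) : ∃ nx, IsPolygon C nx := by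
  classical
  -- Seen from `c` all other points lie in an open half plane, and the successor of `c` is the first
  -- of them in counterclockwise order.
  have hex : ∀ c ∈ C, ∃ d ∈ C, d ≠ c ∧ ∀ e ∈ C, e ≠ c → e ≠ d → 0 < cr (d - c) (e - c) := by
    intro c hc
    have hfin : ((C : Set Plane) \ {c}).Finite := C.finite_toSet.subset sdiff_subset
    obtain ⟨f, u, hfu, hup⟩ := geometric_hahn_banach_point_closed (convex_convexHull ℝ _)
      (hfin.isClosed_convexHull ℝ) (hC c hc)
    obtain ⟨a, ha⟩ := exists_cr_eq f
    have hapos : ∀ d ∈ C, d ≠ c → 0 < cr a (d - c) := by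
      intro d hd hdc
      have := hup d (subset_convexHull ℝ _ ⟨hd, hdc⟩)
      rw [cr_sub_right, ha, ha]; linarith
    obtain ⟨d₀, hd₀, hd₀c, -⟩ := hthree c hc c hc
    have ha0 : a ≠ 0 := by
      rintro rfl
      simpa using hapos d₀ hd₀ hd₀c
    obtain ⟨d, hd, hmin⟩ := Finset.exists_min_image (C.erase c)
      (fun d => cr (rot a) (d - c) / cr a (d - c)) ⟨d₀, Finset.mem_erase.2 ⟨hd₀c, hd₀⟩⟩
    obtain ⟨hdc, hd⟩ := Finset.mem_erase.1 hd
    refine ⟨d, hd, hdc, fun e he hec hed => ?_⟩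
    have h1 := hmin e (Finset.mem_erase.2 ⟨hec, he⟩)
    rw [div_le_div_iff₀ (hapos d hd hdc) (hapos e he hec)] at h1
    have h2 := cr_mul_cr a (rot a) (d - c) (e - c)
    have h3 := cr_rot_pos ha0
    have h4 := cr_anticomm (d - c) (rot a)
    have h5 : 0 ≤ cr a (rot a) * cr (d - c) (e - c) := by rw [h2, h4]; linarith
    exact lt_of_le_of_ne (nonneg_of_mul_nonneg_right h5 h3)
      (hcol c hc d hd e he hdc hec hed).symm
  choose! nx h1 h2 h3 using hex
  refine ⟨nx, hne, h1, h2, fun c hc h => ?_, fun c hc d hd hdc hd' => h3 c hc d hd hdc hd'⟩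
  obtain ⟨e, he, hec, hen⟩ := hthree c hc (nx c) (h1 c hc)
  have k1 := h3 c hc e he hec hen
  have k2 := h3 (nx c) (h1 c hc) e he hen (by rw [h]; exact hec)
  rw [h] at k2
  have : cr (c - nx c) (e - nx c) = -cr (nx c - c) (e - c) := by
    simp only [cr_sub_left, cr_sub_right, cr_self]
    rw [cr_anticomm c (nx c)]
    ring
  linarith

lemma lt_cr_of_isOpen {U : Set Plane} (hU : IsOpen U) {a x : Plane} {r : ℝ} (ha : a ≠ 0)
    (h : ∀ y ∈ U, r ≤ cr a y) (hx : x ∈ U) : r < cr a x := by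
  have hlim : Tendsto (fun ε : ℝ => x + ε • -rot a) (𝓝[>] 0) (𝓝 x) := by
    have : Continuous fun ε : ℝ => x + ε • -rot a := by fun_prop
    have h := this.tendsto 0
    rw [zero_smul, add_zero] at h
    exact h.mono_left nhdsWithin_le_nhds
  obtain ⟨ε, h1, h0⟩ := ((hlim.eventually (hU.mem_nhds hx)).and self_mem_nhdsWithin).exists
  replace h0 : 0 < ε := h0
  have h2 := h _ h1
  rw [cr_add_right, cr_smul_right, cr_neg_right] at h2
  have := mul_pos h0 (cr_rot_pos ha)
  linarith

/-- The extreme points of the closure are ends of wires, hence finite in number, and by Krein–Milman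
the closure is their hull. The sides are in the closure but not in `U`, so wires cover them. A
convex open set is the interior of its closure, so the interior of the polygon is `U`, without
wires. -/
lemma IsFace.exists_isCell {E : Finset (Sym2 Plane)} (hE : NonCrossing E) (hU : IsFace E U)
    (hb : Bornology.IsBounded U) (hconv : Convex ℝ U) : ∃ C nx, IsCell E C nx := by
  classical
  have hcpt : IsCompact (closure U) := hb.isCompact_closure
  have hfin : ((closure U).extremePoints ℝ).Finite := by
    refine (E.biUnion Sym2.toFinset).finite_toSet.subset fun c hc => ?_
    obtain ⟨e, he, hce⟩ := hU.extremePoint_mem hE hc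
    exact Finset.mem_biUnion.2 ⟨e, he, Sym2.mem_toFinset.2 hce⟩
  set C := hfin.toFinset with hCdef
  have hCmem : ∀ c, c ∈ C ↔ c ∈ (closure U).extremePoints ℝ := fun c => hfin.mem_toFinset
  have hhull : convexHull ℝ (C : Set Plane) = closure U := by
    have := closure_convexHull_extremePoints hcpt hconv.closure
    rw [(hfin.isClosed_convexHull ℝ).closure_eq] at this
    rwa [hCdef, hfin.coe_toFinset]
  have hle : ∀ {a : Plane} {r : ℝ}, (∀ c ∈ C, r ≤ cr a c) → ∀ y ∈ closure U, r ≤ cr a y :=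
    fun h y hy => IsPolygon.le_of_mem_convexHull (S := (C : Set Plane)) h (hhull ▸ hy)
  obtain ⟨x₀, hx₀⟩ := hU.nonempty
  have hne : C.Nonempty := by
    rw [← Finset.coe_nonempty, ← convexHull_nonempty_iff (𝕜 := ℝ), hhull]
    exact ⟨x₀, subset_closure hx₀⟩
  obtain ⟨nx, hnx⟩ := exists_isPolygon hne (fun c hc hcon => by
      have := (hconv.closure.mem_extremePoints_iff_mem_sdiff_convexHull_sdiff.1 ((hCmem c).1 hc)).2
      exact this (convexHull_mono (sdiff_subset_sdiff_left fun d hd =>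
        ((hCmem d).1 hd).1) hcon))
    (fun c hc d hd e he => cr_ne_zero_of_extremePoints ((hCmem c).1 hc) ((hCmem d).1 hd)
      ((hCmem e).1 he))
    -- With at most two extreme points the closure would lie on a line, but `U` is open and
    -- nonempty.
    (fun c hc d hd => by
      by_contra hcon
      push Not at hcon
      obtain ⟨a, ha0, ha⟩ : ∃ a : Plane, a ≠ 0 ∧ cr a d = cr a c := by
        by_cases hcd : d = c
        · exact ⟨EuclideanSpace.single 0 1, by simp, by rw [hcd]⟩
        · refine ⟨d - c, sub_ne_zero.2 hcd, ?_⟩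
          rw [← sub_eq_zero, ← cr_sub_right, cr_self]
      have hall : ∀ e ∈ C, cr a e = cr a c := by
        intro e he
        by_cases hec : e = c
        · rw [hec]
        · rw [hcon e he hec, ha]
      have h1 : ∀ y ∈ U, cr a c ≤ cr a y := fun y hy =>
        hle (fun e he => (hall e he).ge) y (subset_closure hy)
      have h2 : ∀ y ∈ U, -cr a c ≤ cr (-a) y := fun y hy =>
        hle (fun e he => by rw [cr_neg_left, hall e he]) y (subset_closure hy)
      have h3 := lt_cr_of_isOpen hU.isOpen ha0 h1 hx₀
      have h4 := h2 x₀ hx₀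
      rw [cr_neg_left] at h4
      linarith)
  refine ⟨C, nx, hnx, fun c hc x hx => ?_, fun e he x hx => ?_, fun c hc =>
    hU.extremePoint_mem hE ((hCmem c).1 hc)⟩
  · have hxcl : x ∈ closure U := by
      rw [← hhull]
      exact (convex_convexHull ℝ _).segment_subset (_root_.subset_convexHull ℝ _ hc)
        (_root_.subset_convexHull ℝ _ (hnx.maps c hc)) hx
    refine hU.mem_tr_of_mem_closure hxcl fun hxU => ?_
    have h1 := lt_cr_of_isOpen hU.isOpen (sub_ne_zero.2 (hnx.ne c hc)) (fun y hy =>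
      hle (r := cr (nx c - c) c) (fun d hd => by
        have := hnx.left_nonneg hc hd
        rw [cr_sub_right] at this
        linarith) y (subset_closure hy)) hxU
    obtain ⟨θ, -, -, rfl⟩ := mem_segment_iff_smul.1 hx
    rw [cr_add_right, cr_smul_right, cr_self] at h1
    linarith
  · by_contra hcon
    push Not at hcon
    have hopen : IsOpen {y | ∀ c ∈ C, 0 < cr (nx c - c) (y - c)} := by
      have : {y | ∀ c ∈ C, 0 < cr (nx c - c) (y - c)} =
          ⋂ c ∈ C, {y | 0 < cr (nx c - c) (y - c)} := by ext; simp
      rw [this]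
      exact isOpen_biInter_finset fun c _ => isOpen_lt continuous_const (by fun_prop)
    have hsub : {y | ∀ c ∈ C, 0 < cr (nx c - c) (y - c)} ⊆ closure U := fun y hy => by
      rw [← hhull]
      exact hnx.mem_convexHull fun c hc => (hy c hc).le
    have hint := interior_maximal hsub hopen hcon
    rw [hconv.interior_closure_eq_interior_of_nonempty_interior
      ⟨x₀, hU.isOpen.interior_eq.symm ▸ hx₀⟩, hU.isOpen.interior_eq] at hint
    exact hU.notMem_tr hint ⟨e, he, hx⟩

/-- In a net without convex cells every bounded face contains the start of the ray opposite to the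
force at some terminal in the interior of the convex hull. -/
lemma IsFace.exists_terminal (ht : IsNet X F t) (hcell : ∀ C nx, ¬ IsCell t.support C nx)
    (hU : IsFace t.support U) (hb : Bornology.IsBounded U) :
    ∃ x ∈ range X ∩ interior (convexHull ℝ (range X)),
      ∀ᶠ ε in 𝓝[>] (0 : ℝ), x - ε • force x t ∈ U := by
  by_contra hcon
  have hconv := convex_of_locally_convex hU.isOpen hU.isPreconnected fun x =>
    (hU.convex_or_terminal ht hb x).resolve_right fun h => hcon ⟨x, h⟩
  obtain ⟨C, nx, h⟩ := hU.exists_isCell ht.nonCrossing hb hconv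
  exact hcell C nx h

/-- The number of bounded faces is at most the number of terminals in the interior of the convex
hull of all terminals. -/
lemma encard_le_of_injOn_faces (ht : IsNet X F t) (hcell : ∀ C nx, ¬ IsCell t.support C nx)
    {α : Type*} (S : Set α) (g : α → Set Plane)
    (hg : ∀ a ∈ S, IsFace t.support (g a) ∧ Bornology.IsBounded (g a)) (hinj : S.InjOn g) :
    S.encard ≤ numInteriorTerminals X := by
  have hex : ∀ a ∈ S, ∃ x ∈ range X ∩ interior (convexHull ℝ (range X)),
      ∀ᶠ ε in 𝓝[>] (0 : ℝ), x - ε • force x t ∈ g a := fun a ha =>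
    (hg a ha).1.exists_terminal ht hcell (hg a ha).2
  choose! f hf hev using hex
  have hfin : (range X ∩ interior (convexHull ℝ (range X))).Finite :=
    (finite_range X).subset inter_subset_left
  rw [numInteriorTerminals, hfin.cast_ncard_eq]
  refine encard_le_encard_of_injOn hf fun a ha b hb hab => hinj ha hb ?_
  -- Faces with the same terminal contain initial pieces of the same ray, so they meet and are
  -- equal.
  have h1 := hev b hb
  rw [← hab] at h1
  obtain ⟨ε, h2, h3⟩ := ((hev a ha).and h1).exists
  exact (hg a ha).1.eq_of_mem (hg b hb).1 h2 h3

end Faces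

/-! ### Crossing parity -/

/-- All vertices of `S` have different heights with respect to `w`. -/
def GenericDir (w : Plane) (S : Finset (Sym2 Plane)) : Prop :=
  ∀ e ∈ S, ∀ f ∈ S, ∀ p ∈ e, ∀ q ∈ f, cr w p = cr w q → p = q

lemma GenericDir.mono {w : Plane} {S S' : Finset (Sym2 Plane)} (h : GenericDir w S) (hS : S' ⊆ S) :
    GenericDir w S' := fun e he f hf => h e (hS he) f (hS hf)

lemma exists_genericDir (S : Finset (Sym2 Plane)) : ∃ w : Plane, w ≠ 0 ∧ GenericDir w S := by
  classical
  set V := S.biUnion Sym2.toFinset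
  -- For `w = (1, s)` two points have equal height exactly when the line through them has slope `s`,
  -- so finitely many slopes are avoided. Points with the same first coordinate are separated by
  -- every `s`.
  obtain ⟨s, hs⟩ := Infinite.exists_notMem_finset
    ((V ×ˢ V).image fun q => (q.1 1 - q.2 1) / (q.1 0 - q.2 0))
  refine ⟨!₂[1, s], fun h => ?_, fun e he f hf p hp q hq hpq => ?_⟩
  · have := congrArg (fun v : Plane => v 0) h
    simp at this
  · have hpV : p ∈ V := Finset.mem_biUnion.2 ⟨e, he, Sym2.mem_toFinset.2 hp⟩
    have hqV : q ∈ V := Finset.mem_biUnion.2 ⟨f, hf, Sym2.mem_toFinset.2 hq⟩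
    have h1 : p 1 - q 1 = s * (p 0 - q 0) := by
      simp [cr] at hpq
      linarith
    by_cases h0 : p 0 - q 0 = 0
    · rw [h0, mul_zero] at h1
      exact plane_ext (sub_eq_zero.1 h0) (sub_eq_zero.1 h1)
    · refine absurd ?_ hs
      exact Finset.mem_image.2 ⟨(p, q), Finset.mem_product.2 ⟨hpV, hqV⟩, by
        change (p 1 - q 1) / (p 0 - q 0) = s
        rw [h1, mul_div_cancel_right₀ _ h0]⟩

/-- The half line from `x` in the direction `w` meets the wire `e`, not in its highest point. -/
def Below (w : Plane) (e : Sym2 Plane) (x : Plane) : Prop :=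
  ∃ p q, e = s(p, q) ∧ cr w p ≤ cr w x ∧ cr w x < cr w q ∧ 0 < cr (q - p) (x - p)

open Classical in
/-- The indicator of `Below`. -/
noncomputable def below (w : Plane) (e : Sym2 Plane) (x : Plane) : ZMod 2 :=
  if Below w e x then 1 else 0

/-- The parity of the number of wires in `S` above `x`. -/
noncomputable def parity (w : Plane) (S : Finset (Sym2 Plane)) (x : Plane) : ZMod 2 :=
  ∑ e ∈ S, below w e x

lemma below_iff {w p q x : Plane} (h : cr w p < cr w q) : Below w s(p, q) x ↔
    cr w p ≤ cr w x ∧ cr w x < cr w q ∧ 0 < cr (q - p) (x - p) := by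
  constructor
  · rintro ⟨p', q', he, h1, h2, h3⟩
    rcases Sym2.eq_iff.1 he with ⟨rfl, rfl⟩ | ⟨rfl, rfl⟩
    · exact ⟨h1, h2, h3⟩
    · linarith
  · rintro ⟨h1, h2, h3⟩
    exact ⟨p, q, rfl, h1, h2, h3⟩

lemma below_congr {w x y : Plane} {e : Sym2 Plane} (h : Below w e y ↔ Below w e x) :
    below w e y = below w e x := by
  by_cases hx : Below w e x
  · rw [below, below, if_pos (h.2 hx), if_pos hx]
  · rw [below, below, if_neg (fun hy => hx (h.1 hy)), if_neg hx]

lemma mem_segment_of_cr_eq_zero {w p q x : Plane} (h : cr w p < cr w q) (h1 : cr w p ≤ cr w x)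
    (h2 : cr w x ≤ cr w q) (h0 : cr (q - p) (x - p) = 0) : x ∈ segment ℝ p q := by
  have hpq : q - p ≠ 0 := by
    intro h'
    rw [sub_eq_zero.1 h'] at h
    exact lt_irrefl _ h
  obtain ⟨r, hr⟩ := exists_smul_of_cr_eq_zero hpq h0
  have h3 := congrArg (cr w) hr
  rw [cr_smul_right, cr_sub_right, cr_sub_right] at h3
  refine mem_segment_iff_smul.2 ⟨r, ?_, ?_, by rw [← hr]; simp⟩
  · by_contra hcon
    nlinarith
  · by_contra hcon
    nlinarith

lemma Below.exists_above {w x : Plane} {e : Sym2 Plane} (h : Below w e x) :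
    ∃ s : ℝ, 0 < s ∧ x + s • w ∈ seg e := by
  obtain ⟨p, q, rfl, h1, h2, h3⟩ := h
  have hpq : 0 < cr w q - cr w p := by linarith
  refine ⟨cr (q - p) (x - p) / (cr w q - cr w p), div_pos h3 hpq, ?_⟩
  rw [seg_mk]
  refine mem_segment_of_cr_eq_zero (w := w) (by linarith) ?_ ?_ ?_
  · rw [cr_add_right, cr_smul_right, cr_self]; linarith
  · rw [cr_add_right, cr_smul_right, cr_self]; linarith
  · have : cr (q - p) w = -(cr w q - cr w p) := by rw [cr_anticomm, cr_sub_right]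
    rw [add_sub_right_comm, cr_add_right, cr_smul_right, this]
    field_simp
    ring

lemma exists_ordered {w : Plane} {S : Finset (Sym2 Plane)} (hw : GenericDir w S)
    (hd : ∀ e ∈ S, ¬ e.IsDiag) {e : Sym2 Plane} (he : e ∈ S) :
    ∃ p q, e = s(p, q) ∧ cr w p < cr w q := by
  induction e with | _ p q => ?_
  have hne : cr w p ≠ cr w q := fun h => hd _ he (by
    rw [Sym2.mk_isDiag_iff]
    exact hw _ he _ he p (by simp) q (by simp) h)
  rcases hne.lt_or_gt with h | h
  · exact ⟨p, q, rfl, h⟩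
  · exact ⟨q, p, Sym2.eq_swap, h⟩

lemma eventually_lt_cr {a x : Plane} {r : ℝ} (h : r < cr a x) : ∀ᶠ y in 𝓝 x, r < cr a y :=
  (isOpen_lt continuous_const (by fun_prop)).mem_nhds h

lemma eventually_cr_lt {a x : Plane} {r : ℝ} (h : cr a x < r) : ∀ᶠ y in 𝓝 x, cr a y < r :=
  (isOpen_lt (by fun_prop) continuous_const).mem_nhds h

lemma eventually_below_eq {w p q x : Plane} (hpq : cr w p < cr w q) (hx : x ∉ segment ℝ p q)
    (hp : cr w x ≠ cr w p) (hq : cr w x ≠ cr w q) :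
    ∀ᶠ y in 𝓝 x, below w s(p, q) y = below w s(p, q) x := by
  have main : ∀ᶠ y in 𝓝 x, Below w s(p, q) y ↔ Below w s(p, q) x := by
    simp only [below_iff hpq]
    rcases hp.lt_or_gt with h1 | h1
    · filter_upwards [eventually_cr_lt h1] with y hy
      exact iff_of_false (fun h => by linarith [h.1]) (fun h => by linarith [h.1])
    rcases hq.lt_or_gt with h2 | h2
    · have h3 : cr (q - p) (x - p) ≠ 0 := fun h0 =>
        hx (mem_segment_of_cr_eq_zero hpq h1.le h2.le h0)
      rcases h3.lt_or_gt with h3 | h3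
      · have : ∀ᶠ y in 𝓝 x, cr (q - p) (y - p) < 0 :=
          (isOpen_lt (by fun_prop) continuous_const).mem_nhds h3
        filter_upwards [this] with y hy
        exact iff_of_false (fun h => by linarith [h.2.2]) (fun h => by linarith [h.2.2])
      · have : ∀ᶠ y in 𝓝 x, 0 < cr (q - p) (y - p) :=
          (isOpen_lt continuous_const (by fun_prop)).mem_nhds h3
        filter_upwards [this, eventually_lt_cr h1, eventually_cr_lt h2] with y k1 k2 k3
        exact iff_of_true ⟨k2.le, k3, k1⟩ ⟨h1.le, h2, h3⟩
    · filter_upwards [eventually_lt_cr h2] with y hy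
      exact iff_of_false (fun h => by linarith [h.2.1]) (fun h => by linarith [h.2.1])
  filter_upwards [main] with y hy using below_congr hy

open Classical in
-- The half line from `x` in direction `w` passes through the vertex `v`. A wire ending in `v` is
-- met from one side of that line only. By the half open convention in `Below`, the count at `x`
-- agrees with the side `cr w v ≤ cr w y`, so the other side differs by the incidence.
lemma eventually_below_vertex {w p q x v : Plane} {l : ℝ} (hpq : cr w p < cr w q) (hl : l < 0)
    (hxv : x = v + l • w) (hv : v = p ∨ v = q) :
    ∀ᶠ y in 𝓝 x, below w s(p, q) y =
      below w s(p, q) x + if cr w y < cr w v then inc v s(p, q) else 0 := by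
  have hw : cr w x = cr w v := by rw [hxv, cr_add_right, cr_smul_right, cr_self]; ring
  have hanti : cr (q - p) w = -(cr w q - cr w p) := by rw [cr_anticomm, cr_sub_right]
  have h3 : 0 < cr (q - p) (x - p) := by
    have h0 : cr (q - p) (v - p) = 0 := by rcases hv with rfl | rfl <;> simp
    rw [hxv, add_sub_right_comm, cr_add_right, h0, cr_smul_right, hanti]
    nlinarith
  have h3' : ∀ᶠ y in 𝓝 x, 0 < cr (q - p) (y - p) :=
    (isOpen_lt continuous_const (by fun_prop)).mem_nhds h3
  have hinc : inc v s(p, q) = 1 := if_pos (by rcases hv with rfl | rfl <;> simp)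
  simp only [below, below_iff hpq, hinc]
  rcases hv with rfl | rfl
  · have : ∀ᶠ y in 𝓝 x, cr w y < cr w q := eventually_cr_lt (by rw [hw]; exact hpq)
    filter_upwards [h3', this] with y k1 k2
    rw [if_pos (show cr w v ≤ cr w x ∧ cr w x < cr w q ∧ 0 < cr (q - v) (x - v) from
      ⟨hw.ge, hw ▸ hpq, h3⟩)]
    by_cases h : cr w y < cr w v
    · rw [if_neg (fun h' => absurd h'.1 (not_le.2 h)), if_pos h]
      exact (CharTwo.add_self_eq_zero (1 : ZMod 2)).symm
    · rw [if_pos ⟨not_lt.1 h, k2, k1⟩, if_neg h, add_zero]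
  · have : ∀ᶠ y in 𝓝 x, cr w p < cr w y := eventually_lt_cr (by rw [hw]; exact hpq)
    filter_upwards [h3', this] with y k1 k2
    rw [if_neg (show ¬ (cr w p ≤ cr w x ∧ cr w x < cr w v ∧ 0 < cr (v - p) (x - p)) from
      fun h => absurd h.2.1 (by rw [hw]; exact lt_irrefl _)), zero_add]
    by_cases h : cr w y < cr w v
    · rw [if_pos ⟨k2.le, h, k1⟩, if_pos h]
    · rw [if_neg (fun h' => h h'.2.1), if_neg h]

open Classical in
lemma eventually_below_vertex_above {w p q x v : Plane} {l : ℝ} (hpq : cr w p < cr w q) (hl : 0 < l)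
    (hxv : x = v + l • w) (hv : v = p ∨ v = q) :
    ∀ᶠ y in 𝓝 x, below w s(p, q) y = below w s(p, q) x := by
  have hanti : cr (q - p) w = -(cr w q - cr w p) := by rw [cr_anticomm, cr_sub_right]
  have h3 : cr (q - p) (x - p) < 0 := by
    have h0 : cr (q - p) (v - p) = 0 := by rcases hv with rfl | rfl <;> simp
    rw [hxv, add_sub_right_comm, cr_add_right, h0, cr_smul_right, hanti]
    nlinarith
  have h3' : ∀ᶠ y in 𝓝 x, cr (q - p) (y - p) < 0 :=
    (isOpen_lt (by fun_prop) continuous_const).mem_nhds h3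
  filter_upwards [h3'] with y hy
  refine below_congr ?_
  simp only [below_iff hpq]
  exact iff_of_false (fun h => by linarith [h.2.2]) (fun h => by linarith [h.2.2])

section Parity

variable {w : Plane} {S : Finset (Sym2 Plane)}

lemma eventually_parity_eq (hw : GenericDir w S) (hd : ∀ e ∈ S, ¬ e.IsDiag) {x : Plane}
    (hx : x ∉ tr S) (hv : ∀ e ∈ S, ∀ v ∈ e, cr w x ≠ cr w v) :
    ∀ᶠ y in 𝓝 x, parity w S y = parity w S x := by
  have : ∀ e ∈ S, ∀ᶠ y in 𝓝 x, below w e y = below w e x := by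
    intro e he
    obtain ⟨p, q, rfl, hpq⟩ := exists_ordered hw hd he
    exact eventually_below_eq hpq (fun h => hx ⟨_, he, h⟩) (hv _ he p (by simp))
      (hv _ he q (by simp))
  filter_upwards [(Finset.eventually_all S).2 this] with y hy
  exact Finset.sum_congr rfl hy

open Classical in
/-- The jump of the parity on the line below a vertex. -/
lemma eventually_parity_vertex (hw : GenericDir w S) (hd : ∀ e ∈ S, ¬ e.IsDiag) {x v : Plane}
    {l : ℝ} (hl : l < 0) (hxv : x = v + l • w) (hx : x ∉ tr S)
    (hv : ∃ e ∈ S, v ∈ e) :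
    ∀ᶠ y in 𝓝 x, parity w S y =
      parity w S x + if cr w y < cr w v then ∑ e ∈ S, inc v e else 0 := by
  obtain ⟨e₀, he₀, hve₀⟩ := hv
  have hwx : cr w x = cr w v := by rw [hxv, cr_add_right, cr_smul_right, cr_self]; ring
  have : ∀ e ∈ S, ∀ᶠ y in 𝓝 x, below w e y =
      below w e x + if cr w y < cr w v then inc v e else 0 := by
    intro e he
    obtain ⟨p, q, rfl, hpq⟩ := exists_ordered hw hd he
    by_cases hve : v ∈ s(p, q)
    · exact eventually_below_vertex hpq hl hxv (Sym2.mem_iff.1 hve)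
    · have hne : ∀ u ∈ s(p, q), cr w x ≠ cr w u := fun u hu h =>
        hve (hw _ he₀ _ he v hve₀ u hu (hwx ▸ h) ▸ hu)
      filter_upwards [eventually_below_eq hpq (fun h => hx ⟨_, he, h⟩) (hne p (by simp))
        (hne q (by simp))] with y hy
      rw [hy, inc, if_neg hve, ite_self, add_zero]
  filter_upwards [(Finset.eventually_all S).2 this] with y hy
  rw [parity, Finset.sum_congr rfl hy, Finset.sum_add_distrib, parity]
  split_ifs <;> simp

/-- Every vertex is on an even number of wires. -/
def EvenSet (S : Finset (Sym2 Plane)) : Prop := ∀ v, ∑ e ∈ S, inc v e = 0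

/-- Off the wires the parity can change only where the half line passes through a vertex. There is
just one vertex on that line, and the jump is its degree, which is even. -/
lemma EvenSet.eventually_parity_eq (hS : EvenSet S) (hw0 : w ≠ 0) (hw : GenericDir w S)
    (hd : ∀ e ∈ S, ¬ e.IsDiag) {x : Plane} (hx : x ∉ tr S) :
    ∀ᶠ y in 𝓝 x, parity w S y = parity w S x := by
  by_cases hv : ∀ e ∈ S, ∀ v ∈ e, cr w x ≠ cr w v
  · exact PlaneWeb.eventually_parity_eq hw hd hx hv
  push Not at hv
  obtain ⟨e₀, he₀, v, hve₀, hxv⟩ := hv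
  obtain ⟨l, hl⟩ := exists_smul_of_cr_eq_zero hw0 (b := x - v) (by rw [cr_sub_right, hxv, sub_self])
  have hxv' : x = v + l • w := by rw [← hl]; simp
  rcases lt_trichotomy l 0 with h | rfl | h
  · filter_upwards [eventually_parity_vertex hw hd h hxv' hx ⟨e₀, he₀, hve₀⟩] with y hy
    rw [hy, hS v, ite_self, add_zero]
  · exact absurd ⟨e₀, he₀, by rw [hxv']; simpa using mem_seg_of_mem hve₀⟩ hx
  · have : ∀ e ∈ S, ∀ᶠ y in 𝓝 x, below w e y = below w e x := by
      intro e he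
      obtain ⟨p, q, rfl, hpq⟩ := exists_ordered hw hd he
      by_cases hve : v ∈ s(p, q)
      · exact eventually_below_vertex_above hpq h hxv' (Sym2.mem_iff.1 hve)
      · have hne : ∀ u ∈ s(p, q), cr w x ≠ cr w u := fun u hu h =>
          hve (hw _ he₀ _ he v hve₀ u hu (hxv ▸ h) ▸ hu)
        exact eventually_below_eq hpq (fun h => hx ⟨_, he, h⟩) (hne p (by simp)) (hne q (by simp))
    filter_upwards [(Finset.eventually_all S).2 this] with y hy
    exact Finset.sum_congr rfl hy

lemma eq_of_isPreconnected {β : Type*} {f : Plane → β} {A : Set Plane} (hA : IsPreconnected A)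
    (hf : ∀ x ∈ A, ∀ᶠ y in 𝓝[A] x, f y = f x) {x y : Plane} (hx : x ∈ A) (hy : y ∈ A) :
    f x = f y := by
  let _ : TopologicalSpace β := ⊥
  have : DiscreteTopology β := ⟨rfl⟩
  have hc : ContinuousOn f A := fun z hz =>
    (continuousWithinAt_const (b := f z)).congr_of_eventuallyEq (hf z hz) rfl
  exact hA.constant hc hx hy

lemma EvenSet.parity_eq (hS : EvenSet S) (hw0 : w ≠ 0) (hw : GenericDir w S)
    (hd : ∀ e ∈ S, ¬ e.IsDiag) {A : Set Plane} (hA : IsPreconnected A) (hAS : ∀ x ∈ A, x ∉ tr S)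
    {x y : Plane} (hx : x ∈ A) (hy : y ∈ A) : parity w S x = parity w S y :=
  eq_of_isPreconnected hA (fun _ hz =>
    nhdsWithin_le_nhds (hS.eventually_parity_eq hw0 hw hd (hAS _ hz))) hx hy

lemma exists_parity_eq_zero_of_ray (x v : Plane) (hv : cr w v ≠ 0) :
    ∃ R : ℝ, ∀ s, R < s → parity w S (x + s • v) = 0 := by
  have key : ∀ e ∈ S, ∀ᶠ s : ℝ in atTop, below w e (x + s • v) = 0 := by
    intro e he
    induction e with | _ p q => ?_
    have hlim : ∀ᶠ s : ℝ in atTop, ∀ r ∈ ({cr w p, cr w q} : Finset ℝ), s * |cr w v| >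
        |r - cr w x| := by
      have h0 := abs_pos.2 hv
      refine (Finset.eventually_all _).2 fun r _ => ?_
      exact (tendsto_id.atTop_mul_const h0).eventually_gt_atTop _
    filter_upwards [hlim, eventually_ge_atTop 0] with s hs hs0
    refine if_neg ?_
    rintro ⟨p', q', he', h1, h2, -⟩
    have hp : s * |cr w v| > |cr w p' - cr w x| ∧ s * |cr w v| > |cr w q' - cr w x| := by
      rcases Sym2.eq_iff.1 he' with ⟨rfl, rfl⟩ | ⟨rfl, rfl⟩
      · exact ⟨hs _ (by simp), hs _ (by simp)⟩
      · exact ⟨hs _ (by simp), hs _ (by simp)⟩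
    rw [cr_add_right, cr_smul_right] at h1 h2
    have k1 := neg_abs_le (cr w p' - cr w x)
    have k2 := le_abs_self (cr w q' - cr w x)
    rcases le_or_gt 0 (cr w v) with h | h
    · rw [abs_of_nonneg h] at hp
      linarith
    · rw [abs_of_neg h] at hp
      linarith
  obtain ⟨R, hR⟩ := eventually_atTop.1 ((Finset.eventually_all S).2 key)
  exact ⟨R, fun s hs => Finset.sum_eq_zero (hR s hs.le)⟩

/-- From a point outside the hull of the vertices one can run to infinity without meeting the hull,
in a direction transverse to `w`, and there the parity is eventually zero. A component of odd parity
stays within the hull. -/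
lemma EvenSet.isBounded (hS : EvenSet S) (hw0 : w ≠ 0) (hw : GenericDir w S)
    (hd : ∀ e ∈ S, ¬ e.IsDiag) {x : Plane} (hx : x ∉ tr S) (hp : parity w S x ≠ 0) :
    Bornology.IsBounded (connectedComponentIn (tr S)ᶜ x) := by
  have hfin : {v | ∃ e ∈ S, v ∈ e}.Finite := by
    classical
    refine (S.biUnion Sym2.toFinset).finite_toSet.subset fun v ⟨e, he, hv⟩ => ?_
    exact Finset.mem_biUnion.2 ⟨e, he, Sym2.mem_toFinset.2 hv⟩
  have hcpt := hfin.isCompact_convexHull ℝ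
  have hsub : tr S ⊆ convexHull ℝ {v | ∃ e ∈ S, v ∈ e} := by
    rintro z ⟨e, he, hz⟩
    induction e with | _ p q => ?_
    exact (convex_convexHull ℝ _).segment_subset
      (subset_convexHull ℝ {v | ∃ e ∈ S, v ∈ e} ⟨_, he, by simp⟩)
      (subset_convexHull ℝ {v | ∃ e ∈ S, v ∈ e} ⟨_, he, by simp⟩) hz
  refine hcpt.isBounded.subset fun y hy => ?_
  by_contra hcon
  have hyS := connectedComponentIn_subset _ _ hy
  have hpy : parity w S y ≠ 0 := by
    rwa [hS.parity_eq hw0 hw hd isPreconnected_connectedComponentIn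
      (fun z hz => connectedComponentIn_subset _ _ hz) hy (mem_connectedComponentIn hx)]
  obtain ⟨f, u, hfu, hup⟩ := geometric_hahn_banach_closed_point (convex_convexHull ℝ _)
    hcpt.isClosed hcon
  obtain ⟨a, ha⟩ := exists_cr_eq f
  rw [← ha] at hup
  obtain ⟨v, hv, hav⟩ : ∃ v, cr w v ≠ 0 ∧ 0 ≤ cr a v := by
    rcases le_total 0 (cr a (rot w)) with h | h
    · exact ⟨rot w, (cr_rot_pos hw0).ne', h⟩
    · exact ⟨-rot w, by rw [cr_neg_right]; exact neg_ne_zero.2 (cr_rot_pos hw0).ne',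
        by rw [cr_neg_right]; linarith⟩
  obtain ⟨R, hR⟩ := exists_parity_eq_zero_of_ray (S := S) y v hv
  have hpre : IsPreconnected (segment ℝ y (y + (|R| + 1) • v)) :=
    (convex_segment _ _).isPreconnected
  refine hpy ?_
  rw [hS.parity_eq hw0 hw hd hpre ?_ (left_mem_segment _ _ _) (right_mem_segment _ _ _)]
  · exact hR _ (by linarith [le_abs_self R])
  · intro z hz hzS
    obtain ⟨θ, h0, -, rfl⟩ := mem_segment_iff_smul.1 hz
    have h1 := hfu _ (hsub hzS)
    rw [← ha, add_sub_cancel_left, cr_add_right, cr_smul_right, cr_smul_right] at h1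
    have : 0 ≤ θ * ((|R| + 1) * cr a v) := by positivity
    linarith

end Parity

/-! ### The faces on the two sides of a wire -/

/-- The ray from `z` in the direction `u` starts in `U`. -/
def Side (u z : Plane) (U : Set Plane) : Prop := ∀ᶠ ε in 𝓝[>] (0 : ℝ), z + ε • u ∈ U

lemma tendsto_add_smul (z u : Plane) : Tendsto (fun ε : ℝ => z + ε • u) (𝓝[>] 0) (𝓝 z) := by
  have : Continuous fun ε : ℝ => z + ε • u := by fun_prop
  have h := this.tendsto 0
  rw [zero_smul, add_zero] at h
  exact h.mono_left nhdsWithin_le_nhds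

section Sides

variable {E : Finset (Sym2 Plane)} {U : Set Plane}

lemma exists_ball_of_notMem {p q : Plane} (hE : NonCrossing E) (he : s(p, q) ∈ E) {z : Plane}
    (hz : z ∈ seg s(p, q)) (hz' : z ∉ s(p, q)) :
    ∃ r > 0, ∀ y ∈ Metric.ball z r, y ∈ tr E → cr (q - p) (y - p) = 0 := by
  have hother : ∀ f ∈ E, ∀ᶠ y in 𝓝 z, y ∈ seg f → f = s(p, q) := by
    intro f hf
    by_cases hfe : f = s(p, q)
    · exact Eventually.of_forall fun _ _ => hfe
    · have hzf : z ∉ seg f := fun h => hz' (hE.mem _ he f hf (Ne.symm hfe) z hz h)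
      filter_upwards [(isCompact_seg f).isClosed.isOpen_compl.mem_nhds hzf] with y hy h
      exact absurd h hy
  obtain ⟨r, hr, hball⟩ := Metric.mem_nhds_iff.1 ((Finset.eventually_all E).2 hother)
  refine ⟨r, hr, fun y hy ⟨f, hf, hyf⟩ => ?_⟩
  have hfe := hball hy f hf hyf
  rw [hfe, seg_mk] at hyf
  obtain ⟨θ, -, -, rfl⟩ := mem_segment_iff_smul.1 hyf
  rw [add_sub_cancel_left, cr_smul_right, cr_self, mul_zero]

lemma cr_eq_zero_of_mem_segment {p q z : Plane} (hz : z ∈ segment ℝ p q) :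
    cr (q - p) (z - p) = 0 := by
  obtain ⟨θ, -, -, rfl⟩ := mem_segment_iff_smul.1 hz
  rw [add_sub_cancel_left, cr_smul_right, cr_self, mul_zero]

/-- Near an inner point of a wire each side of the wire belongs to one face. -/
lemma exists_halfBall {p q u : Plane} (hE : NonCrossing E) (he : s(p, q) ∈ E) {z : Plane}
    (hz : z ∈ seg s(p, q)) (hz' : z ∉ s(p, q)) (hu : cr (q - p) u ≠ 0) :
    ∃ H : Set Plane, Convex ℝ H ∧ (∀ x ∈ H, x ∉ tr E) ∧
      ∀ᶠ y in 𝓝 z, y ∈ seg s(p, q) → Side u y H := by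
  obtain ⟨r, hr, hball⟩ := exists_ball_of_notMem hE he hz hz'
  refine ⟨Metric.ball z r ∩ {y | 0 < cr (cr (q - p) u • (q - p)) (y - p)},
    (convex_ball z r).inter ?_, fun x hx hxt => ?_, ?_⟩
  · intro x hx y hy α β hα hβ hαβ
    replace hx : 0 < cr (cr (q - p) u • (q - p)) (x - p) := hx
    replace hy : 0 < cr (cr (q - p) u • (q - p)) (y - p) := hy
    change 0 < cr (cr (q - p) u • (q - p)) _
    have e : α • x + β • y - p = α • (x - p) + β • (y - p) := by
      have : α • x + β • y - p = α • (x - p) + β • (y - p) + (α + β - 1) • p := by module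
      rw [this, hαβ]; simp
    rw [e, cr_add_right, cr_smul_right, cr_smul_right]
    obtain rfl : β = 1 - α := by linarith
    rcases hα.eq_or_lt with rfl | h
    · simpa using hy
    · have := mul_pos h hx
      have := mul_nonneg hβ hy.le
      linarith
  · have h1 : 0 < cr (cr (q - p) u • (q - p)) (x - p) := hx.2
    rw [cr_smul_left, hball x hx.1 hxt, mul_zero] at h1
    exact lt_irrefl _ h1
  · filter_upwards [Metric.ball_mem_nhds z hr] with y hy hyseg
    filter_upwards [(tendsto_add_smul y u).eventually (Metric.isOpen_ball.mem_nhds hy),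
      self_mem_nhdsWithin] with ε h1 h0
    replace h0 : 0 < ε := h0
    refine ⟨h1, ?_⟩
    change 0 < cr (cr (q - p) u • (q - p)) _
    rw [add_sub_right_comm, cr_add_right, cr_smul_left, cr_smul_left, cr_smul_right,
      cr_eq_zero_of_mem_segment hyseg, mul_zero, zero_add]
    have := mul_self_pos.2 hu
    nlinarith

lemma Side.and_exists {u z : Plane} {U V : Set Plane} (h : Side u z U) (h' : Side u z V) :
    ∃ y, y ∈ U ∧ y ∈ V := by
  obtain ⟨ε, h1, h2⟩ := (Filter.Eventually.and h h').exists
  exact ⟨_, h1, h2⟩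

lemma Side.mono {u z : Plane} {U V : Set Plane} (h : Side u z U) (hUV : U ⊆ V) : Side u z V :=
  Filter.Eventually.mono h fun _ hx => hUV hx

lemma exists_side {p q u : Plane} (hE : NonCrossing E) (he : s(p, q) ∈ E) {z : Plane}
    (hz : z ∈ seg s(p, q)) (hz' : z ∉ s(p, q)) (hu : cr (q - p) u ≠ 0) :
    ∃ U, IsFace E U ∧ Side u z U := by
  obtain ⟨H, hH, hHt, hside⟩ := exists_halfBall hE he hz hz' hu
  have h := hside.self_of_nhds hz
  obtain ⟨y, hy, -⟩ := h.and_exists h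
  refine ⟨_, ⟨y, hHt y hy, rfl⟩, h.mono ?_⟩
  exact hH.isPreconnected.subset_connectedComponentIn hy hHt

lemma convex_openSeg (p q : Plane) : IsPreconnected {z | z ∈ seg s(p, q) ∧ z ∉ s(p, q)} := by
  by_cases hpq : p = q
  · have : {z | z ∈ seg s(p, q) ∧ z ∉ s(p, q)} = ∅ := by
      ext z; subst hpq; simp [seg_mk]
    rw [this]; exact isPreconnected_empty
  · have : {z | z ∈ seg s(p, q) ∧ z ∉ s(p, q)} = openSegment ℝ p q := by
      ext z
      constructor
      · rintro ⟨h1, h2⟩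
        rw [Sym2.mem_iff] at h2
        push Not at h2
        obtain ⟨θ, h0, h1, rfl⟩ := exists_param_of_mem_segment h1 h2.1 h2.2
        exact ⟨1 - θ, θ, by linarith, h0, by ring, by module⟩
      · intro h
        refine ⟨openSegment_subset_segment _ _ _ h, fun h' => ?_⟩
        rw [Sym2.mem_iff] at h'
        rcases h' with rfl | rfl
        · exact hpq ((left_mem_openSegment_iff).1 h)
        · exact hpq ((right_mem_openSegment_iff).1 h)
    rw [this]
    exact (convex_openSegment p q).isPreconnected

/-- By `exists_halfBall` lying beside a given face is a locally constant property along the open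
wire, which is connected. -/
lemma Side.congr {p q u : Plane} (hE : NonCrossing E) (he : s(p, q) ∈ E) (hU : IsFace E U)
    (hu : cr (q - p) u ≠ 0) {z y : Plane} (hz : z ∈ seg s(p, q)) (hz' : z ∉ s(p, q))
    (hy : y ∈ seg s(p, q)) (hy' : y ∉ s(p, q)) (h : Side u z U) : Side u y U := by
  have := eq_of_isPreconnected (f := fun x => Side u x U) (convex_openSeg p q) ?_
    (x := z) (y := y) ⟨hz, hz'⟩ ⟨hy, hy'⟩
  · exact this ▸ h
  · rintro x ⟨hx, hx'⟩
    obtain ⟨H, hH, hHt, hside⟩ := exists_halfBall hE he hx hx' hu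
    have key : ∀ v, Side u v H → (Side u v U ↔ H ⊆ U) := fun v hv => by
      constructor
      · intro h
        obtain ⟨y, h1, h2⟩ := h.and_exists hv
        exact hU.subset_of_isPreconnected hH.isPreconnected hHt h2 h1
      · exact fun h => hv.mono h
    filter_upwards [nhdsWithin_le_nhds hside, self_mem_nhdsWithin] with v hv hvA
    rw [key v (hv hvA.1), key x (hside.self_of_nhds hx)]

/-- `up` and `dn` give the faces above and below the wires. -/
structure IsSides (E : Finset (Sym2 Plane)) (w : Plane) (up dn : Sym2 Plane → Set Plane) : Prop where
  up_face : ∀ e ∈ E, IsFace E (up e)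
  dn_face : ∀ e ∈ E, IsFace E (dn e)
  up_side : ∀ e ∈ E, ∀ z ∈ seg e, z ∉ e → Side w z (up e)
  dn_side : ∀ e ∈ E, ∀ z ∈ seg e, z ∉ e → Side (-w) z (dn e)

lemma exists_mem_seg_notMem {w : Plane} (E : Finset (Sym2 Plane)) {e : Sym2 Plane}
    (hd : ¬ e.IsDiag) (hw : ∀ p q, e = s(p, q) → cr w p ≠ cr w q) :
    ∃ z ∈ seg e, z ∉ e ∧ ∀ f ∈ E, ∀ v ∈ f, cr w z ≠ cr w v := by
  classical
  induction e with | _ p q => ?_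
  rw [Sym2.mk_isDiag_iff] at hd
  have h0 : cr w q - cr w p ≠ 0 := sub_ne_zero.2 (hw p q rfl).symm
  obtain ⟨θ, ⟨h1, h2⟩, hθ⟩ := (Ioo_infinite (zero_lt_one (α := ℝ))).exists_notMem_finset
    ((E.biUnion Sym2.toFinset).image fun v => (cr w v - cr w p) / (cr w q - cr w p))
  refine ⟨p + θ • (q - p), mem_segment_iff_smul.2 ⟨θ, h1.le, h2.le, rfl⟩, ?_, ?_⟩
  · rw [Sym2.mem_iff]
    have hqp := sub_ne_zero.2 (Ne.symm hd)
    rintro (h | h)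
    · exact hqp ((smul_eq_zero.1 (add_eq_left.1 h)).resolve_left h1.ne')
    · have : (1 - θ) • (q - p) = 0 := by
        have e : (1 - θ) • (q - p) = q - (p + θ • (q - p)) := by module
        rw [e, h, sub_self]
      exact hqp ((smul_eq_zero.1 this).resolve_left (by linarith))
  · intro f hf v hv h
    refine hθ (Finset.mem_image.2 ⟨v, Finset.mem_biUnion.2 ⟨f, hf, Sym2.mem_toFinset.2 hv⟩, ?_⟩)
    rw [← h, cr_add_right, cr_smul_right, cr_sub_right, add_sub_cancel_left,
      mul_div_cancel_right₀ _ h0]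

lemma GenericDir.ne {w : Plane} (hw : GenericDir w E) (hE : NonCrossing E) {e : Sym2 Plane}
    (he : e ∈ E) : ∀ p q, e = s(p, q) → cr w p ≠ cr w q := by
  rintro p q rfl h
  exact hE.not_isDiag _ he (by
    rw [Sym2.mk_isDiag_iff]; exact hw _ he _ he p (by simp) q (by simp) h)

lemma exists_isSides (hE : NonCrossing E) {w : Plane} (hw : GenericDir w E) :
    ∃ up dn, IsSides E w up dn := by
  have : ∀ u, (∀ p q, s(p, q) ∈ E → cr (q - p) u ≠ 0) → ∀ e ∈ E, ∃ U, IsFace E U ∧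
      ∀ z ∈ seg e, z ∉ e → Side u z U := by
    intro u hu e he
    obtain ⟨z, hz, hz', -⟩ := exists_mem_seg_notMem E (hE.not_isDiag e he) (hw.ne hE he)
    induction e with | _ p q => ?_
    obtain ⟨U, hU, hs⟩ := exists_side hE he hz hz' (hu p q he)
    exact ⟨U, hU, fun y hy hy' => hs.congr hE he hU (hu p q he) hz hz' hy hy'⟩
  have hu : ∀ p q, s(p, q) ∈ E → cr (q - p) w ≠ 0 := fun p q he h => by
    rw [cr_anticomm, cr_sub_right, neg_eq_zero, sub_eq_zero] at h
    exact hw.ne hE he p q rfl h.symm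
  choose! up h1 h2 using this w hu
  choose! dn h3 h4 using this (-w) fun p q he h => hu p q he (by rwa [cr_neg_right, neg_eq_zero] at h)
  exact ⟨up, dn, h1, h3, h2, h4⟩

open Classical in
/-- The parity changes across the wires of `S` only. -/
lemma eventually_parity_sides {w : Plane} {S : Finset (Sym2 Plane)} (hE : NonCrossing E)
    (hw : GenericDir w E) (hS : S ⊆ E) {e : Sym2 Plane} (he : e ∈ E) {z : Plane} (hz : z ∈ seg e)
    (hz' : z ∉ e) (hv : ∀ f ∈ E, ∀ v ∈ f, cr w z ≠ cr w v) :
    ∃ k : ZMod 2, (∀ᶠ ε in 𝓝[>] (0 : ℝ), parity w S (z + ε • w) = k) ∧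
      ∀ᶠ ε in 𝓝[>] (0 : ℝ), parity w S (z + ε • -w) = k + if e ∈ S then 1 else 0 := by
  obtain ⟨p, q, rfl, hpq⟩ := exists_ordered hw hE.not_isDiag he
  have hother : ∀ᶠ y in 𝓝 z, ∀ f ∈ S.erase s(p, q), below w f y = below w f z := by
    refine (Finset.eventually_all _).2 fun f hf => ?_
    obtain ⟨hfe, hf⟩ := Finset.mem_erase.1 hf
    replace hf := hS hf
    obtain ⟨p', q', rfl, hpq'⟩ := exists_ordered hw hE.not_isDiag hf
    exact eventually_below_eq hpq' (fun h => hz' (hE.mem _ he _ hf hfe.symm z hz h))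
      (hv _ hf p' (by simp)) (hv _ hf q' (by simp))
  have hp : cr w p < cr w z ∧ cr w z < cr w q := by
    obtain ⟨θ, h0, h1, rfl⟩ := mem_segment_iff_smul.1 hz
    have k1 := hv _ he p (by simp)
    have k2 := hv _ he q (by simp)
    rw [cr_add_right, cr_smul_right, cr_sub_right] at k1 k2 ⊢
    refine ⟨lt_of_le_of_ne (by nlinarith) k1.symm, lt_of_le_of_ne (by nlinarith) k2⟩
  have hanti : cr (q - p) w = -(cr w q - cr w p) := by rw [cr_anticomm, cr_sub_right]
  have h0 := cr_eq_zero_of_mem_segment hz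
  have hup : ∀ ε : ℝ, 0 < ε → below w s(p, q) (z + ε • w) = 0 := by
    intro ε hε
    rw [below, if_neg]
    rw [below_iff hpq]
    rintro ⟨-, -, h⟩
    rw [add_sub_right_comm, cr_add_right, h0, cr_smul_right, hanti] at h
    nlinarith
  have hdn : ∀ ε : ℝ, 0 < ε → below w s(p, q) (z + ε • -w) = 1 := by
    intro ε hε
    rw [below, if_pos]
    rw [below_iff hpq, cr_add_right, cr_smul_right, cr_neg_right, cr_self]
    refine ⟨by linarith [hp.1], by linarith [hp.2], ?_⟩
    rw [add_sub_right_comm, cr_add_right, h0, cr_smul_right, cr_neg_right, hanti]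
    nlinarith
  have hpar : ∀ y, (∀ f ∈ S.erase s(p, q), below w f y = below w f z) →
      parity w S y = ∑ f ∈ S.erase s(p, q), below w f z +
        if s(p, q) ∈ S then below w s(p, q) y else 0 := by
    intro y hy
    rw [parity, ← Finset.sum_congr rfl hy]
    split_ifs with h
    · rw [Finset.sum_erase_add _ _ h]
    · rw [Finset.erase_eq_of_notMem h, add_zero]
  refine ⟨∑ f ∈ S.erase s(p, q), below w f z, ?_, ?_⟩
  · filter_upwards [(tendsto_add_smul z w).eventually hother, self_mem_nhdsWithin] with ε h1 h2
    rw [hpar _ h1, hup ε h2, ite_self, add_zero]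
  · filter_upwards [(tendsto_add_smul z (-w)).eventually hother, self_mem_nhdsWithin] with ε h1 h2
    rw [hpar _ h1, hdn ε h2]

open Classical in
-- The parity of an even set is constant on each face, so the jump across the wire at one generic
-- inner point decides.
lemma EvenSet.parity_add_parity {w : Plane} {S : Finset (Sym2 Plane)} {up dn : Sym2 Plane → Set Plane}
    (hSe : EvenSet S) (hE : NonCrossing E) (hw0 : w ≠ 0) (hw : GenericDir w E) (hS : S ⊆ E)
    (hs : IsSides E w up dn) {e : Sym2 Plane} (he : e ∈ E) {x y : Plane} (hx : x ∈ up e)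
    (hy : y ∈ dn e) : parity w S x + parity w S y = if e ∈ S then 1 else 0 := by
  obtain ⟨z, hz, hz', hv⟩ := exists_mem_seg_notMem E (hE.not_isDiag e he) (hw.ne hE he)
  obtain ⟨k, h1, h2⟩ := eventually_parity_sides hE hw hS he hz hz' hv
  obtain ⟨ε, ⟨h1, h2⟩, h3, h4⟩ := ((h1.and h2).and ((hs.up_side e he z hz hz').and
    (hs.dn_side e he z hz hz'))).exists
  have hconst : ∀ {U : Set Plane}, IsFace E U → ∀ {x y}, x ∈ U → y ∈ U →
      parity w S x = parity w S y := fun hU _ _ hx hy =>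
    hSe.parity_eq hw0 (hw.mono hS) (fun e he => hE.not_isDiag e (hS he)) hU.isPreconnected
      (fun z hz ⟨f, hf, hzf⟩ => hU.notMem_tr hz ⟨f, hS hf, hzf⟩) hx hy
  rw [hconst (hs.up_face e he) hx h3, hconst (hs.dn_face e he) hy h4, h1, h2, ← add_assoc,
    CharTwo.add_self_eq_zero, zero_add]

end Sides

/-! ### The boundary of a bounded face is even -/

/-- The right-hand limits of `G` form a locally constant function, since both one-sided limits agree
everywhere. That function is constant on the line and zero far out. The values of `G` at the points
where the line meets wires play no role. -/
lemma eventually_eq_zero_of_locally_eq {G : ℝ → ZMod 2}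
    (hG : ∀ s, ∃ k, (∀ᶠ r in 𝓝[>] s, G r = k) ∧ ∀ᶠ r in 𝓝[<] s, G r = k)
    (h0 : ∃ R, ∀ s, R < s → G s = 0) (s : ℝ) : ∀ᶠ r in 𝓝[>] s, G r = 0 := by
  choose k hr hl using hG
  have huniq : ∀ {s c}, (∀ᶠ r in 𝓝[>] s, G r = c) → k s = c := by
    intro s c h
    obtain ⟨r, h1, h2⟩ := ((hr s).and h).exists
    exact h1.symm.trans h2
  have hloc : IsLocallyConstant k := by
    rw [IsLocallyConstant.iff_eventually_eq]
    intro s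
    rw [← nhdsNE_sup_pure s, eventually_sup, eventually_pure]
    refine ⟨?_, rfl⟩
    rw [← nhdsLT_sup_nhdsGT, eventually_sup]
    constructor
    · obtain ⟨a, ha, h⟩ := mem_nhdsLT_iff_exists_Ioo_subset.1 (hl s)
      filter_upwards [Ioo_mem_nhdsLT ha] with y hy
      refine huniq ?_
      filter_upwards [Ioo_mem_nhdsGT hy.2] with r hr
      exact h ⟨hy.1.trans hr.1, hr.2⟩
    · obtain ⟨a, ha, h⟩ := mem_nhdsGT_iff_exists_Ioo_subset.1 (hr s)
      filter_upwards [Ioo_mem_nhdsGT ha] with y hy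
      refine huniq ?_
      filter_upwards [Ioo_mem_nhdsGT hy.2] with r hr
      exact h ⟨hy.1.trans hr.1, hr.2⟩
  obtain ⟨R, hR⟩ := h0
  have h1 : k (R + 1) = 0 := huniq (by
    filter_upwards [self_mem_nhdsWithin] with r hr
    exact hR r (by linarith [show R + 1 < r from hr]))
  have h2 : k s = 0 := by rw [hloc.apply_eq_of_preconnectedSpace s (R + 1), h1]
  exact h2 ▸ hr s

lemma eventually_right_of_side {x w : Plane} {s : ℝ} {P : Plane → Prop}
    (h : ∀ᶠ ε in 𝓝[>] (0 : ℝ), P (x + s • w + ε • w)) : ∀ᶠ r in 𝓝[>] s, P (x + r • w) := by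
  have hlim : Tendsto (fun r : ℝ => r - s) (𝓝[>] s) (𝓝[>] 0) := by
    refine tendsto_nhdsWithin_of_tendsto_nhds_of_eventually_within _ ?_ ?_
    · have : Continuous fun r : ℝ => r - s := by fun_prop
      have h := this.tendsto s
      rw [sub_self] at h
      exact h.mono_left nhdsWithin_le_nhds
    · filter_upwards [self_mem_nhdsWithin] with r hr
      exact sub_pos.2 (show s < r from hr)
  filter_upwards [hlim.eventually h] with r hr
  rwa [add_assoc, ← add_smul, add_sub_cancel] at hr

lemma eventually_left_of_side {x w : Plane} {s : ℝ} {P : Plane → Prop}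
    (h : ∀ᶠ ε in 𝓝[>] (0 : ℝ), P (x + s • w + ε • -w)) : ∀ᶠ r in 𝓝[<] s, P (x + r • w) := by
  have hlim : Tendsto (fun r : ℝ => s - r) (𝓝[<] s) (𝓝[>] 0) := by
    refine tendsto_nhdsWithin_of_tendsto_nhds_of_eventually_within _ ?_ ?_
    · have : Continuous fun r : ℝ => s - r := by fun_prop
      have h := this.tendsto s
      rw [sub_self] at h
      exact h.mono_left nhdsWithin_le_nhds
    · filter_upwards [self_mem_nhdsWithin] with r hr
      exact sub_pos.2 (show r < s from hr)
  filter_upwards [hlim.eventually h] with r hr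
  rwa [add_assoc, smul_neg, ← neg_smul, ← add_smul, show s + -(s - r) = r by ring] at hr

section Boundary

variable {E : Finset (Sym2 Plane)} {U : Set Plane} {w : Plane} {up dn : Sym2 Plane → Set Plane}

open Classical in
/-- The wires with `U` on exactly one side. -/
noncomputable def bdry (E : Finset (Sym2 Plane)) (up dn : Sym2 Plane → Set Plane) (U : Set Plane) :
    Finset (Sym2 Plane) := {e ∈ E | ¬ (up e = U ↔ dn e = U)}

lemma mem_bdry {e : Sym2 Plane} : e ∈ bdry E up dn U ↔ e ∈ E ∧ ¬ (up e = U ↔ dn e = U) := by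
  classical
  exact Finset.mem_filter

lemma IsFace.mem_iff_eq {V : Set Plane} (hU : IsFace E U) (hV : IsFace E V) {x : Plane} (hx : x ∈ V) :
    x ∈ U ↔ V = U :=
  ⟨fun h => hV.eq_of_mem hU hx h, fun h => h ▸ hx⟩

lemma IsFace.eventually_mem_iff (hU : IsFace E U) {x : Plane} (hx : x ∉ tr E) :
    ∀ᶠ y in 𝓝 x, y ∈ U ↔ x ∈ U := by
  have hV : IsFace E (connectedComponentIn (tr E)ᶜ x) := ⟨x, hx, rfl⟩
  have hxV := mem_connectedComponentIn (F := (tr E)ᶜ) hx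
  filter_upwards [hV.isOpen.mem_nhds hxV] with y hy
  rw [hU.mem_iff_eq hV hy, hU.mem_iff_eq hV hxV]

open Classical in
-- Along the line from `x` in direction `w` the indicator of `U` and the parity of its boundary
-- wires jump at the same wires. Both vanish far out, because `U` is bounded. The line avoids all
-- vertices, so the evenness of the boundary is not presupposed; it will be deduced from this lemma.
lemma indicator_eq_parity (hE : NonCrossing E) (hw0 : w ≠ 0) (hw : GenericDir w E)
    (hs : IsSides E w up dn) (hU : IsFace E U) (hb : Bornology.IsBounded U) {x : Plane}
    (hx : x ∉ tr E) (hv : ∀ f ∈ E, ∀ v ∈ f, cr w x ≠ cr w v) :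
    (if x ∈ U then 1 else 0) = parity w (bdry E up dn U) x := by
  set B := bdry E up dn U with hB
  have hBE : B ⊆ E := fun e he => (mem_bdry.1 he).1
  have hd : ∀ e ∈ B, ¬ e.IsDiag := fun e he => hE.not_isDiag e (hBE he)
  set G : ℝ → ZMod 2 := fun s => (if x + s • w ∈ U then 1 else 0) + parity w B (x + s • w) with hG
  have hh : ∀ s : ℝ, cr w (x + s • w) = cr w x := fun s => by
    rw [cr_add_right, cr_smul_right, cr_self, mul_zero, add_zero]
  have hopen : ∀ s : ℝ, x + s • w ∉ tr E →
      ∀ᶠ y in 𝓝 (x + s • w), (if y ∈ U then 1 else 0) + parity w B y = G s := by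
    intro s hs
    filter_upwards [hU.eventually_mem_iff hs, eventually_parity_eq (hw.mono hBE) hd
      (fun ⟨f, hf, h⟩ => hs ⟨f, hBE hf, h⟩)
      (fun e he v hve => by rw [hh]; exact hv e (hBE he) v hve)] with y h1 h2
    simp only [hG, h1, h2]
  have hline : Continuous fun r : ℝ => x + r • w := by fun_prop
  have hloc : ∀ s, ∃ k, (∀ᶠ r in 𝓝[>] s, G r = k) ∧ ∀ᶠ r in 𝓝[<] s, G r = k := by
    intro s
    by_cases hst : x + s • w ∈ tr E
    · obtain ⟨e, he, hze⟩ := hst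
      have hz' : x + s • w ∉ e := fun h => hv e he _ h (hh s).symm
      obtain ⟨k, h1, h2⟩ := eventually_parity_sides hE hw hBE he hze hz'
        (fun f hf v hvf => by rw [hh]; exact hv f hf v hvf)
      refine ⟨(if up e = U then 1 else 0) + k, ?_, ?_⟩
      · refine eventually_right_of_side
          (P := fun y => (if y ∈ U then 1 else 0) + parity w B y = _) ?_
        filter_upwards [h1, hs.up_side e he _ hze hz'] with ε k1 k2
        simp only [k1, hU.mem_iff_eq (hs.up_face e he) k2]
      · refine eventually_left_of_side
          (P := fun y => (if y ∈ U then 1 else 0) + parity w B y = _) ?_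
        filter_upwards [h2, hs.dn_side e he _ hze hz'] with ε k1 k2
        simp only [k1, hU.mem_iff_eq (hs.dn_face e he) k2]
        have hBmem : e ∈ B ↔ ¬ (up e = U ↔ dn e = U) := by
          rw [hB, mem_bdry]; exact and_iff_right he
        simp only [hBmem]
        by_cases c1 : up e = U <;> by_cases c2 : dn e = U <;> simp [c1, c2]
        · rw [add_comm]
        · rw [add_comm k, ← add_assoc, CharTwo.add_self_eq_zero, zero_add]
    · have := hline.continuousAt.eventually (hopen s hst)
      exact ⟨G s, this.filter_mono nhdsWithin_le_nhds, this.filter_mono nhdsWithin_le_nhds⟩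
  have hfar : ∃ R, ∀ s, R < s → G s = 0 := by
    obtain ⟨R, hR⟩ := hb.subset_closedBall 0
    have h0 := norm_pos_iff.2 hw0
    have hbelow : ∀ e ∈ B, ∀ᶠ s : ℝ in atTop, below w e (x + s • w) = 0 := by
      intro e he
      obtain ⟨p, q, rfl, hpq⟩ := exists_ordered (hw.mono hBE) hd he
      filter_upwards [eventually_gt_atTop (cr (q - p) (x - p) / (cr w q - cr w p))] with s hs
      rw [below, if_neg]
      rw [below_iff hpq]
      rintro ⟨-, -, h⟩
      have hanti : cr (q - p) w = -(cr w q - cr w p) := by rw [cr_anticomm, cr_sub_right]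
      rw [div_lt_iff₀ (sub_pos.2 hpq)] at hs
      rw [add_sub_right_comm, cr_add_right, cr_smul_right, hanti] at h
      linarith
    obtain ⟨R', hR'⟩ := eventually_atTop.1 ((Finset.eventually_all B).2 hbelow)
    refine ⟨max R' ((|R| + ‖x‖) / ‖w‖), fun s hs => ?_⟩
    have h1 : parity w B (x + s • w) = 0 :=
      Finset.sum_eq_zero (hR' s ((le_max_left _ _).trans hs.le))
    have h2 : x + s • w ∉ U := by
      intro hmem
      have h3 := hR hmem
      rw [mem_closedBall_zero_iff] at h3
      have h4 := (le_max_right _ _).trans_lt hs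
      rw [div_lt_iff₀ h0] at h4
      have h5 := norm_sub_le (x + s • w) x
      rw [add_sub_cancel_left, norm_smul] at h5
      have h6 := mul_le_mul_of_nonneg_right (le_abs_self s) h0.le
      rw [Real.norm_eq_abs] at h5
      linarith [le_abs_self R]
    simp only [hG, h1, if_neg h2, add_zero]
  have h0 := eventually_eq_zero_of_locally_eq hloc hfar 0
  have h1 := hline.continuousAt.eventually (hopen 0 (by simpa using hx))
  obtain ⟨r, h2, h3⟩ := (h0.and (h1.filter_mono nhdsWithin_le_nhds)).exists
  have h4 : G 0 = 0 := h3.symm.trans h2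
  simp only [hG, zero_smul, add_zero] at h4
  exact CharTwo.add_eq_zero.1 h4

lemma finite_line_inter (hE : NonCrossing E) (hw : GenericDir w E) (v : Plane) :
    {l : ℝ | v + l • w ∈ tr E}.Finite := by
  have : {l : ℝ | v + l • w ∈ tr E} ⊆ ⋃ e ∈ E, {l : ℝ | v + l • w ∈ seg e} := by
    rintro l ⟨e, he, h⟩
    exact mem_biUnion he h
  refine (E.finite_toSet.biUnion fun e he => Set.Subsingleton.finite ?_).subset this
  intro l hl l' hl'
  obtain ⟨p, q, rfl, hpq⟩ := exists_ordered hw hE.not_isDiag he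
  have h1 := cr_eq_zero_of_mem_segment (show v + l • w ∈ segment ℝ p q from hl)
  have h2 := cr_eq_zero_of_mem_segment (show v + l' • w ∈ segment ℝ p q from hl')
  have hanti : cr (q - p) w = -(cr w q - cr w p) := by rw [cr_anticomm, cr_sub_right]
  rw [add_sub_right_comm, cr_add_right, cr_smul_right, hanti] at h1 h2
  have h3 : (l - l') * (cr w q - cr w p) = 0 := by linarith
  exact sub_eq_zero.1 ((mul_eq_zero.1 h3).resolve_right (by linarith))

/-- Take a point `x` off the net on the line below `v`. Near `x` the indicator of `U` is constant,
and it equals the parity at generic points on both sides of the line. Across the line the parity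
jumps by the degree of `v` in the boundary, which is therefore even. -/
lemma evenSet_bdry (hE : NonCrossing E) (hw0 : w ≠ 0) (hw : GenericDir w E)
    (hs : IsSides E w up dn) (hU : IsFace E U) (hb : Bornology.IsBounded U) :
    EvenSet (bdry E up dn U) := by
  classical
  intro v
  set B := bdry E up dn U with hB
  have hBE : B ⊆ E := fun e he => (mem_bdry.1 he).1
  have hd : ∀ e ∈ B, ¬ e.IsDiag := fun e he => hE.not_isDiag e (hBE he)
  by_cases hv : ∃ e ∈ B, v ∈ e
  swap
  · push Not at hv
    exact Finset.sum_eq_zero fun e he => if_neg (hv e he)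
  obtain ⟨e₀, he₀, hve₀⟩ := hv
  have hfin := finite_line_inter hE hw v
  obtain ⟨l, hl, hlt⟩ := (Iio_infinite (0 : ℝ)).exists_notMem_finite hfin
  replace hl : l < 0 := hl
  set x := v + l • w with hx
  have hxE : x ∉ tr E := hlt
  have hcx : cr w x = cr w v := by rw [hx, cr_add_right, cr_smul_right, cr_self]; ring
  have hev1 := eventually_parity_vertex (hw.mono hBE) hd hl hx
    (fun ⟨f, hf, h⟩ => hxE ⟨f, hBE hf, h⟩) ⟨e₀, he₀, hve₀⟩
  have hev2 := hU.eventually_mem_iff hxE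
  have hev3 : ∀ᶠ y in 𝓝 x, y ∉ tr E := (isClosed_tr E).isOpen_compl.mem_nhds hxE
  have hev4 : ∀ᶠ y in 𝓝 x, ∀ u ∈ E.biUnion Sym2.toFinset, u ≠ v → cr w y ≠ cr w u := by
    refine (Finset.eventually_all _).2 fun u hu => ?_
    obtain ⟨f, hf, huf⟩ := Finset.mem_biUnion.1 hu
    by_cases huv : u = v
    · exact Eventually.of_forall fun y h => absurd huv h
    · have hne : cr w x ≠ cr w u := fun h => huv
        (hw _ (hBE he₀) f hf v hve₀ u (Sym2.mem_toFinset.1 huf) (hcx ▸ h)).symm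
      have : ∀ᶠ y in 𝓝 x, cr w y ≠ cr w u :=
        (isOpen_ne_fun (by fun_prop) continuous_const).mem_nhds hne
      exact this.mono fun y h _ => h
  have hall := (hev1.and hev2).and (hev3.and hev4)
  obtain ⟨ε, ⟨⟨⟨a1, a2⟩, a3, a4⟩, ⟨b1, b2⟩, b3, b4⟩, h0⟩ :=
    (((tendsto_add_smul x (rot w)).eventually hall).and
      ((tendsto_add_smul x (-rot w)).eventually hall)).and self_mem_nhdsWithin |>.exists
  replace h0 : 0 < ε := h0
  have hrot := cr_rot_pos hw0
  have hpos := mul_pos h0 hrot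
  have e1 : cr w (x + ε • rot w) = cr w v + ε * cr w (rot w) := by
    rw [cr_add_right, cr_smul_right, hcx]
  have e2 : cr w (x + ε • -rot w) = cr w v - ε * cr w (rot w) := by
    rw [cr_add_right, cr_smul_right, cr_neg_right, hcx]; ring
  have hind : ∀ y, y ∉ tr E → (∀ u ∈ E.biUnion Sym2.toFinset, u ≠ v → cr w y ≠ cr w u) →
      cr w y ≠ cr w v → (if y ∈ U then 1 else 0) = parity w B y := by
    intro y hy hyu hyv
    refine indicator_eq_parity hE hw0 hw hs hU hb hy fun f hf u hu => ?_
    by_cases huv : u = v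
    · rw [huv]; exact hyv
    · exact hyu u (Finset.mem_biUnion.2 ⟨f, hf, Sym2.mem_toFinset.2 hu⟩) huv
  have k1 := hind _ a3 a4 (by rw [e1]; linarith)
  have k2 := hind _ b3 b4 (by rw [e2]; linarith)
  rw [a1, if_neg (show ¬ cr w (x + ε • rot w) < cr w v by rw [e1]; linarith), add_zero] at k1
  rw [b1, if_pos (show cr w (x + ε • -rot w) < cr w v by rw [e2]; linarith)] at k2
  simp only [a2] at k1
  simp only [b2] at k2
  rw [k1] at k2
  exact left_eq_add.1 k2

end Boundary

/-! ### Loops and faces -/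

section Loops

variable {E : Finset (Sym2 Plane)} {w : Plane} {up dn : Sym2 Plane → Set Plane}

open Classical in
/-- The edge sets of loops that no cycle of wires inside them splits in two. -/
structure IsPrimeLoop (E : Finset (Sym2 Plane)) (w : Plane) (up : Sym2 Plane → Set Plane)
    (L : Finset (Sym2 Plane)) : Prop where
  subset : L ⊆ E
  even : EvenSet L
  nonempty : L.Nonempty
  eq_of_even : ∀ M ⊆ L, EvenSet M → M.Nonempty → M = L
  inter_even : ∀ M ⊆ E, EvenSet M → (∀ e ∈ M, e ∉ L → ∀ x ∈ up e, parity w L x = 1) →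
    EvenSet (M ∩ L)

lemma EvenSet.parity_eq_of_face {S : Finset (Sym2 Plane)} (hSe : EvenSet S) (hE : NonCrossing E)
    (hw0 : w ≠ 0) (hw : GenericDir w E) (hS : S ⊆ E) {U : Set Plane} (hU : IsFace E U) {x y : Plane}
    (hx : x ∈ U) (hy : y ∈ U) : parity w S x = parity w S y :=
  hSe.parity_eq hw0 (hw.mono hS) (fun e he => hE.not_isDiag e (hS he)) hU.isPreconnected
    (fun _ hz ⟨f, hf, hzf⟩ => hU.notMem_tr hz ⟨f, hS hf, hzf⟩) hx hy

/-- One side of the wire is `U`, inside `L`. As the wire is not in `L`, its other side is inside as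
well. -/
lemma parity_up_of_mem_bdry (hE : NonCrossing E) (hw0 : w ≠ 0) (hw : GenericDir w E)
    (hs : IsSides E w up dn) {L : Finset (Sym2 Plane)} (hL : EvenSet L) (hLE : L ⊆ E) {U : Set Plane}
    (hpar : ∀ x ∈ U, parity w L x = 1) {e : Sym2 Plane} (he : e ∈ bdry E up dn U) (heL : e ∉ L) :
    ∀ x ∈ up e, parity w L x = 1 := by
  intro x hx
  obtain ⟨heE, h⟩ := mem_bdry.1 he
  by_cases hup : up e = U
  · exact hpar x (hup ▸ hx)
  · have hdn : dn e = U := by tauto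
    obtain ⟨y, hy⟩ := (hs.dn_face e heE).nonempty
    have h1 := hL.parity_add_parity hE hw0 hw hLE hs heE hx hy
    rw [if_neg heL] at h1
    rw [CharTwo.add_eq_zero.1 h1]
    exact hpar y (hdn ▸ hy)

/-- Exactly one of the two faces at an edge of `L` has odd parity, and it is bounded. Its boundary
is an even set of wires that are in `L` or inside it, so it meets `L` in an even set containing the
given edge. An even nonempty part of a loop is the whole loop. -/
lemma IsPrimeLoop.exists_face (hE : NonCrossing E) (hw0 : w ≠ 0) (hw : GenericDir w E)
    (hs : IsSides E w up dn) {L : Finset (Sym2 Plane)} (hL : IsPrimeLoop E w up L) :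
    ∃ U, IsFace E U ∧ Bornology.IsBounded U ∧ (∀ x ∈ U, parity w L x = 1) ∧
      L ⊆ bdry E up dn U := by
  classical
  obtain ⟨e₀, he₀⟩ := hL.nonempty
  have heE := hL.subset he₀
  have hone : ∀ c : ZMod 2, c ≠ 0 → c = 1 := by decide
  have hflip : ∀ x ∈ up e₀, ∀ y ∈ dn e₀, parity w L x + parity w L y = 1 := fun x hx y hy => by
    rw [hL.even.parity_add_parity hE hw0 hw hL.subset hs heE hx hy, if_pos he₀]
  obtain ⟨x, hx⟩ := (hs.up_face _ heE).nonempty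
  obtain ⟨y, hy⟩ := (hs.dn_face _ heE).nonempty
  have hne : up e₀ ≠ dn e₀ := by
    intro h
    have h1 := hflip x hx x (h ▸ hx)
    rw [CharTwo.add_self_eq_zero] at h1
    exact absurd h1 (by decide)
  obtain ⟨U, hU, x, hxU, hx1, hUe⟩ : ∃ U, IsFace E U ∧ ∃ x ∈ U, parity w L x = 1 ∧
      ¬ (up e₀ = U ↔ dn e₀ = U) := by
    by_cases h : parity w L x = 0
    · have h1 := hflip x hx y hy
      rw [h, zero_add] at h1
      exact ⟨_, hs.dn_face _ heE, y, hy, h1, by simp [hne]⟩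
    · exact ⟨_, hs.up_face _ heE, x, hx, hone _ h, by simp [hne.symm]⟩
  have hpar : ∀ z ∈ U, parity w L z = 1 := fun z hz => by
    rw [hL.even.parity_eq_of_face hE hw0 hw hL.subset hU hz hxU, hx1]
  have hxL : ∀ z ∈ U, z ∉ tr L := fun z hz ⟨f, hf, hzf⟩ => hU.notMem_tr hz ⟨f, hL.subset hf, hzf⟩
  have hb : Bornology.IsBounded U := by
    refine (hL.even.isBounded hw0 (hw.mono hL.subset) (fun e he => hE.not_isDiag e (hL.subset he))
      (hxL x hxU) (by rw [hx1]; decide)).subset ?_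
    exact hU.isPreconnected.subset_connectedComponentIn hxU hxL
  refine ⟨U, hU, hb, hpar, ?_⟩
  have heven := hL.inter_even (bdry E up dn U) (fun e he => (mem_bdry.1 he).1)
    (evenSet_bdry hE hw0 hw hs hU hb)
    (fun e he heL => parity_up_of_mem_bdry hE hw0 hw hs hL.even hL.subset hpar he heL)
  have := hL.eq_of_even _ Finset.inter_subset_right heven
    ⟨e₀, Finset.mem_inter.2 ⟨mem_bdry.2 ⟨heE, hUe⟩, he₀⟩⟩
  rw [← this]
  exact Finset.inter_subset_left

/-- Since `L'` bounds a face inside `L`, the set `L' ∩ L` is even, and if it is not empty both loops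
equal it. Two disjoint loops around the same face would each have the wires of the other inside,
which fails for a topmost wire. -/
lemma IsPrimeLoop.eq_of_face (hE : NonCrossing E) (hw0 : w ≠ 0) (hw : GenericDir w E)
    (hs : IsSides E w up dn) {L L' : Finset (Sym2 Plane)} (hL : IsPrimeLoop E w up L)
    (hL' : IsPrimeLoop E w up L') {U : Set Plane}
    (h1 : ∀ x ∈ U, parity w L x = 1) (h1' : ∀ x ∈ U, parity w L' x = 1)
    (h2 : L ⊆ bdry E up dn U) (h2' : L' ⊆ bdry E up dn U) : L = L' := by
  classical
  have heven := hL.inter_even L' hL'.subset hL'.even fun e he heL =>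
    parity_up_of_mem_bdry hE hw0 hw hs hL.even hL.subset h1 (h2' he) heL
  by_cases hne : (L' ∩ L).Nonempty
  · rw [← hL.eq_of_even _ Finset.inter_subset_right heven hne]
    exact hL'.eq_of_even _ Finset.inter_subset_left heven hne
  exfalso
  rw [Finset.not_nonempty_iff_eq_empty] at hne
  have hdisj : ∀ e, e ∈ L → e ∉ L' := fun e he he' => by
    have : e ∈ L' ∩ L := Finset.mem_inter.2 ⟨he', he⟩
    rw [hne] at this
    exact absurd this (Finset.notMem_empty e)
  obtain ⟨e₀, he₀⟩ := hL.nonempty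
  have heE := hL.subset he₀
  obtain ⟨z₀, hz₀, -, hv₀⟩ := exists_mem_seg_notMem E (hE.not_isDiag _ heE) (hw.ne hE heE)
  have hLE : L ∪ L' ⊆ E := Finset.union_subset hL.subset hL'.subset
  have hfin : {l : ℝ | z₀ + l • w ∈ tr (L ∪ L')}.Finite :=
    (finite_line_inter hE hw z₀).subset fun l ⟨f, hf, h⟩ => ⟨f, hLE hf, h⟩
  -- The last point of `L ∪ L'` on a generic line of direction `w`. Above it no wire of either loop
  -- follows, so both parities are zero there.
  obtain ⟨s, hst, hmax⟩ := Set.exists_max_image _ id hfin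
    ⟨0, e₀, Finset.mem_union_left _ he₀, by simpa using hz₀⟩
  obtain ⟨e, he, hze⟩ := hst
  have hze' : z₀ + s • w ∉ e := fun h => hv₀ e (hLE he) _ h (by
    rw [cr_add_right, cr_smul_right, cr_self]; ring)
  have htop : ∀ {K : Finset (Sym2 Plane)}, K ⊆ L ∪ L' →
      ¬ ∀ x ∈ up e, parity w K x = 1 := by
    intro K hK hpar
    obtain ⟨ε, hmem, h0⟩ := ((hs.up_side e (hLE he) _ hze hze').and self_mem_nhdsWithin).exists
    replace h0 : 0 < ε := h0
    obtain ⟨f, hf, hbelow⟩ := Finset.exists_ne_zero_of_sum_ne_zero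
      (show parity w K _ ≠ 0 by rw [hpar _ hmem]; decide)
    have hB : Below w f (z₀ + s • w + ε • w) := by
      by_contra h
      exact hbelow (if_neg h)
    obtain ⟨r, hr, hrf⟩ := hB.exists_above
    have := hmax (s + ε + r) ⟨f, hK hf, by
      rwa [show z₀ + (s + ε + r) • w = z₀ + s • w + ε • w + r • w by module]⟩
    simp only [id] at this
    linarith
  rcases Finset.mem_union.1 he with heL | heL
  · exact htop Finset.subset_union_right
      (parity_up_of_mem_bdry hE hw0 hw hs hL'.even hL'.subset h1' (h2 heL) (hdisj e heL))
  · exact htop Finset.subset_union_left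
      (parity_up_of_mem_bdry hE hw0 hw hs hL.even hL.subset h1 (h2' heL) fun h => hdisj e h heL)

end Loops

/-! ### Even sets of edges in graphs -/

section Graphs

variable {V : Type*} {G : SimpleGraph V}

open Classical in
lemma sum_inc_edges {u v : V} (p : G.Walk u v) (x : V) :
    (p.edges.map (inc x)).sum = (if x = u then 1 else 0) + if x = v then 1 else 0 := by
  induction p with
  | nil => simp [CharTwo.add_self_eq_zero]
  | @cons a b c h p ih =>
    rw [SimpleGraph.Walk.edges_cons, List.map_cons, List.sum_cons, ih]
    have hab := h.ne
    simp only [inc, Sym2.mem_iff]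
    by_cases h1 : x = a
    · have h2 : x ≠ b := fun h2 => hab (h1.symm.trans h2)
      simp [h1, hab]
    · by_cases h2 : x = b
      · subst h2
        simp [h1, ← add_assoc, CharTwo.add_self_eq_zero]
      · simp [h1, h2]

/-- A set of edges of a path with even degrees is empty. -/
lemma eq_empty_of_even_of_isPath {u v : V} (p : G.Walk u v) (hp : p.IsPath) {M : Finset (Sym2 V)}
    (hM : ∀ e ∈ M, e ∈ p.edges) (heven : ∀ v, ∑ e ∈ M, inc v e = 0) : M = ∅ := by
  classical
  induction p with
  | nil => exact Finset.eq_empty_of_forall_notMem fun e he => by simpa using hM e he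
  | @cons a b c h p ih =>
    rw [SimpleGraph.Walk.cons_isPath_iff] at hp
    refine ih hp.1 fun e he => ?_
    have h1 := hM e he
    rw [SimpleGraph.Walk.edges_cons, List.mem_cons] at h1
    refine h1.resolve_left ?_
    rintro rfl
    have h2 := heven a
    rw [Finset.sum_eq_single_of_mem _ he] at h2
    · rw [inc, if_pos (by simp)] at h2
      exact one_ne_zero h2
    · intro f hf hne
      have h3 := hM f hf
      rw [SimpleGraph.Walk.edges_cons, List.mem_cons] at h3
      refine if_neg fun haf => hp.2 ?_
      exact SimpleGraph.Walk.mem_support_of_mem_edges (h3.resolve_left hne) haf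

lemma even_edges_of_isCycle [DecidableEq V] {u : V} {c : G.Walk u u} (hc : c.IsCycle) (v : V) :
    ∑ e ∈ c.edges.toFinset, inc v e = 0 := by
  rw [List.sum_toFinset _ hc.isTrail.edges_nodup, sum_inc_edges, CharTwo.add_self_eq_zero]

/-- Without its first edge the cycle is a path, which has no even set of edges but the empty one.
Either `M` or its complement in the cycle avoids that edge. -/
lemma eq_of_even_of_isCycle [DecidableEq V] {u : V} {c : G.Walk u u} (hc : c.IsCycle)
    {M : Finset (Sym2 V)} (hM : M ⊆ c.edges.toFinset) (heven : ∀ v, ∑ e ∈ M, inc v e = 0)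
    (hne : M.Nonempty) : M = c.edges.toFinset := by
  have hL := even_edges_of_isCycle hc
  cases c with
  | nil => simp at hc
  | @cons _ b _ h p =>
    have hp := (SimpleGraph.Walk.cons_isCycle_iff p h).1 hc
    have key : ∀ K ⊆ (SimpleGraph.Walk.cons h p).edges.toFinset, (∀ v, ∑ e ∈ K, inc v e = 0) →
        s(u, b) ∉ K → K = ∅ := fun K hK hKe hnot =>
      eq_empty_of_even_of_isPath p hp.1 (fun e he => by
        have := hK he
        rw [List.mem_toFinset, SimpleGraph.Walk.edges_cons, List.mem_cons] at this
        exact this.resolve_left (by rintro rfl; exact hnot he)) hKe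
    by_cases hmem : s(u, b) ∈ M
    · have := key _ (Finset.sdiff_subset (t := M)) (fun v => by
        have h1 := Finset.sum_sdiff hM (f := inc v)
        rwa [heven v, add_zero, hL v] at h1) (fun h => (Finset.mem_sdiff.1 h).2 hmem)
      exact Finset.Subset.antisymm hM (Finset.sdiff_eq_empty_iff_subset.1 this)
    · exact absurd (key M hM heven hmem) hne.ne_empty

/-- The sum of the degrees over a connected component is even. -/
lemma exists_reachable_odd {A : Finset (Sym2 V)} (hd : ∀ e ∈ A, ¬ e.IsDiag)
    (hG : ∀ p q, s(p, q) ∈ A → G.Adj p q) {v : V} (hv : ∑ e ∈ A, inc v e ≠ 0) :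
    ∃ u, u ≠ v ∧ G.Reachable v u ∧ ∑ e ∈ A, inc u e ≠ 0 := by
  classical
  set T := {u ∈ A.biUnion Sym2.toFinset | G.Reachable v u} with hT
  have hvT : v ∈ T := by
    obtain ⟨e, he, hne⟩ := Finset.exists_ne_zero_of_sum_ne_zero hv
    refine Finset.mem_filter.2 ⟨Finset.mem_biUnion.2 ⟨e, he, ?_⟩, SimpleGraph.Reachable.refl v⟩
    rw [Sym2.mem_toFinset]
    by_contra h
    exact hne (if_neg h)
  -- Handshake: an edge has both ends in the component of `v` or none, so an odd degree at `v`
  -- forces another odd degree there.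
  have hsum : ∑ u ∈ T, ∑ e ∈ A, inc u e = 0 := by
    rw [Finset.sum_comm]
    refine Finset.sum_eq_zero fun e he => ?_
    induction e with | _ p q => ?_
    have hpq : p ≠ q := fun h => hd _ he (by rwa [Sym2.mk_isDiag_iff])
    have hadj := hG p q he
    have hinc : ∀ u, inc u s(p, q) = (if u = p then 1 else 0) + if u = q then 1 else 0 := by
      intro u
      simp only [inc, Sym2.mem_iff]
      by_cases h1 : u = p
      · subst h1; simp [hpq]
      · simp [h1]
    simp only [hinc, Finset.sum_add_distrib, Finset.sum_ite_eq']
    have hpT : p ∈ T ↔ q ∈ T := by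
      have hpA : p ∈ A.biUnion Sym2.toFinset :=
        Finset.mem_biUnion.2 ⟨_, he, Sym2.mem_toFinset.2 (by simp)⟩
      have hqA : q ∈ A.biUnion Sym2.toFinset :=
        Finset.mem_biUnion.2 ⟨_, he, Sym2.mem_toFinset.2 (by simp)⟩
      rw [hT, Finset.mem_filter, Finset.mem_filter, and_iff_right hpA, and_iff_right hqA]
      exact ⟨fun h => h.trans hadj.reachable, fun h => h.trans hadj.symm.reachable⟩
    by_cases h : p ∈ T
    · rw [if_pos h, if_pos (hpT.1 h)]; exact CharTwo.add_self_eq_zero _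
    · rw [if_neg h, if_neg (fun h' => h (hpT.2 h')), add_zero]
  by_contra hcon
  push Not at hcon
  rw [Finset.sum_eq_single_of_mem v hvT fun u hu hne =>
    hcon u hne (Finset.mem_filter.1 hu).2] at hsum
  exact hv hsum

/-- A shortest path between two different points of a set. -/
lemma exists_isPath_between {A : Set V} {a b : V} (ha : a ∈ A) (hb : b ∈ A) (hab : a ≠ b)
    (h : G.Reachable a b) : ∃ a ∈ A, ∃ b ∈ A, a ≠ b ∧ ∃ p : G.Walk a b, p.IsPath ∧
      ∀ x ∈ p.support, x ∈ A → x = a ∨ x = b := by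
  classical
  obtain ⟨p₀⟩ := h
  have hex : ∃ n, ∃ a ∈ A, ∃ b ∈ A, a ≠ b ∧ ∃ p : G.Walk a b, p.length = n :=
    ⟨_, a, ha, b, hb, hab, p₀, rfl⟩
  obtain ⟨a, ha, b, hb, hab, p, hp⟩ := Nat.find_spec hex
  have hmin : ∀ x ∈ A, ∀ y ∈ A, x ≠ y → ∀ q : G.Walk x y, p.length ≤ q.length :=
    fun x hx y hy hxy q => by
      rw [hp]
      exact Nat.find_min' hex ⟨x, hx, y, hy, hxy, q, rfl⟩
  refine ⟨a, ha, b, hb, hab, p.bypass, p.bypass_isPath, fun x hx hxA => ?_⟩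
  by_contra hcon
  push Not at hcon
  have h1 := hmin a ha x hxA (Ne.symm hcon.1) (p.bypass.takeUntil x hx)
  have h2 := p.bypass.length_takeUntil_lt_length hx hcon.2
  have h3 := p.length_bypass_le_length
  omega

/-- A path joining two vertices of a cycle splits it into two cycles. -/
lemma exists_cycles_of_chord [DecidableEq V] {a b : V} {c : G.Walk a a} (hc : c.IsCycle)
    (hb : b ∈ c.support) (hab : a ≠ b) {p : G.Walk a b} (hp : p.IsPath)
    (hsupp : ∀ x ∈ p.support, x ∈ c.support → x = a ∨ x = b)
    (hedges : ∀ e ∈ p.edges, e ∉ c.edges) :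
    ∃ c₁ c₂ : G.Walk a a, c₁.IsCycle ∧ c₂.IsCycle ∧
      (∀ e ∈ c₁.edges, e ∈ c.edges ∨ e ∈ p.edges) ∧ (∀ e ∈ c₂.edges, e ∈ c.edges ∨ e ∈ p.edges) ∧
      {e | e ∈ c.edges} = symmDiff {e | e ∈ c₁.edges} {e | e ∈ c₂.edges} := by
  set p₁ := c.takeUntil b hb with hp₁
  set p₂ := c.dropUntil b hb with hp₂
  have hspec : p₁.append p₂ = c := c.take_spec hb
  have hce : ∀ e, e ∈ c.edges ↔ e ∈ p₁.edges ∨ e ∈ p₂.edges := fun e => by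
    rw [← hspec, SimpleGraph.Walk.edges_append, List.mem_append]
  have hcs : ∀ x, x ∈ c.support ↔ x ∈ p₁.support ∨ x ∈ p₂.support := fun x => by
    rw [← hspec, SimpleGraph.Walk.mem_support_append_iff]
  have hcyc : (p₁.append p₂).IsCycle := hspec.symm ▸ hc
  have hnil : ∀ {x y : V} (q : G.Walk x y), x ≠ y → ¬ q.Nil := fun q hxy h => hxy h.eq
  have hpath₁ : p₁.IsPath := hcyc.isPath_of_append_left (hnil _ hab.symm)
  have hpath₂ : p₂.IsPath := hcyc.isPath_of_append_right (hnil _ hab)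
  have htail : ∀ {x y : V} (q : G.Walk x y), q.IsPath → ∀ z ∈ q.support.tail,
      z ∈ q.support ∧ z ≠ x := by
    intro x y q hq z hz
    refine ⟨List.mem_of_mem_tail hz, ?_⟩
    rintro rfl
    have := hq.support_nodup
    rw [← SimpleGraph.Walk.cons_tail_support, List.nodup_cons] at this
    exact this.1 hz
  -- Two edge-disjoint walks from `a` to `b` cannot both be the single edge, so together they are
  -- long enough for a cycle.
  have hlong : ∀ {q r : G.Walk a b}, (∀ e ∈ q.edges, e ∉ r.edges) → 1 < q.length ∨ 1 < r.length := by
    intro q r hqr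
    by_contra hcon
    push Not at hcon
    have hone : ∀ q : G.Walk a b, q.length ≤ 1 → s(a, b) ∈ q.edges := by
      intro q hq
      cases q with
      | nil => exact absurd rfl hab
      | cons h q =>
        cases q with
        | nil => simp
        | cons h' q => simp at hq
    exact hqr _ (hone q hcon.1) (hone r hcon.2)
  have hdisj : ∀ e ∈ p₁.edges, e ∉ p₂.edges := fun e h1 h2 =>
    hc.isTrail.disjoint_edges_takeUntil_dropUntil hb h1 h2
  refine ⟨p₁.append p.reverse, p.append p₂, ?_, ?_, ?_, ?_, ?_⟩
  · refine hpath₁.isCycle_append hp.reverse ?_ ?_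
    · intro x hx hx'
      obtain ⟨h1, h2⟩ := htail _ hpath₁ x hx
      obtain ⟨h3, h4⟩ := htail _ hp.reverse x hx'
      rw [SimpleGraph.Walk.support_reverse, List.mem_reverse] at h3
      rcases hsupp x h3 ((hcs x).2 (Or.inl h1)) with h | h
      · exact h2 h
      · exact h4 h
    · rw [SimpleGraph.Walk.length_reverse]
      exact hlong fun e h1 h2 => hedges e h2 ((hce e).2 (Or.inl h1))
  · refine hp.isCycle_append hpath₂ ?_ ?_
    · intro x hx hx'
      obtain ⟨h1, h2⟩ := htail _ hp x hx
      obtain ⟨h3, h4⟩ := htail _ hpath₂ x hx'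
      rcases hsupp x h1 ((hcs x).2 (Or.inr h3)) with h | h
      · exact h2 h
      · exact h4 h
    · rw [← SimpleGraph.Walk.length_reverse p₂]
      refine hlong fun e h1 h2 => hedges e h1 ((hce e).2 (Or.inr ?_))
      rwa [SimpleGraph.Walk.edges_reverse, List.mem_reverse] at h2
  · intro e he
    rw [SimpleGraph.Walk.edges_append, List.mem_append, SimpleGraph.Walk.edges_reverse,
      List.mem_reverse] at he
    rw [hce]; tauto
  · intro e he
    rw [SimpleGraph.Walk.edges_append, List.mem_append] at he
    rw [hce]; tauto
  · ext e
    have h1 := hdisj e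
    have h2 : e ∈ p.edges → e ∉ p₁.edges ∧ e ∉ p₂.edges := fun h =>
      ⟨fun h' => hedges e h ((hce e).2 (Or.inl h')), fun h' => hedges e h ((hce e).2 (Or.inr h'))⟩
    rw [Set.mem_symmDiff]
    change e ∈ c.edges ↔ (e ∈ (p₁.append p.reverse).edges ∧ ¬ e ∈ (p.append p₂).edges) ∨
      (e ∈ (p.append p₂).edges ∧ ¬ e ∈ (p₁.append p.reverse).edges)
    rw [hce, SimpleGraph.Walk.edges_append, List.mem_append, SimpleGraph.Walk.edges_append,
      List.mem_append, SimpleGraph.Walk.edges_reverse, List.mem_reverse]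
    tauto

end Graphs

/-! ### Minimal and elementary loops -/

section WebLoops

variable {E : Finset (Sym2 Plane)} {w : Plane} {up dn : Sym2 Plane → Set Plane} {W : Web}

lemma trace_eq_tr (L : Finset (Sym2 Plane)) : Web.trace (L : Set (Sym2 Plane)) = tr L := by
  ext x
  constructor
  · rintro ⟨p, q, h, hx⟩
    exact ⟨s(p, q), h, hx⟩
  · rintro ⟨e, he, hx⟩
    induction e with | _ p q => exact ⟨p, q, he, hx⟩

lemma notMem_tr_of_notMem (hE : NonCrossing E) {L : Finset (Sym2 Plane)} (hL : L ⊆ E)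
    {e : Sym2 Plane} (he : e ∈ E) (heL : e ∉ L) {z : Plane} (hz : z ∈ seg e) (hz' : z ∉ e) :
    z ∉ tr L := by
  rintro ⟨f, hf, hzf⟩
  exact hz' (hE.mem e he f (hL hf) (by rintro rfl; exact heL hf) z hz hzf)

/-- Wires with odd parity on one side lie in the closed region bounded by the loop. -/
lemma mem_tr_or_mem_inside (hE : NonCrossing E) (hw0 : w ≠ 0) (hw : GenericDir w E)
    (hs : IsSides E w up dn) {L : Finset (Sym2 Plane)} (hLe : EvenSet L) (hL : L ⊆ E)
    {e : Sym2 Plane} (he : e ∈ E) (heL : e ∉ L) (hup : ∀ x ∈ up e, parity w L x = 1) {x : Plane}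
    (hx : x ∈ seg e) (hxL : x ∉ tr L) : x ∈ Web.inside (L : Set (Sym2 Plane)) := by
  have hd : ∀ f ∈ L, ¬ f.IsDiag := fun f hf => hE.not_isDiag f (hL hf)
  have hloc : ∀ {z}, z ∉ tr L → ∀ᶠ y in 𝓝 z, parity w L y = parity w L z := fun hz =>
    hLe.eventually_parity_eq hw0 (hw.mono hL) hd hz
  have hopen : ∀ z ∈ seg e, z ∉ e → parity w L z = 1 := by
    intro z hz hz'
    obtain ⟨ε, h1, h2⟩ := ((hs.up_side e he z hz hz').and ((tendsto_add_smul z w).eventually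
      (hloc (notMem_tr_of_notMem hE hL he heL hz hz')))).exists
    rw [← h2]
    exact hup _ h1
  have hpx : parity w L x = 1 := by
    by_cases hxe : x ∈ e
    · obtain ⟨q, rfl⟩ := hxe
      have hq : x ≠ q := fun h => hE.not_isDiag _ he (by rwa [Sym2.mk_isDiag_iff])
      obtain ⟨ε, h1, h2⟩ := (((tendsto_add_smul x (q - x)).eventually (hloc hxL)).and
        (Ioo_mem_nhdsGT (zero_lt_one (α := ℝ)))).exists
      rw [← h1]
      refine hopen _ (mem_segment_iff_smul.2 ⟨ε, h2.1.le, h2.2.le, rfl⟩) ?_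
      have hqx := sub_ne_zero.2 hq.symm
      rw [Sym2.mem_iff]
      rintro (h | h)
      · exact hqx ((smul_eq_zero.1 (add_eq_left.1 h)).resolve_left h2.1.ne')
      · have : (1 - ε) • (q - x) = 0 := by
          have e : (1 - ε) • (q - x) = q - (x + ε • (q - x)) := by module
          rw [e, h, sub_self]
        exact hqx ((smul_eq_zero.1 this).resolve_left (by linarith [h2.2]))
    · exact hopen x hx hxe
  refine ⟨by rwa [trace_eq_tr], ?_⟩
  rw [trace_eq_tr]
  exact hLe.isBounded hw0 (hw.mono hL) hd hxL (by rw [hpx]; decide)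

/-- Wires inside the loop, other than its own, are forbidden, so an admissible `M` is contained in
the loop and `M ∩ L = M` is even. -/
lemma isPrimeLoop_of_isMinimalLoop (hE : NonCrossing E) (hw0 : w ≠ 0) (hw : GenericDir w E)
    (hs : IsSides E w up dn) (hG : ∀ p q, W.graph.Adj p q ↔ s(p, q) ∈ E)
    {L : Set (Sym2 Plane)} (hL : W.IsMinimalLoop L) :
    ∃ K : Finset (Sym2 Plane), L = K ∧ IsPrimeLoop E w up K := by
  classical
  obtain ⟨⟨p, c, hc, rfl⟩, hmin⟩ := hL
  have hcE : ∀ e ∈ c.edges, e ∈ E := by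
    intro e he
    have := c.edges_subset_edgeSet he
    induction e with | _ p q => exact (hG p q).1 this
  have hKE : c.edges.toFinset ⊆ E := fun e he => hcE e (List.mem_toFinset.1 he)
  have hKeven : EvenSet c.edges.toFinset := even_edges_of_isCycle hc
  have hcoe : {e | e ∈ c.edges} = ((c.edges.toFinset : Finset (Sym2 Plane)) : Set _) :=
    (List.coe_toFinset c.edges).symm
  refine ⟨c.edges.toFinset, hcoe, hKE, hKeven, ?_, fun M hM hMe hne =>
    eq_of_even_of_isCycle hc hM hMe hne, fun M hME hMe hcond => ?_⟩
  · rw [List.toFinset_nonempty_iff]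
    exact fun h => hc.ne_nil (SimpleGraph.Walk.edges_eq_nil.1 h).eq_nil
  · have hML : M ⊆ c.edges.toFinset := by
      intro e he
      by_contra heL
      have heE := hME he
      obtain ⟨z, hz, hz', -⟩ := exists_mem_seg_notMem E (hE.not_isDiag e heE) (hw.ne hE heE)
      have hins := mem_tr_or_mem_inside hE hw0 hw hs hKeven hKE heE heL (hcond e he heL) hz
        (notMem_tr_of_notMem hE hKE heE heL hz hz')
      rw [← hcoe] at hins
      induction e with | _ a b => ?_
      exact (Set.disjoint_left.1 (hmin a b ((hG a b).2 heE) (fun h => heL (List.mem_toFinset.2 h))))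
        hz hins
    rwa [Finset.inter_eq_left.2 hML]

/-- If `M ∩ L` were not even, `M \ L` would have a vertex of odd degree. All such vertices lie on
the loop, and a component contains a second one. A shortest path in `M \ L` between two vertices of
the loop is then a chord within the closed region, and it subdivides the loop. -/
lemma isPrimeLoop_of_isElementaryLoop (hE : NonCrossing E) (hw0 : w ≠ 0) (hw : GenericDir w E)
    (hs : IsSides E w up dn) (hG : ∀ p q, W.graph.Adj p q ↔ s(p, q) ∈ E)
    {L : Set (Sym2 Plane)} (hL : W.IsElementaryLoop L) :
    ∃ K : Finset (Sym2 Plane), L = K ∧ IsPrimeLoop E w up K := by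
  classical
  obtain ⟨⟨p, c, hc, rfl⟩, hmin⟩ := hL
  have hcE : ∀ e ∈ c.edges, e ∈ E := by
    intro e he
    have := c.edges_subset_edgeSet he
    induction e with | _ p q => exact (hG p q).1 this
  have hKE : c.edges.toFinset ⊆ E := fun e he => hcE e (List.mem_toFinset.1 he)
  have hKeven : EvenSet c.edges.toFinset := even_edges_of_isCycle hc
  have hcoe : {e | e ∈ c.edges} = ((c.edges.toFinset : Finset (Sym2 Plane)) : Set _) :=
    (List.coe_toFinset c.edges).symm
  refine ⟨c.edges.toFinset, hcoe, hKE, hKeven, ?_, fun M hM hMe hne =>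
    eq_of_even_of_isCycle hc hM hMe hne, fun M hME hMe hcond => ?_⟩
  · rw [List.toFinset_nonempty_iff]
    exact fun h => hc.ne_nil (SimpleGraph.Walk.edges_eq_nil.1 h).eq_nil
  by_contra hodd
  obtain ⟨v, hv⟩ : ∃ v, ∑ e ∈ M ∩ c.edges.toFinset, inc v e ≠ 0 := by
    by_contra h
    push Not at h
    exact hodd h
  -- Since `M` is even, its parts on and off the loop have odd degree at the same vertices, and
  -- these are vertices of the loop.
  have hsplit : ∀ v, ∑ e ∈ M \ c.edges.toFinset, inc v e = ∑ e ∈ M ∩ c.edges.toFinset, inc v e := by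
    intro v
    have h1 := Finset.sum_inter_add_sum_sdiff M c.edges.toFinset (inc v)
    rw [hMe v] at h1
    exact (CharTwo.add_eq_zero.1 h1).symm
  set A := M \ c.edges.toFinset with hA
  have hAE : ∀ e ∈ A, e ∈ E ∧ e ∉ c.edges := fun e he =>
    ⟨hME (Finset.mem_sdiff.1 he).1, fun h => (Finset.mem_sdiff.1 he).2 (List.mem_toFinset.2 h)⟩
  have hsupp : ∀ u, ∑ e ∈ A, inc u e ≠ 0 → u ∈ c.support := by
    intro u hu
    rw [hsplit] at hu
    obtain ⟨e, he, hne⟩ := Finset.exists_ne_zero_of_sum_ne_zero hu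
    have hue : u ∈ e := by
      by_contra h
      exact hne (if_neg h)
    exact SimpleGraph.Walk.mem_support_of_mem_edges
      (List.mem_toFinset.1 (Finset.mem_inter.1 he).2) hue
  have hAG : ∀ e ∈ A, e ∈ W.graph.edgeSet := by
    intro e he
    induction e with | _ p q => exact (hG p q).2 (hAE _ he).1
  set GA : SimpleGraph Plane := SimpleGraph.fromEdgeSet (A : Set (Sym2 Plane)) with hGA
  have hGAadj : ∀ p q, s(p, q) ∈ A → GA.Adj p q := by
    intro p q h
    rw [hGA, SimpleGraph.fromEdgeSet_adj]
    exact ⟨h, ((hG p q).2 (hAE _ h).1).ne⟩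
  have hle : GA ≤ W.graph := by
    intro p q h
    rw [hGA, SimpleGraph.fromEdgeSet_adj] at h
    exact hAG _ h.1
  rw [← hsplit] at hv
  obtain ⟨u, huv, hreach, hu⟩ := exists_reachable_odd
    (fun e he => hE.not_isDiag e (hAE e he).1) hGAadj hv
  obtain ⟨a, ha, b, hb, hab, q, hq, hqs⟩ := exists_isPath_between (A := {x | x ∈ c.support})
    (hsupp v hv) (hsupp u hu) huv.symm hreach
  have hqA : ∀ e ∈ q.edges, e ∈ A := by
    intro e he
    have := q.edges_subset_edgeSet he
    rw [hGA, SimpleGraph.edgeSet_fromEdgeSet] at this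
    exact this.1
  have hrot : ∀ e, e ∈ (c.rotate a ha).edges ↔ e ∈ c.edges := fun e =>
    (c.rotate_edges a ha).mem_iff
  have hrots : ∀ x, x ∈ (c.rotate a ha).support ↔ x ∈ c.support := by
    intro x
    have h := congrArg (fun d : W.graph.Walk p p => x ∈ d.support) (c.take_spec ha)
    simp only [SimpleGraph.Walk.mem_support_append_iff] at h
    rw [SimpleGraph.Walk.rotate, SimpleGraph.Walk.mem_support_append_iff, ← h, or_comm]
  obtain ⟨c₁, c₂, hc₁, hc₂, h1, h2, hsymm⟩ := exists_cycles_of_chord (hc.rotate ha)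
    ((hrots b).2 hb) hab (p := q.mapLe hle) (hq.mapLe hle)
    (fun x hx hxc => hqs x (by simpa using hx) ((hrots x).1 hxc))
    (fun e he hec => (hAE e (hqA e (by simpa using he))).2 ((hrot e).1 hec))
  have htrace : ∀ {d : W.graph.Walk a a}, (∀ e ∈ d.edges, e ∈ (c.rotate a ha).edges ∨
      e ∈ (q.mapLe hle).edges) → Web.trace {e | e ∈ d.edges} ⊆
      Web.trace {e | e ∈ c.edges} ∪ Web.inside {e | e ∈ c.edges} := by
    rintro d hd x ⟨p, r, hpr, hx⟩
    rcases hd _ hpr with h | h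
    · exact Or.inl ⟨p, r, (hrot _).1 h, hx⟩
    · have hmem : s(p, r) ∈ A := hqA _ (by simpa using h)
      obtain ⟨hM, hnot⟩ := Finset.mem_sdiff.1 hmem
      rw [hcoe, trace_eq_tr]
      by_cases hxt : x ∈ tr c.edges.toFinset
      · exact Or.inl hxt
      · exact Or.inr (mem_tr_or_mem_inside hE hw0 hw hs hKeven hKE (hME hM) hnot
          (hcond _ hM hnot) hx hxt)
  refine hmin ⟨_, _, ⟨a, c₁, hc₁, rfl⟩, ⟨a, c₂, hc₂, rfl⟩, htrace h1, htrace h2, ?_⟩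
  rw [← hsymm]
  ext e
  exact (hrot e).symm

end WebLoops

/-! ### The web of a net -/

section NetWeb

variable {N : ℕ} {X F : Fin N → Plane} {t : Sym2 Plane →₀ ℝ}

open Classical in
/-- The web with the wires of a net. -/
noncomputable def netWeb (X : Fin N → Plane) (t : Sym2 Plane →₀ ℝ) : Web where
  nodes := t.support.biUnion Sym2.toFinset ∪ Finset.univ.image X
  graph := SimpleGraph.fromEdgeSet (t.support : Set (Sym2 Plane))
  mem_nodes p q h := Finset.mem_union_left _ <| Finset.mem_biUnion.2
    ⟨s(p, q), (SimpleGraph.fromEdgeSet_adj _ |>.1 h).1, Sym2.mem_toFinset.2 (by simp)⟩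

lemma netWeb_adj (ht : IsNet X F t) (p q : Plane) :
    (netWeb X t).graph.Adj p q ↔ s(p, q) ∈ t.support := by
  rw [netWeb, SimpleGraph.fromEdgeSet_adj]
  exact ⟨fun h => h.1, fun h => ⟨h, fun hpq => ht.nonCrossing.not_isDiag _ h (by
    rwa [Sym2.mk_isDiag_iff])⟩⟩

lemma isAdmissibleStress_netWeb (ht : IsNet X F t) :
    (netWeb X t).IsAdmissibleStress X F (fun p q => t s(p, q)) := by
  classical
  refine ⟨fun i => Finset.mem_union_right _ (Finset.mem_image_of_mem _ (Finset.mem_univ i)),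
    fun p q _ => by rw [Sym2.eq_swap], fun p q h => (ht.pos _ ((netWeb_adj ht p q).1 h)).le,
    fun p _ => ?_⟩
  rw [← ht.balance p]
  congr 1
  have h1 : ∑ e ∈ t.support with p ∈ e, t e • pull p e = force p t := by
    rw [force_apply]
    refine Finset.sum_subset (Finset.filter_subset _ _) fun e he he' => ?_
    rw [pull_of_notMem fun h => he' (Finset.mem_filter.2 ⟨he, h⟩), smul_zero]
  have h2 : (t.support.filter fun e => p ∈ e) =
      ((netWeb X t).nodes.filter ((netWeb X t).graph.Adj p)).image fun q => s(p, q) := by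
    ext e
    simp only [Finset.mem_filter, Finset.mem_image]
    constructor
    · rintro ⟨he, q, rfl⟩
      have hadj := (netWeb_adj ht p q).2 he
      exact ⟨q, ⟨(netWeb X t).mem_nodes _ _ hadj.symm, hadj⟩, rfl⟩
    · rintro ⟨q, ⟨-, hq⟩, rfl⟩
      exact ⟨(netWeb_adj ht p q).1 hq, by simp⟩
  rw [← h1, h2, Finset.sum_image (fun a _ b _ h => Sym2.congr_right.1 h)]
  refine Finset.sum_congr rfl fun q hq => ?_
  rw [pull_left (Finset.mem_filter.1 hq).2.ne, udir, smul_smul, div_eq_mul_inv]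

lemma noCrossing_netWeb (ht : IsNet X F t)
    (hX : ∀ i, ∀ e ∈ t.support, X i ∈ seg e → X i ∈ e) : (netWeb X t).NoCrossing := by
  classical
  refine ⟨fun p q r s hpq hrs hne x hx => ?_, fun p q hpq x hx hxs => ?_⟩
  · rw [netWeb_adj ht] at hpq hrs
    have h1 := ht.nonCrossing.mem _ hpq _ hrs hne x hx.1 hx.2
    have h2 := ht.nonCrossing.mem _ hrs _ hpq hne.symm x hx.2 hx.1
    rw [Sym2.mem_iff] at h1 h2
    exact ⟨h1, h2⟩
  · rw [netWeb_adj ht] at hpq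
    rw [← Sym2.mem_iff]
    rcases Finset.mem_union.1 hx with h | h
    · obtain ⟨e, he, hxe⟩ := Finset.mem_biUnion.1 h
      exact ht.nonCrossing.mem_of_node hpq he (Sym2.mem_toFinset.1 hxe) hxs
    · obtain ⟨i, -, rfl⟩ := Finset.mem_image.1 h
      exact hX i _ hpq hxs

/-- A prime loop is sent to a bounded face inside it whose boundary contains it. This map is
injective by `IsPrimeLoop.eq_of_face`, so the bound on bounded faces applies. -/
lemma encard_loops_le (ht : IsNet X F t) (hcell : ∀ C nx, ¬ IsCell t.support C nx) {w : Plane}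
    {up dn : Sym2 Plane → Set Plane} (hw0 : w ≠ 0) (hw : GenericDir w t.support)
    (hs : IsSides t.support w up dn) (S : Set (Set (Sym2 Plane)))
    (hS : ∀ L ∈ S, ∃ K : Finset (Sym2 Plane), L = K ∧ IsPrimeLoop t.support w up K) :
    S.encard ≤ numInteriorTerminals X := by
  have hE := ht.nonCrossing
  have hex : ∀ L ∈ S, ∃ K : Finset (Sym2 Plane), ∃ U, L = K ∧ IsPrimeLoop t.support w up K ∧
      IsFace t.support U ∧ Bornology.IsBounded U ∧ (∀ x ∈ U, parity w K x = 1) ∧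
      K ⊆ bdry t.support up dn U := by
    intro L hL
    obtain ⟨K, hK, hprime⟩ := hS L hL
    obtain ⟨U, hU⟩ := hprime.exists_face hE hw0 hw hs
    exact ⟨K, U, hK, hprime, hU⟩
  choose! K U hK hprime hU hb hpar hsub using hex
  refine encard_le_of_injOn_faces ht hcell S U (fun L hL => ⟨hU L hL, hb L hL⟩) ?_
  intro L hL L' hL' h
  rw [hK L hL, hK L' hL', (hprime L hL).eq_of_face hE hw0 hw hs (hprime L' hL') (hpar L hL)
    (h ▸ hpar L' hL') (hsub L hL) (h ▸ hsub L' hL')]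

end NetWeb

end PlaneWeb

/-! ### The theorem, for the web of a net without convex cells -/

open PlaneWeb in
theorem mainTheorem6 (N : ℕ) (X F : Fin N → Plane) (W : Web) (hW : W.Supports X F) :
    ∃ (W' : Web) (σ : Plane → Plane → ℝ),
      W'.IsAdmissibleStress X F σ ∧
      (∀ p q, W'.graph.Adj p q → 0 < σ p q) ∧
      W'.NoCrossing ∧
      {L | W'.IsMinimalLoop L}.encard ≤ numInteriorTerminals X ∧
      {L | W'.IsElementaryLoop L}.encard ≤ numInteriorTerminals X := by
  obtain ⟨t, ht, hX, hcell⟩ := exists_isNet_no_cell X F W hW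
  obtain ⟨w, hw0, hw⟩ := exists_genericDir t.support
  obtain ⟨up, dn, hs⟩ := exists_isSides ht.nonCrossing hw
  refine ⟨netWeb X t, fun p q => t s(p, q), isAdmissibleStress_netWeb ht,
    fun p q h => ht.pos _ ((netWeb_adj ht p q).1 h), noCrossing_netWeb ht hX, ?_, ?_⟩
  · exact encard_loops_le ht hcell hw0 hw hs _ fun L hL =>
      isPrimeLoop_of_isMinimalLoop ht.nonCrossing hw0 hw hs (netWeb_adj ht) hL
  · exact encard_loops_le ht hcell hw0 hw hs _ fun L hL =>
      isPrimeLoop_of_isElementaryLoop ht.nonCrossing hw0 hw hs (netWeb_adj ht) hL
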